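/- **Setting.** Consider a layered medium with interfaces $z=d_0>d_1>\dots>d_{L-1}$ and layers $\ell=0,\dots,L$, where layer $\ell$ is $d_\ell<z<d_{\ell-1}$ (unbounded above for $\ell=0$ and below for $\ell=L$), with dielectric constants $\varepsilon_\ell>0$ and inverse Debye–Hückel lengths $\lambda_\ell>0$. For $\lambda_\rho>0$ put $\lambda_{\ell z}=\sqrt{\lambda_\ell^2+\lambda_\rho^2}$. The reaction densities $\sigma^{\mathfrak{ab}}_{\ell\ell'}(\lambda_\rho)$, $\mathfrak a,\mathfrak b\in\{1,2\}$ ($\mathfrak a=1$ only for $\ell<L$, $\mathfrak a=2$ only for $\ell>0$, $\mathfrak b=1$ only for $\ell'<L$, $\mathfrak b=2$ only for $\ell'>0$) are the functions determined by the following requirement. For each source height $z'$ in layer $\ell'$ the functions $$\hat u_{\ell\ell'}(z)=\frac{e^{-\lambda_{\ell z}(z-d_\ell)}}{2\lambda_{\ell z}}\psi^1_{\ell\ell'}+\frac{e^{-\lambda_{\ell z}(d_{\ell-1}-z)}}{2\lambda_{\ell z}}\psi^2_{\ell\ell'}+\delta_{\ell\ell'}\frac{e^{-\lambda_{\ell z}|z-z'|}}{2\varepsilon_\ell\lambda_{\ell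 z}},\qquad \psi^{\mathfrak a}_{\ell\ell'}=e^{-\lambda_{\ell'z}(z'-d_{\ell'})}\sigma^{\mathfrak a1}_{\ell\ell'}+e^{-\lambda_{\ell'z}(d_{\ell'-1}-z')}\sigma^{\mathfrak a2}_{\ell\ell'}$$ (terms with a non-existing $\sigma$ omitted) satisfy $\hat u_{j,\ell'}(d_j)=\hat u_{j+1,\ell'}(d_j)$ and $\varepsilon_j\hat u_{j,\ell'}'(d_j)=\varepsilon_{j+1}\hat u_{j+1,\ell'}'(d_j)$ at every interface $j=0,\dots,L-1$. For $\boldsymbol r=(x,y,z)$, write $\boldsymbol\rho=(x,y)$, and let $\boldsymbol\lambda_\alpha=\lambda_\rho(\cos\alpha,\sin\alpha)$. The reaction component for a target $\boldsymbol r$ in layer $\ell$ and a source $\boldsymbol r'$ in layer $\ell'$ is $$u^{\mathfrak{ab}}_{\ell\ell'}(\boldsymbol r,\boldsymbol r')=\frac1{8\pi^2}\int_0^\infty\!\!\int_0^{2\pi}\frac{\lambda_\rho}{\lambda_{\ell z}}\,e^{i\boldsymbol\lambda_\alpha\cdot(\boldsymbol\rho-\boldsymbol\rho')-\lambda_{\ell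 z}A_{\mathfrak a}-\lambda_{\ell'z}B_{\mathfrak b}}\,\sigma^{\mathfrak{ab}}_{\ell\ell'}(\lambda_\rho)\,d\alpha\,d\lambda_\rho,$$ with $A_1=z-d_\ell$, $A_2=d_{\ell-1}-z$, $B_1=z'-d_{\ell'}$, $B_2=d_{\ell'-1}-z'$. The equivalent polarization source is $\boldsymbol r'_{\mathfrak{ab}}=(x',y',z'_{\mathfrak{ab}})$ with $z'_{1\mathfrak b}=d_\ell-B_{\mathfrak b}$, $z'_{2\mathfrak b}=d_{\ell-1}+B_{\mathfrak b}$. For points $\boldsymbol r$ and $\boldsymbol s=(x_s,y_s,z_s)$ with $\boldsymbol\rho_s=(x_s,y_s)$ put $$\mathcal E^{1}(\boldsymbol r,\boldsymbol s)=e^{i\boldsymbol\lambda_\alpha\cdot(\boldsymbol\rho-\boldsymbol\rho_s)-\lambda_{\ell z}(z-d_\ell)-\lambda_{\ell'z}(d_\ell-z_s)},\qquad \mathcal E^{2}(\boldsymbol r,\boldsymbol s)=e^{i\boldsymbol\lambda_\alpha\cdot(\boldsymbol\rho-\boldsymbol\rho_s)-\lambda_{\ell z}(d_{\ell-1}-z)-\lambda_{\ell'z}(z_s-d_{\ell-1})},$$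 $$I^{\mathfrak{ab}}[g](\boldsymbol r,\boldsymbol s)=\int_0^\infty\!\!\int_0^{2\pi}\frac{\lambda_\rho}{\lambda_{\ell z}}\,\mathcal E^{\mathfrak a}(\boldsymbol r,\boldsymbol s)\,\sigma^{\mathfrak{ab}}_{\ell\ell'}(\lambda_\rho)\,g(\lambda_\rho,\alpha)\,d\alpha\,d\lambda_\rho,\qquad \tilde u^{\mathfrak{ab}}_{\ell\ell'}(\boldsymbol r,\boldsymbol s)=\frac1{8\pi^2}I^{\mathfrak{ab}}[1](\boldsymbol r,\boldsymbol s).$$ Let $i_n(x)=\sqrt{\pi/(2x)}\,I_{n+1/2}(x)$ be the modified spherical Bessel functions (extended by continuity to $x=0$), $\widehat P_n^m(w)=\sqrt{\frac{2n+1}{4\pi}\frac{(n-m)!}{(n+m)!}}\,(1-w^2)^{m/2}\frac{d^m}{dw^m}P_n(w)$ for $0\le m\le n$, $\widehat P_n^{-m}=(-1)^m\widehat P_n^m$, with $\sqrt{1-w^2}=-i\sqrt{w^2-1}$ for $w>1$, and $Y_n^m(\theta,\varphi)=\widehat P_n^m(\cos\theta)e^{im\varphi}$. Write $\widehat P_n^m[\ell]=\widehat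 P_n^m(\lambda_{\ell z}/\lambda_\ell)$. Put $s^{1}_{nm}=1$, $s^{2}_{nm}=(-1)^{n+m}$ and $t^1_{nm}=(-1)^n$, $t^2_{nm}=(-1)^m$. For a source center $\boldsymbol r_c$ and a target center $\boldsymbol r_c^t$, let $(r_s,\theta_s,\varphi_s)$ and $(r_t,\theta_t,\varphi_t)$ be the spherical coordinates of $\boldsymbol r'_{\mathfrak{ab}}-\boldsymbol r_c$ and $\boldsymbol r-\boldsymbol r_c^t$, and define $$M_{nm}=4\pi\, i_n(\lambda_{\ell'}r_s)\overline{Y_n^m(\theta_s,\varphi_s)},\qquad \widetilde{\mathcal F}_{nm}^{\mathfrak{ab}}(\boldsymbol r,\boldsymbol r_c)=\frac{s^{\mathfrak a}_{nm}}{8\pi^2}I^{\mathfrak{ab}}\big[\widehat P_n^m[\ell']e^{im\alpha}\big](\boldsymbol r,\boldsymbol r_c),$$ $$L_{nm}^{\mathfrak{ab}}=\frac{t^{\mathfrak a}_{nm}}{2\pi}I^{\mathfrak{ab}}\big[\widehat P_n^m[\ell]e^{-im\alpha}\big](\boldsymbol r_c^t,\boldsymbol r'_{\mathfrak{ab}}),\qquad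 T_{nm,\nu\mu}^{\mathfrak{ab}}=\frac{t^{\mathfrak a}_{nm}s^{\mathfrak a}_{\nu\mu}}{2\pi}I^{\mathfrak{ab}}\big[\widehat P_n^m[\ell]\,\widehat P_\nu^\mu[\ell']\,e^{i(\mu-m)\alpha}\big](\boldsymbol r_c^t,\boldsymbol r_c).$$ **Theorem.** Let $\boldsymbol r$ lie in layer $\ell$ and $\boldsymbol r'$ in layer $\ell'$, let $\mathfrak a,\mathfrak b$ be such that $\sigma^{\mathfrak{ab}}_{\ell\ell'}$ exists, and let the centers satisfy $z_c<d_\ell<z_c^t$ if $\mathfrak a=1$, and $z_c^t<d_{\ell-1}<z_c$ if $\mathfrak a=2$. Then: 1. the integrals defining $\tilde u^{\mathfrak{ab}}_{\ell\ell'}(\boldsymbol r,\boldsymbol r'_{\mathfrak{ab}})$ and all $\widetilde{\mathcal F}^{\mathfrak{ab}}_{nm}(\boldsymbol r,\boldsymbol r_c)$, $L^{\mathfrak{ab}}_{nm}$, $T^{\mathfrak{ab}}_{nm,\nu\mu}$ ($|m|\le n$, $|\mu|\le\nu$) converge absolutely, and $u^{\mathfrak{ab}}_{\ell\ell'}(\boldsymbol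 r,\boldsymbol r')=\tilde u^{\mathfrak{ab}}_{\ell\ell'}(\boldsymbol r,\boldsymbol r'_{\mathfrak{ab}})$; 2. (multipole expansion) if $|\boldsymbol r'_{\mathfrak{ab}}-\boldsymbol r_c|<|\boldsymbol r-\boldsymbol r_c|$, then $\displaystyle\tilde u^{\mathfrak{ab}}_{\ell\ell'}(\boldsymbol r,\boldsymbol r'_{\mathfrak{ab}})=\sum_{n=0}^\infty\sum_{m=-n}^n M_{nm}\widetilde{\mathcal F}^{\mathfrak{ab}}_{nm}(\boldsymbol r,\boldsymbol r_c)$; 3. (local expansion) if $|\boldsymbol r-\boldsymbol r_c^t|<|\boldsymbol r'_{\mathfrak{ab}}-\boldsymbol r_c^t|$, then $\displaystyle\tilde u^{\mathfrak{ab}}_{\ell\ell'}(\boldsymbol r,\boldsymbol r'_{\mathfrak{ab}})=\sum_{n=0}^\infty\sum_{m=-n}^n L^{\mathfrak{ab}}_{nm}\,i_n(\lambda_\ell r_t)Y_n^m(\theta_t,\varphi_t)$; 4. (multipole-to-local translation) if $|\boldsymbol r'_{\mathfrak{ab}}-\boldsymbol r_c|<|\boldsymbol r_c^t-\boldsymbol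 r_c|$, then $\displaystyle L^{\mathfrak{ab}}_{nm}=\sum_{\nu=0}^\infty\sum_{\mu=-\nu}^{\nu}T^{\mathfrak{ab}}_{nm,\nu\mu}M_{\nu\mu}$ for all $n\ge0$, $|m|\le n$. The series over $n$ (respectively $\nu$) of the finite inner sums converge absolutely. -/

import Mathlib

/-- Points of three-dimensional space, with the Euclidean norm; the coordinates are
`r 0 = x`, `r 1 = y`, `r 2 = z`. -/
abbrev Space3 : Type := EuclideanSpace ℝ (Fin 3)

namespace Space3

/-- Polar angle `θ ∈ [0, π]` of a vector. -/
noncomputable def theta (v : Space3) : ℝ := Real.arccos (v 2 / ‖v‖)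

/-- Azimuthal angle `φ ∈ (-π, π]` of a vector. -/
noncomputable def phi (v : Space3) : ℝ := Complex.arg ((v 0 : ℂ) + (v 1 : ℂ) * Complex.I)

end Space3

namespace SphericalFunctions

/-- The Legendre polynomial `P_n` (Rodrigues' formula), with complex coefficients. -/
noncomputable def legendrePoly (n : ℕ) : Polynomial ℂ :=
  Polynomial.C (1 / (2 ^ n * (n.factorial : ℂ))) *
    Polynomial.derivative^[n] ((Polynomial.X ^ 2 - 1) ^ n)

/-- The branch `√(1 - w²) = -i √(r₁ r₂) e^{i(θ₁ + θ₂)/2}`, where `w + 1 = r₁ e^{iθ₁}`,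
`w - 1 = r₂ e^{iθ₂}` with principal arguments. It is the usual square root for `w ∈ [-1, 1]`
and `-i √(w² - 1)` for real `w > 1`. -/
noncomputable def sqrtOneSubSq (w : ℂ) : ℂ :=
  -Complex.I * ((w + 1) ^ (1 / 2 : ℂ) * (w - 1) ^ (1 / 2 : ℂ))

/-- The associated Legendre function `P_n^m` for `|m| ≤ n`:
`P_n^m(w) = (-1)^m (1 - w²)^{m/2} P_n^{(m)}(w)` and
`P_n^{-m} = (-1)^m ((n-m)! / (n+m)!) P_n^m` for `m ≥ 0`. -/
noncomputable def assocLegendre (n : ℕ) (m : ℤ) (w : ℂ) : ℂ :=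
  let p : ℂ := (-1) ^ m.natAbs * sqrtOneSubSq w ^ m.natAbs *
    (Polynomial.derivative^[m.natAbs] (legendrePoly n)).eval w
  if 0 ≤ m then p
  else (-1) ^ m.natAbs * (((n - m.natAbs).factorial : ℂ) / ((n + m.natAbs).factorial : ℂ)) * p

/-- The normalized associated Legendre function
`P̂_n^m = (-1)^m √((2n+1)/(4π) · (n-m)!/(n+m)!) P_n^m`. -/
noncomputable def normLegendre (n : ℕ) (m : ℤ) (w : ℂ) : ℂ :=
  (-1) ^ m * (Real.sqrt ((2 * (n : ℝ) + 1) / (4 * Real.pi) *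
    ((((n : ℤ) - m).toNat.factorial : ℝ) / (((n : ℤ) + m).toNat.factorial : ℝ))) : ℂ) *
    assocLegendre n m w

/-- The spherical harmonic `Y_n^m(θ, φ) = P̂_n^m(cos θ) e^{imφ}`. -/
noncomputable def sphHarm (n : ℕ) (m : ℤ) (θ φ : ℝ) : ℂ :=
  normLegendre n m (Real.cos θ : ℂ) * Complex.exp (Complex.I * (m : ℂ) * (φ : ℂ))

/-- The spherical harmonic in the direction of a vector (any direction when the vector is zero). -/
noncomputable def sphHarmAt (n : ℕ) (m : ℤ) (v : Space3) : ℂ :=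
  sphHarm n m (Space3.theta v) (Space3.phi v)

/-- The modified spherical Bessel function of the first kind
`i_n(x) = √(π/(2x)) I_{n+1/2}(x)`, where `I_ν(x) = ∑_k (x/2)^{2k+ν} / (k! Γ(k+ν+1))`,
written as the power series of its entire extension (so `i_0(0) = 1`, `i_n(0) = 0` for `n ≥ 1`). -/
noncomputable def sphBesselI (n : ℕ) (x : ℝ) : ℝ :=
  Real.sqrt Real.pi / 2 *
    ∑' k : ℕ, (x / 2) ^ (2 * k + n) / ((k.factorial : ℝ) * Real.Gamma ((k : ℝ) + n + 3 / 2))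

end SphericalFunctions

/-- The Sommerfeld-type double integral `∫₀^∞ ∫₀^{2π} g(λ_ρ, α) dα dλ_ρ`. -/
noncomputable def sommerfeldIntegral (g : ℝ → ℝ → ℂ) : ℂ :=
  ∫ k in Set.Ioi (0 : ℝ), ∫ α in (0 : ℝ)..(2 * Real.pi), g k α

/-- Absolute convergence of a Sommerfeld-type double integral. -/
def SommerfeldConvergent (g : ℝ → ℝ → ℂ) : Prop :=
  MeasureTheory.IntegrableOn (Function.uncurry g)
    (Set.Ioi (0 : ℝ) ×ˢ Set.Ioc (0 : ℝ) (2 * Real.pi))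

/-- A layered medium with `L` interfaces `z = d 0 > d 1 > ⋯ > d (L-1)` and layers `0, …, L`
(layer `ℓ` is `d ℓ < z < d (ℓ-1)`, unbounded above for `ℓ = 0` and below for `ℓ = L`), with
dielectric constants `ε ℓ` and inverse Debye-Hückel lengths `lam ℓ`. Values of `d`, `ε`, `lam`
at larger indices are never used. -/
structure LayeredMedium where
  L : ℕ
  d : ℕ → ℝ
  ε : ℕ → ℝ
  lam : ℕ → ℝ
  d_lt : ∀ j, j + 1 < L → d (j + 1) < d j
  ε_pos : ∀ ℓ, ℓ ≤ L → 0 < ε ℓ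
  lam_pos : ∀ ℓ, ℓ ≤ L → 0 < lam ℓ

/-- The values `1, 2` of the superscripts `𝔞, 𝔟` of the reaction components. -/
inductive Side : Type
  | one
  | two

namespace LayeredMedium

variable (M : LayeredMedium)

/-- The open layer with index `ℓ`. -/
def InLayer (ℓ : ℕ) (z : ℝ) : Prop := (ℓ < M.L → M.d ℓ < z) ∧ (0 < ℓ → z < M.d (ℓ - 1))

/-- `λ_{ℓz} = √(λ_ℓ² + λ_ρ²)`. -/
noncomputable def lamz (ℓ : ℕ) (k : ℝ) : ℝ := Real.sqrt (M.lam ℓ ^ 2 + k ^ 2)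

/-- Superscript `1` occurs for layers with an interface below, superscript `2` for layers with
an interface above. -/
def Admissible : Side → ℕ → Prop
  | Side.one, ℓ => ℓ < M.L
  | Side.two, ℓ => 0 < ℓ ∧ ℓ ≤ M.L

/-- `ψ^𝔞_{ℓℓ'}(λ_ρ, z')` as a combination of the densities `σ^{𝔞𝔟}_{ℓℓ'}(λ_ρ)`. -/
noncomputable def psi (σ : Side → Side → ℕ → ℕ → ℝ → ℝ) (a : Side) (ℓ ℓ' : ℕ) (k z' : ℝ) : ℝ :=
  (if ℓ' < M.L then Real.exp (-M.lamz ℓ' k * (z' - M.d ℓ')) * σ a Side.one ℓ ℓ' k else 0) +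
  (if 0 < ℓ' then Real.exp (-M.lamz ℓ' k * (M.d (ℓ' - 1) - z')) * σ a Side.two ℓ ℓ' k else 0)

/-- The two-dimensional Fourier transform in `(x - x', y - y')`, at a frequency of modulus `k`, of
the layered Green's function in layer `ℓ` for a unit source in layer `ℓ'`: two reaction components
(only one, decaying, in the top and bottom layers) and the free-space part if `ℓ = ℓ'`. -/
noncomputable def spectralGreen (σ : Side → Side → ℕ → ℕ → ℝ → ℝ) (ℓ ℓ' : ℕ) (k z' z : ℝ) : ℝ :=
  (if ℓ < M.L then
    Real.exp (-M.lamz ℓ k * (z - M.d ℓ)) / (2 * M.lamz ℓ k) * M.psi σ Side.one ℓ ℓ' k z' else 0) +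
  (if 0 < ℓ then
    Real.exp (-M.lamz ℓ k * (M.d (ℓ - 1) - z)) / (2 * M.lamz ℓ k) *
      M.psi σ Side.two ℓ ℓ' k z' else 0) +
  (if ℓ = ℓ' then Real.exp (-M.lamz ℓ k * |z - z'|) / (2 * M.ε ℓ * M.lamz ℓ k) else 0)

/-- `σ^{𝔞𝔟}_{ℓℓ'}` are the reaction densities of the medium: for every source position the spectral
Green's function satisfies the transmission conditions (continuity of the potential and of
`ε ∂_z` of it) at every interface. -/
def IsReactionDensity (σ : Side → Side → ℕ → ℕ → ℝ → ℝ) : Prop :=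
  ∀ k : ℝ, 0 < k → ∀ ℓ' : ℕ, ℓ' ≤ M.L → ∀ z' : ℝ, M.InLayer ℓ' z' → ∀ j : ℕ, j < M.L →
    M.spectralGreen σ j ℓ' k z' (M.d j) = M.spectralGreen σ (j + 1) ℓ' k z' (M.d j) ∧
    M.ε j * deriv (M.spectralGreen σ j ℓ' k z') (M.d j) =
      M.ε (j + 1) * deriv (M.spectralGreen σ (j + 1) ℓ' k z') (M.d j)

/-- Solvability of the linear system for the amplitudes (`a ℓ` upgoing, `b ℓ` downgoing). -/
theorem exists_amplitudes (L : ℕ) (E l e : ℕ → ℝ) (hE : ∀ j, 0 < E j)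
    (hE1 : ∀ j, 0 < j → j < L → E j ≤ 1) (hl : ∀ j, j ≤ L → 0 < l j)
    (he : ∀ j, j ≤ L → 0 < e j) (f g : ℕ → ℝ) :
    ∃ a b : ℕ → ℝ, a L = 0 ∧ b 0 = 0 ∧ ∀ j, j < L →
      (a j + b j * E j) / l j - (a (j + 1) * E (j + 1) + b (j + 1)) / l (j + 1) = f j ∧
      e j * (-a j + b j * E j) - e (j + 1) * (-(a (j + 1) * E (j + 1)) + b (j + 1)) = g j := by
  let A : (Fin L → ℝ) → ℕ → ℝ := fun x j => if h : j < L then x ⟨j, h⟩ else 0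
  let B : (Fin L → ℝ) → ℕ → ℝ := fun y j => if h : 0 < j ∧ j - 1 < L then y ⟨j - 1, h.2⟩ else 0
  have hAadd : ∀ x x' j, A (x + x') j = A x j + A x' j := by
    intro x x' j; simp only [A]; split_ifs <;> simp
  have hBadd : ∀ x x' j, B (x + x') j = B x j + B x' j := by
    intro x x' j; simp only [B]; split_ifs <;> simp
  have hAsm : ∀ (c : ℝ) x j, A (c • x) j = c * A x j := by
    intro x x' j; simp only [A]; split_ifs <;> simp
  have hBsm : ∀ (c : ℝ) x j, B (c • x) j = c * B x j := by
    intro x x' j; simp only [B]; split_ifs <;> simp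
  let T : ((Fin L → ℝ) × (Fin L → ℝ)) →ₗ[ℝ] ((Fin L → ℝ) × (Fin L → ℝ)) :=
    { toFun := fun p =>
        (fun j => (A p.1 j + B p.2 j * E j) / l j -
          (A p.1 (j + 1) * E (j + 1) + B p.2 (j + 1)) / l (j + 1),
         fun j => e j * (-A p.1 j + B p.2 j * E j) -
          e (j + 1) * (-(A p.1 (j + 1) * E (j + 1)) + B p.2 (j + 1)))
      map_add' := by
        intro p q
        refine Prod.ext ?_ ?_ <;> funext j <;>
          simp only [Prod.fst_add, Prod.snd_add, hAadd, hBadd, Pi.add_apply] <;> ring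
      map_smul' := by
        intro c p
        refine Prod.ext ?_ ?_ <;> funext j <;>
          simp only [Prod.smul_fst, Prod.smul_snd, hAsm, hBsm, Pi.smul_apply, smul_eq_mul,
            RingHom.id_apply] <;> ring }
  have hAL : ∀ x, A x L = 0 := by intro x; simp [A]
  have hB0 : ∀ x, B x 0 = 0 := by intro x; simp [B]
  have hinj : Function.Injective T := by
    rw [injective_iff_map_eq_zero]
    rintro ⟨x, y⟩ hxy
    have h1 : ∀ j, j < L → (A x j + B y j * E j) / l j =
        (A x (j + 1) * E (j + 1) + B y (j + 1)) / l (j + 1) := by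
      intro j hj
      have := congrFun (congrArg Prod.fst hxy) ⟨j, hj⟩
      simp only [T, LinearMap.coe_mk, AddHom.coe_mk, Prod.fst_zero, Pi.zero_apply] at this
      linarith
    have h2 : ∀ j, j < L → e j * (-A x j + B y j * E j) =
        e (j + 1) * (-(A x (j + 1) * E (j + 1)) + B y (j + 1)) := by
      intro j hj
      have := congrFun (congrArg Prod.snd hxy) ⟨j, hj⟩
      simp only [T, LinearMap.coe_mk, AddHom.coe_mk, Prod.snd_zero, Pi.zero_apply] at this
      linarith
    have hfl : ∀ j, j < L → (A x j + B y j * E j) / l j * (e j * (-A x j + B y j * E j)) ≤ 0 := by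
      intro j
      induction j with
      | zero =>
        intro hj
        have e1 : (A x 0 + B y 0 * E 0) / l 0 * (e 0 * (-A x 0 + B y 0 * E 0))
            = -(e 0 / l 0 * (A x 0) ^ 2) := by rw [hB0]; ring
        rw [e1]
        have := hl 0 (by omega)
        have := he 0 (by omega)
        have : 0 ≤ e 0 / l 0 * (A x 0) ^ 2 := by positivity
        linarith
      | succ j ih =>
        intro hj
        have h := ih (by omega)
        rw [h1 j (by omega), h2 j (by omega)] at h
        have hl' := hl (j + 1) (by omega)
        have he' := he (j + 1) (by omega)
        have hEp := hE (j + 1)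
        have hEl := hE1 (j + 1) (by omega) hj
        have hE2 : 0 ≤ 1 - E (j + 1) ^ 2 := by nlinarith
        have hq : 0 ≤ e (j + 1) / l (j + 1) *
            ((A x (j + 1) ^ 2 + B y (j + 1) ^ 2) * (1 - E (j + 1) ^ 2)) := by positivity
        have e2 : (A x (j + 1) * E (j + 1) + B y (j + 1)) / l (j + 1) *
              (e (j + 1) * (-(A x (j + 1) * E (j + 1)) + B y (j + 1))) -
            (A x (j + 1) + B y (j + 1) * E (j + 1)) / l (j + 1) *
              (e (j + 1) * (-A x (j + 1) + B y (j + 1) * E (j + 1))) =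
            e (j + 1) / l (j + 1) *
            ((A x (j + 1) ^ 2 + B y (j + 1) ^ 2) * (1 - E (j + 1) ^ 2)) := by ring
        linarith
    have hBL : B y L = 0 := by
      rcases Nat.eq_zero_or_pos L with h0 | hpos
      · rw [h0]; exact hB0 y
      · obtain ⟨n, rfl⟩ : ∃ n, L = n + 1 := ⟨L - 1, by omega⟩
        have h := hfl n (by omega)
        rw [h1 n (by omega), h2 n (by omega), hAL] at h
        have hl' := hl (n + 1) le_rfl
        have he' := he (n + 1) le_rfl
        have e3 : (0 * E (n + 1) + B y (n + 1)) / l (n + 1) *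
            (e (n + 1) * (-(0 * E (n + 1)) + B y (n + 1))) =
            e (n + 1) / l (n + 1) * (B y (n + 1)) ^ 2 := by ring
        rw [e3] at h
        have hc : 0 < e (n + 1) / l (n + 1) := by positivity
        by_contra hne
        have : 0 < (B y (n + 1)) ^ 2 := by positivity
        have := mul_pos hc this
        linarith
    have hall : ∀ i, i ≤ L → A x (L - i) = 0 ∧ B y (L - i) = 0 := by
      intro i
      induction i with
      | zero => intro _; exact ⟨hAL x, hBL⟩
      | succ i ih =>
        intro hi
        obtain ⟨ha, hb⟩ := ih (by omega)
        have hs : L - i = (L - (i + 1)) + 1 := by omega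
        rw [hs] at ha hb
        have k1 := h1 (L - (i + 1)) (by omega)
        have k2 := h2 (L - (i + 1)) (by omega)
        rw [ha, hb] at k1 k2
        have hl' := hl (L - (i + 1)) (by omega)
        have he' := he (L - (i + 1)) (by omega)
        have k1' : A x (L - (i + 1)) + B y (L - (i + 1)) * E (L - (i + 1)) = 0 := by
          have : (A x (L - (i + 1)) + B y (L - (i + 1)) * E (L - (i + 1))) / l (L - (i + 1)) = 0 := by
            rw [k1]; simp
          rcases div_eq_zero_iff.mp this with h | h
          · exact h
          · exact absurd h hl'.ne'
        have k2' : -A x (L - (i + 1)) + B y (L - (i + 1)) * E (L - (i + 1)) = 0 := by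
          have : e (L - (i + 1)) * (-A x (L - (i + 1)) + B y (L - (i + 1)) * E (L - (i + 1))) = 0 := by
            rw [k2]; simp
          rcases mul_eq_zero.mp this with h | h
          · exact absurd h he'.ne'
          · exact h
        refine ⟨by linarith, ?_⟩
        have : B y (L - (i + 1)) * E (L - (i + 1)) = 0 := by linarith
        rcases mul_eq_zero.mp this with h | h
        · exact h
        · exact absurd h (hE _).ne'
    refine Prod.ext ?_ ?_
    · funext j
      have := (hall (L - j) (by omega)).1
      rw [Nat.sub_sub_self j.2.le] at this
      simpa [A] using this
    · funext j
      have := (hall (L - (j + 1)) (by omega)).2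
      rw [Nat.sub_sub_self j.2] at this
      simpa [B] using this
  obtain ⟨⟨x, y⟩, hT⟩ := LinearMap.injective_iff_surjective.mp hinj
    (fun j : Fin L => f j, fun j : Fin L => g j)
  refine ⟨A x, B y, hAL x, hB0 y, fun j hj => ⟨?_, ?_⟩⟩
  · exact congrFun (congrArg Prod.fst hT) ⟨j, hj⟩
  · exact congrFun (congrArg Prod.snd hT) ⟨j, hj⟩

theorem lamz_pos {ℓ : ℕ} (h : ℓ ≤ M.L) (k : ℝ) : 0 < M.lamz ℓ k :=
  Real.sqrt_pos.mpr (by have := M.lam_pos ℓ h; positivity)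

/-- Every layered medium has reaction densities. -/
theorem exists_isReactionDensity :
    ∃ σ : Side → Side → ℕ → ℕ → ℝ → ℝ, M.IsReactionDensity σ := by
  have key : ∀ (ℓ' : ℕ) (k : ℝ) (f g : ℕ → ℝ), ∃ p : (ℕ → ℝ) × (ℕ → ℝ),
      p.1 M.L = 0 ∧ p.2 0 = 0 ∧ ∀ j, j < M.L →
      (p.1 j + p.2 j * Real.exp (-M.lamz j k * (M.d (j - 1) - M.d j))) / M.lamz j k -
        (p.1 (j + 1) * Real.exp (-M.lamz (j + 1) k * (M.d j - M.d (j + 1))) + p.2 (j + 1)) /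
          M.lamz (j + 1) k = f j ∧
      M.ε j * (-p.1 j + p.2 j * Real.exp (-M.lamz j k * (M.d (j - 1) - M.d j))) -
        M.ε (j + 1) * (-(p.1 (j + 1) * Real.exp (-M.lamz (j + 1) k * (M.d j - M.d (j + 1)))) +
          p.2 (j + 1)) = g j := by
    intro ℓ' k f g
    obtain ⟨a, b, ha, hb, h⟩ := exists_amplitudes M.L
      (fun j => Real.exp (-M.lamz j k * (M.d (j - 1) - M.d j))) (fun j => M.lamz j k) M.ε
      (fun j => Real.exp_pos _)
      (fun j h0 hL => by
        have := M.d_lt (j - 1) (by omega)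
        rw [Nat.sub_add_cancel h0] at this
        have h2 := M.lamz_pos hL.le k
        rw [Real.exp_le_one_iff]
        nlinarith)
      (fun j hj => M.lamz_pos hj k) M.ε_pos f g
    exact ⟨(a, b), ha, hb, h⟩
  choose p hpL hp0 hp using key
  let q : Side → ℕ → ℝ → (ℕ → ℝ) × (ℕ → ℝ) := fun b ℓ' k =>
    match b with
    | Side.one => p ℓ' k (fun j => if j = ℓ' then -1 / (M.ε ℓ' * M.lamz ℓ' k) else 0)
        (fun j => if j = ℓ' then -1 else 0)
    | Side.two => p ℓ' k (fun j => if j + 1 = ℓ' then 1 / (M.ε ℓ' * M.lamz ℓ' k) else 0)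
        (fun j => if j + 1 = ℓ' then -1 else 0)
  let σ : Side → Side → ℕ → ℕ → ℝ → ℝ := fun a b ℓ ℓ' k =>
    match a with
    | Side.one => (q b ℓ' k).1 ℓ
    | Side.two => (q b ℓ' k).2 ℓ
  refine ⟨σ, fun k _ ℓ' hℓ' z' hz' j hj => ?_⟩
  set s1 : ℝ := if ℓ' < M.L then Real.exp (-M.lamz ℓ' k * (z' - M.d ℓ')) else 0 with hs1
  set s2 : ℝ := if 0 < ℓ' then Real.exp (-M.lamz ℓ' k * (M.d (ℓ' - 1) - z')) else 0 with hs2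
  have hpsi : ∀ a ℓ, M.psi σ a ℓ ℓ' k z' =
      s1 * σ a Side.one ℓ ℓ' k + s2 * σ a Side.two ℓ ℓ' k := by
    intro a ℓ; simp only [psi, hs1, hs2]; split_ifs <;> simp
  set A : ℕ → ℝ := fun ℓ => M.psi σ Side.one ℓ ℓ' k z' with hA
  set B : ℕ → ℝ := fun ℓ => M.psi σ Side.two ℓ ℓ' k z' with hB
  have hAL : A M.L = 0 := by
    simp only [hA, hpsi, σ, q, hpL]; simp
  have hB0 : B 0 = 0 := by
    simp only [hB, hpsi, σ, q, hp0]; simp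
  have hG : ∀ ℓ, ℓ ≤ M.L → M.spectralGreen σ ℓ ℓ' k z' = fun z =>
      Real.exp (-M.lamz ℓ k * (z - M.d ℓ)) / (2 * M.lamz ℓ k) * A ℓ +
      Real.exp (-M.lamz ℓ k * (M.d (ℓ - 1) - z)) / (2 * M.lamz ℓ k) * B ℓ +
      (if ℓ = ℓ' then Real.exp (-M.lamz ℓ k * |z - z'|) / (2 * M.ε ℓ * M.lamz ℓ k) else 0) := by
    intro ℓ hℓ
    funext z
    simp only [spectralGreen]
    congr 2
    · split_ifs with h
      · rfl
      · have : ℓ = M.L := by omega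
        rw [this, hAL]; simp
    · split_ifs with h
      · rfl
      · have : ℓ = 0 := by omega
        rw [this, hB0]; simp
  have hd1 : ∀ c lm t x : ℝ, HasDerivAt (fun z => Real.exp (-lm * (z - t)) / (2 * lm) * c)
      (Real.exp (-lm * (x - t)) * (-lm) / (2 * lm) * c) x := by
    intro c lm t x
    have := ((((hasDerivAt_id x).sub_const t).const_mul (-lm)).exp.div_const (2 * lm)).mul_const c
    simpa using this
  have hd2 : ∀ c lm t x : ℝ, HasDerivAt (fun z => Real.exp (-lm * (t - z)) / (2 * lm) * c)
      (Real.exp (-lm * (t - x)) * lm / (2 * lm) * c) x := by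
    intro c lm t x
    have := ((((hasDerivAt_id x).const_sub t).const_mul (-lm)).exp.div_const (2 * lm)).mul_const c
    simpa using this
  have hlj := M.lamz_pos hj.le k
  have hlj1 := M.lamz_pos (show j + 1 ≤ M.L from hj) k
  have hej := M.ε_pos j hj.le
  have hej1 := M.ε_pos (j + 1) hj
  set Ej := Real.exp (-M.lamz j k * (M.d (j - 1) - M.d j)) with hEj
  set Ej1 := Real.exp (-M.lamz (j + 1) k * (M.d j - M.d (j + 1))) with hEj1
  set D1 : ℝ := if j = ℓ' then s1 else 0 with hD1
  set D2 : ℝ := if j + 1 = ℓ' then s2 else 0 with hD2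
  have v1 : M.spectralGreen σ j ℓ' k z' (M.d j) =
      (A j + B j * Ej) / (2 * M.lamz j k) + D1 / (2 * M.ε j * M.lamz j k) := by
    rw [hG j hj.le]
    have : (if j = ℓ' then Real.exp (-M.lamz j k * |M.d j - z'|) / (2 * M.ε j * M.lamz j k)
        else 0) = D1 / (2 * M.ε j * M.lamz j k) := by
      by_cases h : j = ℓ'
      · have hz := hz'.1 (h ▸ hj)
        subst h
        rw [abs_of_neg (by linarith)]
        simp [hD1, hs1, hj]
      · simp [hD1, h]
    simp only [this, sub_self, mul_zero, Real.exp_zero]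
    rw [← hEj]; ring
  have v2 : M.spectralGreen σ (j + 1) ℓ' k z' (M.d j) =
      (A (j + 1) * Ej1 + B (j + 1)) / (2 * M.lamz (j + 1) k) +
        D2 / (2 * M.ε (j + 1) * M.lamz (j + 1) k) := by
    rw [hG (j + 1) hj]
    have : (if j + 1 = ℓ' then Real.exp (-M.lamz (j + 1) k * |M.d j - z'|) /
        (2 * M.ε (j + 1) * M.lamz (j + 1) k) else 0) =
        D2 / (2 * M.ε (j + 1) * M.lamz (j + 1) k) := by
      by_cases h : j + 1 = ℓ'
      · have hz := hz'.2 (by omega)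
        subst h
        rw [Nat.add_sub_cancel] at hz
        rw [abs_of_pos (by linarith)]
        simp [hD2, hs2]
      · simp [hD2, h]
    simp only [this, Nat.add_sub_cancel, sub_self, mul_zero, Real.exp_zero]
    rw [← hEj1]; ring
  have w1 : deriv (M.spectralGreen σ j ℓ' k z') (M.d j) =
      (-A j + B j * Ej) / 2 + D1 / (2 * M.ε j) := by
    rw [hG j hj.le]
    have h3 : HasDerivAt (fun z => if j = ℓ' then Real.exp (-M.lamz j k * |z - z'|) /
        (2 * M.ε j * M.lamz j k) else 0) (D1 / (2 * M.ε j)) (M.d j) := by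
      by_cases h : j = ℓ'
      · have hz := hz'.1 (h ▸ hj)
        subst h
        have h4 := hd2 (1 / M.ε j) (M.lamz j k) z' (M.d j)
        have h5 : D1 / (2 * M.ε j) =
            Real.exp (-M.lamz j k * (z' - M.d j)) * M.lamz j k / (2 * M.lamz j k) *
              (1 / M.ε j) := by
          simp only [hD1, hs1, hj, if_true]; field_simp
        rw [h5]
        refine h4.congr_of_eventuallyEq ?_
        filter_upwards [Iio_mem_nhds hz] with z hzz
        have hzz' : z < z' := hzz
        simp only [if_true]
        rw [abs_of_neg (by linarith), neg_sub]
        field_simp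
      · simpa [hD1, h] using hasDerivAt_const (M.d j) (0 : ℝ)
    have := (((hd1 (A j) (M.lamz j k) (M.d j) (M.d j)).add
      (hd2 (B j) (M.lamz j k) (M.d (j - 1)) (M.d j))).add h3).deriv
    refine this.trans ?_
    rw [← hEj, sub_self, mul_zero, Real.exp_zero]
    field_simp
  have w2 : deriv (M.spectralGreen σ (j + 1) ℓ' k z') (M.d j) =
      (-(A (j + 1) * Ej1) + B (j + 1)) / 2 - D2 / (2 * M.ε (j + 1)) := by
    rw [hG (j + 1) hj]
    have h3 : HasDerivAt (fun z => if j + 1 = ℓ' then Real.exp (-M.lamz (j + 1) k * |z - z'|) /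
        (2 * M.ε (j + 1) * M.lamz (j + 1) k) else 0) (-(D2 / (2 * M.ε (j + 1)))) (M.d j) := by
      by_cases h : j + 1 = ℓ'
      · have hz := hz'.2 (by omega)
        subst h
        rw [Nat.add_sub_cancel] at hz
        have h4 := hd1 (1 / M.ε (j + 1)) (M.lamz (j + 1) k) z' (M.d j)
        have h5 : -(D2 / (2 * M.ε (j + 1))) =
            Real.exp (-M.lamz (j + 1) k * (M.d j - z')) * (-M.lamz (j + 1) k) /
              (2 * M.lamz (j + 1) k) * (1 / M.ε (j + 1)) := by
          simp only [hD2, hs2, if_true, Nat.add_sub_cancel, Nat.succ_pos]; field_simp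
        rw [h5]
        refine h4.congr_of_eventuallyEq ?_
        filter_upwards [Ioi_mem_nhds hz] with z hzz
        have hzz' : z' < z := hzz
        simp only [if_true]
        rw [abs_of_pos (by linarith)]
        field_simp
      · simpa [hD2, h] using hasDerivAt_const (M.d j) (0 : ℝ)
    have := (((hd1 (A (j + 1)) (M.lamz (j + 1) k) (M.d (j + 1)) (M.d j)).add
      (hd2 (B (j + 1)) (M.lamz (j + 1) k) (M.d j) (M.d j))).add h3).deriv
    refine this.trans ?_
    rw [← hEj1, sub_self, mul_zero, Real.exp_zero]
    field_simp
    ring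
  obtain ⟨o1, o2⟩ := hp ℓ' k (fun j => if j = ℓ' then -1 / (M.ε ℓ' * M.lamz ℓ' k) else 0)
        (fun j => if j = ℓ' then -1 else 0) j hj
  obtain ⟨t1, t2⟩ := hp ℓ' k (fun j => if j + 1 = ℓ' then 1 / (M.ε ℓ' * M.lamz ℓ' k) else 0)
        (fun j => if j + 1 = ℓ' then -1 else 0) j hj
  have c1 : s1 * (if j = ℓ' then -1 / (M.ε ℓ' * M.lamz ℓ' k) else 0) =
      -(D1 / (M.ε j * M.lamz j k)) := by
    by_cases h : j = ℓ'
    · subst h; simp only [hD1, if_true]; ring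
    · simp [hD1, h]
  have c2 : s1 * (if j = ℓ' then (-1 : ℝ) else 0) = -D1 := by
    by_cases h : j = ℓ' <;> simp [hD1, h]
  have c3 : s2 * (if j + 1 = ℓ' then 1 / (M.ε ℓ' * M.lamz ℓ' k) else 0) =
      D2 / (M.ε (j + 1) * M.lamz (j + 1) k) := by
    by_cases h : j + 1 = ℓ'
    · subst h; simp only [hD2, if_true]; ring
    · simp [hD2, h]
  have c4 : s2 * (if j + 1 = ℓ' then (-1 : ℝ) else 0) = -D2 := by
    by_cases h : j + 1 = ℓ' <;> simp [hD2, h]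
  have eA : ∀ ℓ, A ℓ = s1 * (q Side.one ℓ' k).1 ℓ + s2 * (q Side.two ℓ' k).1 ℓ := fun ℓ => hpsi _ _
  have eB : ∀ ℓ, B ℓ = s1 * (q Side.one ℓ' k).2 ℓ + s2 * (q Side.two ℓ' k).2 ℓ := fun ℓ => hpsi _ _
  have hq1 : p ℓ' k (fun j => if j = ℓ' then -1 / (M.ε ℓ' * M.lamz ℓ' k) else 0)
        (fun j => if j = ℓ' then -1 else 0) = q Side.one ℓ' k := rfl
  have hq2 : p ℓ' k (fun j => if j + 1 = ℓ' then 1 / (M.ε ℓ' * M.lamz ℓ' k) else 0)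
        (fun j => if j + 1 = ℓ' then -1 else 0) = q Side.two ℓ' k := rfl
  rw [hq1] at o1 o2
  rw [hq2] at t1 t2
  rw [← hEj, ← hEj1] at o1 o2 t1 t2
  constructor
  · rw [v1, v2, eA, eB, eA, eB]
    linear_combination (1 / 2) * s1 * o1 + (1 / 2) * s2 * t1 + (1 / 2) * c1 + (1 / 2) * c3
  · have r1 : M.ε j * (D1 / (2 * M.ε j)) = D1 / 2 := by field_simp
    have r2 : M.ε (j + 1) * (D2 / (2 * M.ε (j + 1))) = D2 / 2 := by field_simp
    rw [w1, w2, mul_add, mul_sub, r1, r2, eA, eB, eA, eB]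
    linear_combination (1 / 2) * s1 * o2 + (1 / 2) * s2 * t2 + (1 / 2) * c2 + (1 / 2) * c4

/-- The reaction densities `σ^{𝔞𝔟}_{ℓℓ'}(λ_ρ)` of the medium. For layers `ℓ, ℓ' ≤ L`, admissible
superscripts and `λ_ρ > 0` the transmission conditions determine them uniquely. -/
noncomputable def reactionDensity : Side → Side → ℕ → ℕ → ℝ → ℝ :=
  Classical.choose M.exists_isReactionDensity

theorem isReactionDensity_reactionDensity : M.IsReactionDensity M.reactionDensity :=
  Classical.choose_spec M.exists_isReactionDensity

/-- `i λ_α · (ρ - ρ')` with `λ_α = λ_ρ (cos α, sin α)`. -/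
noncomputable def lateralPhase (k α : ℝ) (r s : Space3) : ℂ :=
  Complex.I * ((k * (Real.cos α * (r 0 - s 0) + Real.sin α * (r 1 - s 1)) : ℝ) : ℂ)

/-- The exponentials `ℰ^{𝔞𝔟}_{ℓℓ'}(r, r')`, for the original source point. -/
noncomputable def expSource (a b : Side) (ℓ ℓ' : ℕ) (r r' : Space3) (k α : ℝ) : ℂ :=
  Complex.exp (lateralPhase k α r r' +
    ((match a with
      | Side.one => -M.lamz ℓ k * (r 2 - M.d ℓ)
      | Side.two => -M.lamz ℓ k * (M.d (ℓ - 1) - r 2) : ℝ) : ℂ) +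
    ((match b with
      | Side.one => -M.lamz ℓ' k * (r' 2 - M.d ℓ')
      | Side.two => -M.lamz ℓ' k * (M.d (ℓ' - 1) - r' 2) : ℝ) : ℂ))

/-- The reaction component `u^{𝔞𝔟}_{ℓℓ'}(r, r')` of the layered Green's function. -/
noncomputable def reactionComponent (a b : Side) (ℓ ℓ' : ℕ) (r r' : Space3) : ℂ :=
  1 / (8 * (Real.pi : ℂ) ^ 2) * sommerfeldIntegral fun k α =>
    ((k / M.lamz ℓ k : ℝ) : ℂ) * M.expSource a b ℓ ℓ' r r' k α *
      (M.reactionDensity a b ℓ ℓ' k : ℂ)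

/-- The equivalent polarization source `r'_{𝔞𝔟}`. -/
noncomputable def polarizationSource (a b : Side) (ℓ ℓ' : ℕ) (r' : Space3) : Space3 :=
  !₂[r' 0, r' 1,
    match a, b with
    | Side.one, Side.one => M.d ℓ - (r' 2 - M.d ℓ')
    | Side.one, Side.two => M.d ℓ - (M.d (ℓ' - 1) - r' 2)
    | Side.two, Side.one => M.d (ℓ - 1) + (r' 2 - M.d ℓ')
    | Side.two, Side.two => M.d (ℓ - 1) + (M.d (ℓ' - 1) - r' 2)]

/-- The exponentials `ℰ⁺_{ℓℓ'}(r, s)` (for `𝔞 = 1`) and `ℰ⁻_{ℓℓ'}(r, s)` (for `𝔞 = 2`). -/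
noncomputable def expPol (a : Side) (ℓ ℓ' : ℕ) (r s : Space3) (k α : ℝ) : ℂ :=
  Complex.exp (lateralPhase k α r s +
    ((match a with
      | Side.one => -M.lamz ℓ k * (r 2 - M.d ℓ) - M.lamz ℓ' k * (M.d ℓ - s 2)
      | Side.two => -M.lamz ℓ k * (M.d (ℓ - 1) - r 2) - M.lamz ℓ' k * (s 2 - M.d (ℓ - 1)) : ℝ) : ℂ))

/-- The factor `(λ_ρ / λ_{ℓz}) ℰ^±_{ℓℓ'}(r, s) σ^{𝔞𝔟}_{ℓℓ'}(λ_ρ)` common to all the Sommerfeld-type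
integrals below. -/
noncomputable def baseIntegrand (a b : Side) (ℓ ℓ' : ℕ) (r s : Space3) (k α : ℝ) : ℂ :=
  ((k / M.lamz ℓ k : ℝ) : ℂ) * M.expPol a ℓ ℓ' r s k α * (M.reactionDensity a b ℓ ℓ' k : ℂ)

/-- The reaction component `ũ^{𝔞𝔟}_{ℓℓ'}(r, s)` as a function of target and polarization source. -/
noncomputable def reactionPol (a b : Side) (ℓ ℓ' : ℕ) (r s : Space3) : ℂ :=
  1 / (8 * (Real.pi : ℂ) ^ 2) * sommerfeldIntegral (M.baseIntegrand a b ℓ ℓ' r s)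

/-- `P̂_n^m(λ_{ℓz} / λ_ℓ)`. -/
noncomputable def spectralLegendre (ℓ n : ℕ) (m : ℤ) (k : ℝ) : ℂ :=
  SphericalFunctions.normLegendre n m ((M.lamz ℓ k / M.lam ℓ : ℝ) : ℂ)

/-- Integrand of the multipole basis function `F̃^{𝔞𝔟}_{nm}(r, r_c)` (without prefactor). -/
noncomputable def multipoleIntegrand (a b : Side) (ℓ ℓ' n : ℕ) (m : ℤ) (r rc : Space3)
    (k α : ℝ) : ℂ :=
  M.baseIntegrand a b ℓ ℓ' r rc k α * M.spectralLegendre ℓ' n m k *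
    Complex.exp (Complex.I * (m : ℂ) * (α : ℂ))

/-- The multipole basis function `F̃^{𝔞𝔟}_{nm}(r, r_c)`. -/
noncomputable def multipoleBasis (a b : Side) (ℓ ℓ' n : ℕ) (m : ℤ) (r rc : Space3) : ℂ :=
  (match a with
    | Side.one => 1
    | Side.two => (-1 : ℂ) ^ ((n : ℤ) + m)) / (8 * (Real.pi : ℂ) ^ 2) *
  sommerfeldIntegral (M.multipoleIntegrand a b ℓ ℓ' n m r rc)

/-- The multipole coefficient `M_{nm} = 4π i_n(λ_{ℓ'} r_s) conj Y_n^m(θ_s, φ_s)`, where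
`(r_s, θ_s, φ_s)` are the spherical coordinates of `s - r_c`. -/
noncomputable def multipoleCoeff (ℓ' n : ℕ) (m : ℤ) (s rc : Space3) : ℂ :=
  4 * (Real.pi : ℂ) * (SphericalFunctions.sphBesselI n (M.lam ℓ' * ‖s - rc‖) : ℂ) *
    (starRingEnd ℂ) (SphericalFunctions.sphHarmAt n m (s - rc))

/-- Integrand of the local expansion coefficient `L^{𝔞𝔟}_{nm}` (without prefactor). -/
noncomputable def localIntegrand (a b : Side) (ℓ ℓ' n : ℕ) (m : ℤ) (rt s : Space3)
    (k α : ℝ) : ℂ :=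
  M.baseIntegrand a b ℓ ℓ' rt s k α * M.spectralLegendre ℓ n m k *
    Complex.exp (-(Complex.I * (m : ℂ) * (α : ℂ)))

/-- The local expansion coefficient `L^{𝔞𝔟}_{nm}` at the target center `r_t`. -/
noncomputable def localCoeff (a b : Side) (ℓ ℓ' n : ℕ) (m : ℤ) (rt s : Space3) : ℂ :=
  (match a with
    | Side.one => (-1 : ℂ) ^ n
    | Side.two => (-1 : ℂ) ^ m) / (2 * (Real.pi : ℂ)) *
  sommerfeldIntegral (M.localIntegrand a b ℓ ℓ' n m rt s)

/-- Integrand of the translation operator `T^{𝔞𝔟}_{nm,νμ}` (without prefactor). -/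
noncomputable def translationIntegrand (a b : Side) (ℓ ℓ' n : ℕ) (m : ℤ) (ν : ℕ) (μ : ℤ)
    (rt rc : Space3) (k α : ℝ) : ℂ :=
  M.baseIntegrand a b ℓ ℓ' rt rc k α * (M.spectralLegendre ℓ n m k * M.spectralLegendre ℓ' ν μ k) *
    Complex.exp (Complex.I * ((μ : ℂ) - (m : ℂ)) * (α : ℂ))

/-- The multipole-to-local translation operator `T^{𝔞𝔟}_{nm,νμ}`. -/
noncomputable def translationCoeff (a b : Side) (ℓ ℓ' n : ℕ) (m : ℤ) (ν : ℕ) (μ : ℤ)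
    (rt rc : Space3) : ℂ :=
  (match a with
    | Side.one => (-1 : ℂ) ^ n
    | Side.two => (-1 : ℂ) ^ (m + (ν : ℤ) + μ)) / (2 * (Real.pi : ℂ)) *
  sommerfeldIntegral (M.translationIntegrand a b ℓ ℓ' n m ν μ rt rc)

/-- Condition on the center of the polarization sources: it lies on the other side of the interface
`z = d ℓ` (for `𝔞 = 1`) or `z = d (ℓ-1)` (for `𝔞 = 2`) than the targets in layer `ℓ`. -/
def SourceCenterCond : Side → ℕ → Space3 → Prop
  | Side.one, ℓ, rc => rc 2 < M.d ℓ
  | Side.two, ℓ, rc => M.d (ℓ - 1) < rc 2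

/-- Condition on the target center: it lies on the same side of that interface as the targets. -/
def TargetCenterCond : Side → ℕ → Space3 → Prop
  | Side.one, ℓ, rt => M.d ℓ < rt 2
  | Side.two, ℓ, rt => rt 2 < M.d (ℓ - 1)

end LayeredMedium

/-! For every complex `w` one has `exp (x w) = ∑ (2n+1) i_n(x) P_n(w)`. Combined with the addition
theorem for complex arguments, this turns a shift of the source point or of the target point into
the series of the theorem, inside the integrand. The real issue is exchanging the sum with the
Sommerfeld integral. On the real contour the terms are controlled by `exp (κ ρ)` against a decay
`exp (-κ D)`, where `D` is the vertical distance. That handles `ρ < D`, but the claim is for `ρ <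
|R|` with `R = (X, Y, D)`.

The remedy is a change of contour. Since `|√(λ² + k²) - k| ≤ λ` for `Re k > 0`, every integrand is a
plane wave of the Laplace equation, `exp (i (k_x X + k_y Y) - k D)` on the null cone `k_x² + k_y² =
k²`, times a holomorphic amplitude growing slower than any exponential on cones. The measure `dκ dα`
on the null cone is invariant under complex rotations, because the generating vector field is
divergence-free. Rotating the cone by an imaginary angle until it is aligned with `R` improves the
modulus of the plane wave to `exp (-κ |R|)`. There the argument of the Legendre functions still
satisfies `|w| ≤ κ/λ + 1`, so the series of moduli is at most a constant times `exp (κ ρ)`, and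
dominated convergence applies as soon as `ρ < |R|` (`IsAmplitude.hasSum_expansion`).

The rotation needs the reaction densities at complex `k`. They solve a square linear system. For a
field `u` the number `k⁻¹ ∫ ε (|u'|² + λ_z² |u|²)` has positive real part when `Re k > 0`, because
`λ_z² / k = k + λ² / k`. Summed over the layers this energy reduces to the jumps at the interfaces.
Without jumps it forces `u = 0`, so Cramer's rule gives holomorphic densities (`stack_unique`,
`differentiableAt_complexDensity`). With the jumps of a source it bounds them on sectors
(`stack_bound`, `exists_bound_complexDensity`).

The local expansion comes from shifting the target, the multipole expansion from shifting the
source. The translation operator comes from shifting the source while the Legendre factor of the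
local coefficient is kept as part of the amplitude. -/

namespace SphericalFunctions

open Polynomial

/-! ### Legendre polynomials and recurrences for their derivatives. -/

theorem derivative_sq_sub_one_pow (n : ℕ) :
    derivative (((X : ℂ[X]) ^ 2 - 1) ^ (n + 1)) =
      (2 * ((n : ℂ[X]) + 1)) * (((X : ℂ[X]) ^ 2 - 1) ^ n * X) := by
  rw [derivative_pow]
  simp
  ring

theorem iterate_derivative_natCast_mul (a : ℂ[X]) (c : ℕ) (k : ℕ) :
    derivative^[k] ((c : ℂ[X]) * a) = (c : ℂ[X]) * derivative^[k] a := by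
  rw [← C_eq_natCast, iterate_derivative_C_mul]

theorem rodrigues_succ (n : ℕ) :
    derivative^[n + 1] (((X : ℂ[X]) ^ 2 - 1) ^ (n + 1)) =
      (2 * ((n : ℂ[X]) + 1)) * (derivative^[n] (((X : ℂ[X]) ^ 2 - 1) ^ n) * X +
        (n : ℂ[X]) * derivative^[n - 1] (((X : ℂ[X]) ^ 2 - 1) ^ n)) := by
  have h : (2 * ((n : ℂ[X]) + 1)) = ((2 * (n + 1) : ℕ) : ℂ[X]) := by push_cast; ring
  rw [Function.iterate_succ_apply, derivative_sq_sub_one_pow, h, iterate_derivative_natCast_mul,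
    iterate_derivative_mul_X, nsmul_eq_mul]

/-- For `q = (X² - 1)^n` one has `(X² - 1) q' = 2 n X q`. In the `n`-fold derivative of this
identity the terms `2 n X q⁽ⁿ⁾` on the two sides cancel by Leibniz's rule. The result is Legendre's
equation integrated once. -/
theorem sq_sub_one_mul_derivative_rodrigues (n : ℕ) :
    ((X : ℂ[X]) ^ 2 - 1) * derivative (derivative^[n] (((X : ℂ[X]) ^ 2 - 1) ^ n)) =
      ((n : ℂ[X]) * ((n : ℂ[X]) + 1)) * derivative^[n - 1] (((X : ℂ[X]) ^ 2 - 1) ^ n) := by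
  rcases n with _ | k
  · simp
  set q := ((X : ℂ[X]) ^ 2 - 1) ^ (k + 1) with hq
  have h0 : derivative q * X * X - derivative q = ((2 * (k + 1) : ℕ) : ℂ[X]) * (q * X) := by
    rw [hq, derivative_sq_sub_one_pow]
    push_cast
    ring
  have h1 := congrArg (fun p => derivative^[k + 1] p) h0
  simp only [iterate_derivative_sub, iterate_derivative_natCast_mul, iterate_derivative_mul_X,
    Nat.add_sub_cancel, nsmul_eq_mul] at h1
  have h2 : (k : ℂ[X]) * derivative^[k - 1] (derivative q) = k * derivative^[k] q := by
    rcases k with _ | k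
    · simp
    · rw [Nat.add_sub_cancel, ← Function.iterate_succ_apply]
  have h3 : derivative^[k + 1] (derivative q) = derivative (derivative^[k + 1] q) := by
    rw [← Function.iterate_succ_apply, Function.iterate_succ_apply']
  have h4 : derivative^[k] (derivative q) = derivative^[k + 1] q := by
    rw [← Function.iterate_succ_apply]
  rw [h3, h4] at h1
  rw [Nat.add_sub_cancel]
  push_cast at h1 ⊢
  linear_combination h1 - ((k : ℂ[X]) + 1) * h2

theorem derivative_legendrePoly_succ (n : ℕ) :
    derivative (legendrePoly (n + 1)) =
      X * derivative (legendrePoly n) + ((n : ℂ[X]) + 1) * legendrePoly n := by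
  have h : derivative^[n + 1 + 1] (((X : ℂ[X]) ^ 2 - 1) ^ (n + 1)) =
      ((2 * (n + 1) : ℕ) : ℂ[X]) * (derivative^[n + 1] (((X : ℂ[X]) ^ 2 - 1) ^ n) * X +
        ((n + 1 : ℕ) : ℂ[X]) * derivative^[n] (((X : ℂ[X]) ^ 2 - 1) ^ n)) := by
    have h : (2 * ((n : ℂ[X]) + 1)) = ((2 * (n + 1) : ℕ) : ℂ[X]) := by push_cast; ring
    rw [Function.iterate_succ_apply, derivative_sq_sub_one_pow, h, iterate_derivative_natCast_mul,
      iterate_derivative_mul_X, nsmul_eq_mul, Nat.add_sub_cancel]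
  have hc : C (1 / (2 ^ (n + 1) * ((n + 1).factorial : ℂ))) * ((2 * (n + 1) : ℕ) : ℂ[X]) =
      C (1 / (2 ^ n * (n.factorial : ℂ))) := by
    rw [← C_eq_natCast, ← C_mul]
    congr 1
    have := n.factorial_ne_zero
    rw [Nat.factorial_succ]
    push_cast
    field_simp
    try ring
  simp only [legendrePoly, derivative_C_mul]
  rw [← Function.iterate_succ_apply' derivative, ← Function.iterate_succ_apply' derivative, h,
    ← mul_assoc, hc]
  push_cast
  ring

theorem succ_mul_legendrePoly_succ (n : ℕ) :
    ((n : ℂ[X]) + 1) * legendrePoly (n + 1) =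
      ((n : ℂ[X]) + 1) * (X * legendrePoly n) + (X ^ 2 - 1) * derivative (legendrePoly n) := by
  have hc : C (1 / (2 ^ (n + 1) * ((n + 1).factorial : ℂ))) * (2 * ((n : ℂ[X]) + 1)) =
      C (1 / (2 ^ n * (n.factorial : ℂ))) := by
    have h : (2 * ((n : ℂ[X]) + 1)) = ((2 * (n + 1) : ℕ) : ℂ[X]) := by push_cast; ring
    rw [h, ← C_eq_natCast, ← C_mul]
    congr 1
    have := n.factorial_ne_zero
    rw [Nat.factorial_succ]
    push_cast
    field_simp
    try ring
  have h2 := sq_sub_one_mul_derivative_rodrigues n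
  simp only [legendrePoly, derivative_C_mul]
  rw [rodrigues_succ]
  linear_combination ((n : ℂ[X]) + 1) * (derivative^[n] (((X : ℂ[X]) ^ 2 - 1) ^ n) * X +
        (n : ℂ[X]) * derivative^[n - 1] (((X : ℂ[X]) ^ 2 - 1) ^ n)) * hc -
      C (1 / (2 ^ n * (n.factorial : ℂ))) * h2

theorem sq_sub_one_mul_derivative_legendrePoly (n : ℕ) :
    ((X : ℂ[X]) ^ 2 - 1) * derivative (legendrePoly (n + 1)) =
      ((n : ℂ[X]) + 1) * (X * legendrePoly (n + 1) - legendrePoly n) := by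
  have h1 := derivative_legendrePoly_succ n
  have h2 := succ_mul_legendrePoly_succ n
  linear_combination (X ^ 2 - 1) * h1 - X * h2

/-- Bonnet's recursion. -/
theorem legendrePoly_bonnet (n : ℕ) :
    ((n : ℂ[X]) + 2) * legendrePoly (n + 2) =
      (2 * (n : ℂ[X]) + 3) * (X * legendrePoly (n + 1)) - ((n : ℂ[X]) + 1) * legendrePoly n := by
  have h1 := succ_mul_legendrePoly_succ (n + 1)
  have h2 := sq_sub_one_mul_derivative_legendrePoly n
  push_cast at h1
  linear_combination h1 + h2

theorem derivative_legendrePoly_sub (n : ℕ) :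
    derivative (legendrePoly (n + 2)) - derivative (legendrePoly n) =
      (2 * (n : ℂ[X]) + 3) * legendrePoly (n + 1) := by
  have hu : ((X : ℂ[X]) ^ 2 - 1) ≠ 0 := by
    intro h
    have := congrArg (eval 0) h
    simp at this
  have h1 := derivative_legendrePoly_succ (n + 1)
  have h2 := sq_sub_one_mul_derivative_legendrePoly n
  have h3 := succ_mul_legendrePoly_succ n
  -- The recurrences give this relation only after multiplication by `X² - 1`, a factor that can be
  -- cancelled in the domain `ℂ[X]`.
  have h4 : derivative (legendrePoly n) =
      X * derivative (legendrePoly (n + 1)) - ((n : ℂ[X]) + 1) * legendrePoly (n + 1) := by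
    apply mul_left_cancel₀ hu
    linear_combination -h3 - X * h2
  push_cast at h1
  linear_combination h1 - h4

theorem legendrePoly_zero : legendrePoly 0 = 1 := by simp [legendrePoly]

theorem legendrePoly_one : legendrePoly 1 = X := by
  have := succ_mul_legendrePoly_succ 0
  simpa [legendrePoly_zero] using this

/-- Values of the derivatives of the Legendre polynomials. -/
noncomputable def legendreDeriv (n m : ℕ) (z : ℂ) : ℂ :=
  (derivative^[m] (legendrePoly n)).eval z

theorem legendreDeriv_sub (n m : ℕ) (z : ℂ) :
    (2 * (n : ℂ) + 3) * legendreDeriv (n + 1) m z =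
      legendreDeriv (n + 2) (m + 1) z - legendreDeriv n (m + 1) z := by
  have h := congrArg (fun p => (derivative^[m] p).eval z) (derivative_legendrePoly_sub n)
  have hc : (2 * (n : ℂ[X]) + 3) = ((2 * n + 3 : ℕ) : ℂ[X]) := by push_cast; ring
  rw [hc] at h
  simp only [iterate_derivative_sub, iterate_derivative_natCast_mul,
    ← Function.iterate_succ_apply, eval_sub, eval_mul, eval_natCast] at h
  push_cast at h
  simp only [legendreDeriv]
  exact h.symm

/-- Bonnet's recursion differentiated `m` times. The Leibniz term containing the derivative of order
`m - 1` is eliminated with `legendreDeriv_sub`. -/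
theorem legendreDeriv_mul (n m : ℕ) (z : ℂ) :
    (2 * (n : ℂ) + 3) * (z * legendreDeriv (n + 1) m z) =
      ((n : ℂ) + 2 - m) * legendreDeriv (n + 2) m z + ((n : ℂ) + 1 + m) * legendreDeriv n m z := by
  have h := congrArg (fun p => (derivative^[m] p).eval z) (legendrePoly_bonnet n)
  have hc : (2 * (n : ℂ[X]) + 3) = ((2 * n + 3 : ℕ) : ℂ[X]) := by push_cast; ring
  have hc1 : ((n : ℂ[X]) + 1) = ((n + 1 : ℕ) : ℂ[X]) := by push_cast; ring
  have hc2 : ((n : ℂ[X]) + 2) = ((n + 2 : ℕ) : ℂ[X]) := by push_cast; ring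
  rw [hc, hc1, hc2, mul_comm X] at h
  simp only [iterate_derivative_sub, iterate_derivative_natCast_mul, iterate_derivative_mul_X,
    eval_sub, eval_mul, eval_natCast, eval_add, eval_X, nsmul_eq_mul] at h
  push_cast at h
  rcases m with _ | m
  · simp only [legendreDeriv] at *
    simp only [Nat.cast_zero] at *
    linear_combination -h
  · have h1 := legendreDeriv_sub n m z
    simp only [legendreDeriv] at *
    rw [Nat.add_sub_cancel] at h
    push_cast at *
    linear_combination -h - ((m : ℂ) + 1) * h1

/-- Differentiating the relation of order `m` produces a term in `z P⁽ᵐ⁺¹⁾`, which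
`legendreDeriv_mul` rewrites in degrees `n` and `n + 2`. Together with `legendreDeriv_sub` and
`legendreDeriv_mul` this covers the order shifts `1`, `-1` and `0` that occur in the addition
theorem. -/
theorem legendreDeriv_one_sub_sq (n m : ℕ) : ∀ z : ℂ,
    (2 * (n : ℂ) + 3) * ((1 - z ^ 2) * legendreDeriv (n + 1) (m + 1) z) =
      ((n : ℂ) + 1 + m) * ((n : ℂ) + 2 + m) * legendreDeriv n m z -
        ((n : ℂ) + 1 - m) * ((n : ℂ) + 2 - m) * legendreDeriv (n + 2) m z := by
  induction m with
  | zero =>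
    intro z
    have h1 := congrArg (eval z) (sq_sub_one_mul_derivative_legendrePoly n)
    have h2 := congrArg (eval z) (legendrePoly_bonnet n)
    simp only [legendreDeriv, Function.iterate_succ, Function.iterate_zero, id,
      Function.comp] at *
    simp only [eval_mul, eval_sub, eval_add, eval_pow, eval_X, eval_one, eval_natCast,
      eval_ofNat] at h1 h2
    push_cast
    linear_combination (-(2 * (n : ℂ) + 3)) * h1 + ((n : ℂ) + 1) * h2
  | succ m ih =>
    intro z
    have hp : (2 * (n : ℂ[X]) + 3) *
          ((1 - X ^ 2) * derivative^[m + 1] (legendrePoly (n + 1))) =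
        ((n : ℂ[X]) + 1 + (m : ℂ[X])) * ((n : ℂ[X]) + 2 + (m : ℂ[X])) * derivative^[m] (legendrePoly n) -
          ((n : ℂ[X]) + 1 - (m : ℂ[X])) * ((n : ℂ[X]) + 2 - (m : ℂ[X])) *
            derivative^[m] (legendrePoly (n + 2)) :=
      Polynomial.funext fun z => by simpa [legendreDeriv] using ih z
    have h1 := congrArg (fun p => eval z (derivative p)) hp
    have h2 := legendreDeriv_mul n (m + 1) z
    simp only [legendreDeriv, Function.iterate_succ_apply'] at *
    simp at h1
    push_cast at *
    linear_combination h1 + 2 * h2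

theorem legendreDeriv_eq (n m : ℕ) (z : ℂ) :
    legendreDeriv n m z = 1 / (2 ^ n * (n.factorial : ℂ)) *
      (derivative^[n + m] (((X : ℂ[X]) ^ 2 - 1) ^ n)).eval z := by
  rw [legendreDeriv, legendrePoly, iterate_derivative_C_mul, eval_mul, eval_C,
    ← Function.iterate_add_apply, add_comm m n]

theorem legendreDeriv_eq_zero {n m : ℕ} (h : n < m) (z : ℂ) : legendreDeriv n m z = 0 := by
  have h1 : (((X : ℂ[X]) ^ 2 - 1) ^ n).natDegree < n + m := by
    refine lt_of_le_of_lt (natDegree_pow_le_of_le n (m := 2) ?_) (by omega)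
    compute_degree
  rw [legendreDeriv_eq, iterate_derivative_eq_zero h1]
  simp

theorem iterate_derivative_comp_neg_X (p : ℂ[X]) (k : ℕ) :
    derivative^[k] (p.comp (-X)) = (-1) ^ k * (derivative^[k] p).comp (-X) := by
  induction k generalizing p with
  | zero => simp
  | succ k ih => simp [ih (derivative p), derivative_comp, pow_succ]

theorem legendreDeriv_neg (n m : ℕ) (z : ℂ) :
    legendreDeriv n m (-z) = (-1) ^ (n + m) * legendreDeriv n m z := by
  have h1 : (((X : ℂ[X]) ^ 2 - 1) ^ n).comp (-X) = ((X : ℂ[X]) ^ 2 - 1) ^ n := by simp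
  have h2 := congrArg (eval (-z)) (iterate_derivative_comp_neg_X (((X : ℂ[X]) ^ 2 - 1) ^ n) (n + m))
  rw [h1] at h2
  simp only [eval_mul, eval_comp, eval_neg, eval_X, neg_neg, eval_pow, eval_one] at h2
  rw [legendreDeriv_eq, legendreDeriv_eq, h2]
  ring

theorem legendreDeriv_zero_zero (z : ℂ) : legendreDeriv 0 0 z = 1 := by
  simp [legendreDeriv, legendrePoly_zero]

theorem legendreDeriv_one_zero (z : ℂ) : legendreDeriv 1 0 z = z := by
  simp [legendreDeriv, legendrePoly_one]

theorem legendreDeriv_one_one (z : ℂ) : legendreDeriv 1 1 z = 1 := by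
  simp [legendreDeriv, legendrePoly_one]

/-! ### Modified spherical Bessel functions and the Legendre expansion of the exponential. -/

/-- Coefficient of `x ^ (2 k + n)` in the power series of `i_n`. -/
noncomputable def besselCoeff (k n : ℕ) : ℝ :=
  Real.sqrt Real.pi / 2 * (1 / 2) ^ (2 * k + n) / (k.factorial * Real.Gamma ((k : ℝ) + n + 3 / 2))

theorem gamma_add_three_half_pos (k n : ℕ) : 0 < Real.Gamma ((k : ℝ) + n + 3 / 2) :=
  Real.Gamma_pos_of_pos (by positivity)

theorem besselCoeff_pos (k n : ℕ) : 0 < besselCoeff k n := by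
  have := gamma_add_three_half_pos k n
  unfold besselCoeff
  positivity

theorem gamma_succ_add (k n : ℕ) : Real.Gamma ((k : ℝ) + 1 + n + 3 / 2) =
    ((k : ℝ) + n + 3 / 2) * Real.Gamma ((k : ℝ) + n + 3 / 2) := by
  rw [← Real.Gamma_add_one (by positivity)]
  ring_nf

theorem besselCoeff_succ_right (k n : ℕ) :
    besselCoeff k n = (2 * k + 2 * n + 3) * besselCoeff k (n + 1) := by
  have h := gamma_succ_add k n
  have := gamma_add_three_half_pos k n
  have e : (k : ℝ) + (n + 1 : ℕ) + 3 / 2 = k + 1 + n + 3 / 2 := by push_cast; ring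
  simp only [besselCoeff]
  rw [e, h, ← add_assoc, pow_succ]
  field_simp

theorem besselCoeff_succ_left (k n : ℕ) :
    besselCoeff k (n + 1) = 2 * (k + 1) * besselCoeff (k + 1) n := by
  have := gamma_add_three_half_pos (k + 1) n
  have e : (k : ℝ) + (n + 1 : ℕ) + 3 / 2 = (k + 1 : ℕ) + n + 3 / 2 := by push_cast; ring
  have e2 : 2 * (k + 1) + n = 2 * k + (n + 1) + 1 := by ring
  simp only [besselCoeff]
  rw [e, e2, pow_succ, Nat.factorial_succ]
  push_cast at *
  field_simp

/-- Passing from `k` to `k + 1` multiplies the Gamma value by `k + n + 3/2 ≥ 1`, so it never falls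
below its value at `k = 0`. Hence `i_n` is at most its leading term times `exp (x²/4)`. -/
theorem besselCoeff_le (k n : ℕ) :
    besselCoeff k n ≤ besselCoeff 0 n * ((1 / 4) ^ k / k.factorial) := by
  have h : ∀ k : ℕ, Real.Gamma ((0 : ℕ) + n + 3 / 2) ≤ Real.Gamma ((k : ℝ) + n + 3 / 2) := by
    intro k
    induction k with
    | zero => exact le_rfl
    | succ k ih =>
      have h1 := gamma_succ_add k n
      have h2 := gamma_add_three_half_pos k n
      push_cast at *
      rw [h1]
      have : (0 : ℝ) ≤ (k : ℝ) + n := by positivity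
      nlinarith
  have h0 := gamma_add_three_half_pos 0 n
  have hk := gamma_add_three_half_pos k n
  have e : besselCoeff 0 n * ((1 / 4) ^ k / k.factorial) =
      Real.sqrt Real.pi / 2 * (1 / 2) ^ (2 * k + n) /
        (k.factorial * Real.Gamma ((0 : ℕ) + n + 3 / 2)) := by
    simp only [besselCoeff]
    rw [pow_add _ (2 * k), pow_mul]
    norm_num
    field_simp
  rw [e]
  unfold besselCoeff
  have := h k
  gcongr

theorem besselCoeff_mul_pow_le (k n : ℕ) {x : ℝ} (hx : 0 ≤ x) :
    besselCoeff k n * x ^ (2 * k + n) ≤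
      besselCoeff 0 n * x ^ n * ((x ^ 2 / 4) ^ k / k.factorial) := by
  calc besselCoeff k n * x ^ (2 * k + n)
      ≤ (besselCoeff 0 n * ((1 / 4) ^ k / k.factorial)) * x ^ (2 * k + n) := by
        gcongr; exact besselCoeff_le k n
    _ = _ := by
        have : (x ^ 2 / 4) ^ k = (1 / 4) ^ k * x ^ (2 * k) := by
          rw [pow_mul, ← mul_pow]; ring_nf
        rw [this, pow_add]; ring

theorem summable_besselCoeff_mul (n : ℕ) {x : ℝ} (hx : 0 ≤ x) :
    Summable fun k => besselCoeff k n * x ^ (2 * k + n) := by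
  have h : Summable fun k : ℕ => besselCoeff 0 n * x ^ n * ((x ^ 2 / 4) ^ k / k.factorial) :=
    (Real.summable_pow_div_factorial _).mul_left _
  refine Summable.of_nonneg_of_le (fun k => ?_) (fun k => besselCoeff_mul_pow_le k n hx) h
  have := besselCoeff_pos k n
  positivity

theorem hasSum_sphBesselI (n : ℕ) {x : ℝ} (hx : 0 ≤ x) :
    HasSum (fun k => besselCoeff k n * x ^ (2 * k + n)) (sphBesselI n x) := by
  convert (summable_besselCoeff_mul n hx).hasSum using 1
  rw [sphBesselI, ← tsum_mul_left]
  refine tsum_congr fun k => ?_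
  rw [besselCoeff, div_pow, div_pow, one_pow]
  ring

theorem sphBesselI_nonneg (n : ℕ) {x : ℝ} (hx : 0 ≤ x) : 0 ≤ sphBesselI n x :=
  (hasSum_sphBesselI n hx).nonneg fun k => by
    have := besselCoeff_pos k n
    positivity

theorem hasSum_pow_div_factorial (x : ℝ) :
    HasSum (fun k : ℕ => x ^ k / k.factorial) (Real.exp x) := by
  have h := NormedSpace.expSeries_div_hasSum_exp x
  rwa [← Real.exp_eq_exp_ℝ] at h

theorem sphBesselI_le (n : ℕ) {x : ℝ} (hx : 0 ≤ x) :
    sphBesselI n x ≤ besselCoeff 0 n * x ^ n * Real.exp (x ^ 2 / 4) :=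
  hasSum_le (fun k => besselCoeff_mul_pow_le k n hx) (hasSum_sphBesselI n hx)
    ((hasSum_pow_div_factorial (x ^ 2 / 4)).mul_left _)

theorem besselCoeff_zero_zero : besselCoeff 0 0 = 1 := by
  have h : Real.Gamma (3 / 2) = Real.sqrt Real.pi / 2 := by
    rw [show (3 / 2 : ℝ) = 1 / 2 + 1 by norm_num, Real.Gamma_add_one (by norm_num),
      Real.Gamma_one_half_eq]
    ring
  have h2 : Real.sqrt Real.pi ≠ 0 := by positivity
  have h3 : ((0 : ℕ) : ℝ) + (0 : ℕ) + 3 / 2 = 3 / 2 := by norm_num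
  rw [besselCoeff, h3, h]
  simp [h2]

/-- Since `besselCoeff 0 n = 1/(2n+1)!!` and the leading coefficient of `P_n` is `(2n-1)!!/n!`, the
prefactor makes the polynomial monic. Bonnet's recursion then gives a bound by a power of `|w| + 1`,
in which `|w|` has coefficient one. -/
theorem norm_legendrePoly_le (w : ℂ) (n : ℕ) :
    (2 * n + 1) * besselCoeff 0 n * n.factorial * ‖legendreDeriv n 0 w‖ ≤ (‖w‖ + 1) ^ n := by
  have h0 := besselCoeff_zero_zero
  have h1 : besselCoeff 0 1 = 1 / 3 := by
    have := besselCoeff_succ_right 0 0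
    norm_num [h0] at this ⊢
    linarith
  induction n using Nat.twoStepInduction with
  | zero => simp [h0, legendreDeriv_zero_zero]
  | one => norm_num [h1, legendreDeriv_one_zero]
  | more n ih0 ih1 =>
    set Y := ‖w‖ + 1 with hY
    have hY1 : 1 ≤ Y := by have := norm_nonneg w; linarith
    have hB := legendreDeriv_mul n 0 w
    have hB' : ((n : ℂ) + 2) * legendreDeriv (n + 2) 0 w =
        (2 * (n : ℂ) + 3) * (w * legendreDeriv (n + 1) 0 w) -
          ((n : ℂ) + 1) * legendreDeriv n 0 w := by
      push_cast at hB; linear_combination -hB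
    have c1 : ‖((n : ℂ) + 2)‖ = n + 2 := by
      have : ((n : ℂ) + 2) = ((n + 2 : ℕ) : ℂ) := by push_cast; ring
      rw [this, Complex.norm_natCast]; push_cast; ring
    have c2 : ‖(2 * (n : ℂ) + 3)‖ = 2 * n + 3 := by
      have : (2 * (n : ℂ) + 3) = ((2 * n + 3 : ℕ) : ℂ) := by push_cast; ring
      rw [this, Complex.norm_natCast]; push_cast; ring
    have c3 : ‖((n : ℂ) + 1)‖ = n + 1 := by
      have : ((n : ℂ) + 1) = ((n + 1 : ℕ) : ℂ) := by push_cast; ring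
      rw [this, Complex.norm_natCast]; push_cast; ring
    have hN : (n + 2 : ℝ) * ‖legendreDeriv (n + 2) 0 w‖ ≤
        (2 * n + 3) * (‖w‖ * ‖legendreDeriv (n + 1) 0 w‖) + (n + 1) * ‖legendreDeriv n 0 w‖ := by
      rw [← c1, ← c2, ← c3, ← norm_mul, ← norm_mul, ← norm_mul, ← norm_mul, hB']
      exact norm_sub_le _ _
    have g1 := besselCoeff_succ_right 0 n
    have g2 := besselCoeff_succ_right 0 (n + 1)
    have gp := besselCoeff_pos 0 (n + 1)
    have fp : (0 : ℝ) < n.factorial := by positivity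
    set p2 := ‖legendreDeriv (n + 2) 0 w‖
    set p1 := ‖legendreDeriv (n + 1) 0 w‖
    set p0 := ‖legendreDeriv n 0 w‖ with hp0
    have hp0' : 0 ≤ p0 := norm_nonneg _
    rw [Nat.factorial_succ] at ih1
    rw [Nat.factorial_succ, Nat.factorial_succ]
    push_cast at *
    rw [g1] at ih0
    calc (2 * ((n : ℝ) + 2) + 1) * besselCoeff 0 (n + 2) * ((n + 1 + 1) * ((n + 1) * n.factorial)) * p2
        = besselCoeff 0 (n + 1) * (n + 1) * n.factorial * ((n + 2) * p2) := by rw [g2]; ring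
      _ ≤ besselCoeff 0 (n + 1) * (n + 1) * n.factorial *
            ((2 * n + 3) * (‖w‖ * p1) + (n + 1) * p0) := by gcongr
      _ = ‖w‖ * ((2 * (n + 1) + 1) * besselCoeff 0 (n + 1) * ((n + 1) * n.factorial) * p1) +
            (n + 1) ^ 2 * (besselCoeff 0 (n + 1) * n.factorial * p0) := by ring
      _ ≤ ‖w‖ * Y ^ (n + 1) + (2 * n + 1) * (2 * 0 + 2 * n + 3) *
            (besselCoeff 0 (n + 1) * n.factorial * p0) := by
          -- The weight is enlarged because `(2n+3) besselCoeff 0 (n+1) = besselCoeff 0 n` then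
          -- reproduces the induction hypothesis at `n`.
          have : ((n : ℝ) + 1) ^ 2 ≤ (2 * n + 1) * (2 * 0 + 2 * n + 3) := by
            have : (0 : ℝ) ≤ n := by positivity
            nlinarith
          gcongr
      _ ≤ ‖w‖ * Y ^ (n + 1) + Y ^ n := by
          have : (2 * (n : ℝ) + 1) * (2 * 0 + 2 * n + 3) *
            (besselCoeff 0 (n + 1) * n.factorial * p0) =
            (2 * n + 1) * ((2 * 0 + 2 * n + 3) * besselCoeff 0 (n + 1)) * n.factorial * p0 := by ring
          rw [this]
          gcongr
      _ ≤ ‖w‖ * Y ^ (n + 1) + Y ^ (n + 1) := by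
          have : Y ^ n ≤ Y ^ (n + 1) := pow_le_pow_right₀ hY1 (by omega)
          gcongr
      _ = Y ^ (n + 2) := by rw [hY]; ring

/-- Terms of the expansion of `exp (x w)` into Legendre polynomials. -/
noncomputable def expLegendreTerm (n : ℕ) (x : ℝ) (w : ℂ) : ℂ :=
  (2 * (n : ℂ) + 1) * (sphBesselI n x : ℂ) * legendreDeriv n 0 w

/-- Summed over `n` the bound is `exp (x²/4 + x (|w| + 1))`. Its rate `x` in `|w|` is that of `exp
(x w)` itself, and a larger rate would shrink the region of convergence in the theorem. -/
theorem norm_expLegendreTerm_le (n : ℕ) {x : ℝ} (hx : 0 ≤ x) (w : ℂ) :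
    ‖expLegendreTerm n x w‖ ≤
      Real.exp (x ^ 2 / 4) * ((x * (‖w‖ + 1)) ^ n / n.factorial) := by
  have c2 : ‖(2 * (n : ℂ) + 1)‖ = 2 * n + 1 := by
    have : (2 * (n : ℂ) + 1) = ((2 * n + 1 : ℕ) : ℂ) := by push_cast; ring
    rw [this, Complex.norm_natCast]; push_cast; ring
  have hb := norm_legendrePoly_le w n
  have fp : (0 : ℝ) < n.factorial := by positivity
  rw [expLegendreTerm, norm_mul, norm_mul, c2, Complex.norm_real, Real.norm_eq_abs,
    abs_of_nonneg (sphBesselI_nonneg n hx)]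
  calc (2 * (n : ℝ) + 1) * sphBesselI n x * ‖legendreDeriv n 0 w‖
      ≤ (2 * n + 1) * (besselCoeff 0 n * x ^ n * Real.exp (x ^ 2 / 4)) *
          ‖legendreDeriv n 0 w‖ := by
        gcongr; exact sphBesselI_le n hx
    _ = Real.exp (x ^ 2 / 4) * (x ^ n / n.factorial) *
          ((2 * n + 1) * besselCoeff 0 n * n.factorial * ‖legendreDeriv n 0 w‖) := by
        field_simp
    _ ≤ Real.exp (x ^ 2 / 4) * (x ^ n / n.factorial) * (‖w‖ + 1) ^ n := by gcongr
    _ = _ := by rw [mul_pow]; ring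

/-- Coefficient of `x ^ N` in the power series of `i_n`. -/
noncomputable def besselSeriesCoeff (N n : ℕ) : ℝ :=
  if n ≤ N ∧ Even (N - n) then besselCoeff ((N - n) / 2) n else 0

theorem besselSeriesCoeff_add (k n : ℕ) : besselSeriesCoeff (2 * k + n) n = besselCoeff k n := by
  simp [besselSeriesCoeff]

theorem besselSeriesCoeff_of_lt {N n : ℕ} (h : N < n) : besselSeriesCoeff N n = 0 := by
  simp [besselSeriesCoeff, h]

/-- This is `(2n+1) i_n' = n i_{n-1} + (n+1) i_{n+1}`, read off at the power `x ^ N`. For `n = 0`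
the truncated index `n - 1` is harmless because of the factor `n`. -/
theorem besselSeriesCoeff_succ (N n : ℕ) :
    (N + 1) * (2 * n + 1) * besselSeriesCoeff (N + 1) n =
      n * besselSeriesCoeff N (n - 1) + (n + 1) * besselSeriesCoeff N (n + 1) := by
  by_cases h : ∃ k, N + 1 = 2 * k + n
  · obtain ⟨k, hk⟩ := h
    have hN : ((N : ℝ) + 1) = 2 * k + n := by exact_mod_cast hk
    rw [hk, besselSeriesCoeff_add, hN]
    have t1 : (n : ℝ) * besselSeriesCoeff N (n - 1) =
        n * ((2 * k + 2 * n + 1) * besselCoeff k n) := by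
      rcases n with _ | n
      · simp
      · have : N = 2 * k + n := by omega
        rw [Nat.add_sub_cancel, this, besselSeriesCoeff_add, besselCoeff_succ_right]
        push_cast
        ring
    have t2 : besselSeriesCoeff N (n + 1) = 2 * k * besselCoeff k n := by
      rcases k with _ | k
      · rw [besselSeriesCoeff_of_lt (by omega)]; simp
      · have : N = 2 * k + (n + 1) := by omega
        rw [this, besselSeriesCoeff_add, besselCoeff_succ_left]
        push_cast
        ring
    rw [t1, t2]
    ring
  · have z1 : besselSeriesCoeff (N + 1) n = 0 := by
      rw [besselSeriesCoeff, if_neg]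
      rintro ⟨h1, k, hk⟩
      exact h ⟨k, by omega⟩
    have z2 : (n : ℝ) * besselSeriesCoeff N (n - 1) = 0 := by
      rcases n with _ | n
      · simp
      · rw [besselSeriesCoeff, if_neg, mul_zero]
        rintro ⟨h1, k, hk⟩
        exact h ⟨k, by omega⟩
    have z3 : besselSeriesCoeff N (n + 1) = 0 := by
      rw [besselSeriesCoeff, if_neg]
      rintro ⟨h1, k, hk⟩
      exact h ⟨k + 1, by omega⟩
    rw [z1, z2, z3]
    ring

/-- Multiplication by `w` acts on the `P_n` through Bonnet's recursion. Collecting the coefficient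
of each `P_n` gives exactly the recursion of the Bessel coefficients, so the identity passes from
`N` to `N + 1`. -/
theorem pow_div_factorial_eq_sum_legendre (w : ℂ) (N : ℕ) :
    w ^ N / N.factorial = ∑ n ∈ Finset.range (N + 1),
      (2 * (n : ℂ) + 1) * (besselSeriesCoeff N n : ℂ) * legendreDeriv n 0 w := by
  induction N with
  | zero =>
    have h0 := besselCoeff_zero_zero
    simp [besselSeriesCoeff, h0, legendreDeriv_zero_zero]
  | succ N ih =>
    have hrec : ∀ n : ℕ, ((N : ℂ) + 1) * ((2 * (n : ℂ) + 1) * (besselSeriesCoeff (N + 1) n : ℂ)) =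
        n * (besselSeriesCoeff N (n - 1) : ℂ) + (n + 1) * (besselSeriesCoeff N (n + 1) : ℂ) := by
      intro n
      have := congrArg (fun t : ℝ => (t : ℂ)) (besselSeriesCoeff_succ N n)
      push_cast at this
      linear_combination this
    have hN : ((N : ℂ) + 1) ≠ 0 := by exact_mod_cast N.succ_ne_zero
    have key : ((N : ℂ) + 1) * ∑ n ∈ Finset.range (N + 1 + 1),
        (2 * (n : ℂ) + 1) * (besselSeriesCoeff (N + 1) n : ℂ) * legendreDeriv n 0 w =
        w * (w ^ N / N.factorial) := by
      rw [ih, Finset.mul_sum, Finset.mul_sum]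
      have l1 : ∀ n ∈ Finset.range (N + 1 + 1), ((N : ℂ) + 1) *
          ((2 * (n : ℂ) + 1) * (besselSeriesCoeff (N + 1) n : ℂ) * legendreDeriv n 0 w) =
          n * (besselSeriesCoeff N (n - 1) : ℂ) * legendreDeriv n 0 w +
          (n + 1) * (besselSeriesCoeff N (n + 1) : ℂ) * legendreDeriv n 0 w := by
        intro n _
        linear_combination legendreDeriv n 0 w * hrec n
      have l2 : ∀ n ∈ Finset.range (N + 1),
          w * ((2 * (n : ℂ) + 1) * (besselSeriesCoeff N n : ℂ) * legendreDeriv n 0 w) =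
          (n + 1) * (besselSeriesCoeff N n : ℂ) * legendreDeriv (n + 1) 0 w +
          n * (besselSeriesCoeff N n : ℂ) * legendreDeriv (n - 1) 0 w := by
        intro n _
        rcases n with _ | n
        · simp [legendreDeriv_zero_zero, legendreDeriv_one_zero, mul_comm]
        · have := legendreDeriv_mul n 0 w
          rw [Nat.add_sub_cancel]
          push_cast at *
          linear_combination (besselSeriesCoeff N (n + 1) : ℂ) * this
      rw [Finset.sum_congr rfl l1, Finset.sum_congr rfl l2, Finset.sum_add_distrib,
        Finset.sum_add_distrib]
      congr 1
      · rw [Finset.sum_range_succ']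
        simp
      · rw [Finset.sum_range_succ, Finset.sum_range_succ, besselSeriesCoeff_of_lt (by omega),
          besselSeriesCoeff_of_lt (by omega), Finset.sum_range_succ' _ N]
        simp
    have hf : (N.factorial : ℂ) ≠ 0 := by exact_mod_cast N.factorial_ne_zero
    apply mul_left_cancel₀ hN
    rw [key, Nat.factorial_succ]
    push_cast
    field_simp
    ring

theorem hasSum_besselSeriesCoeff (n : ℕ) {x : ℝ} (hx : 0 ≤ x) :
    HasSum (fun N => besselSeriesCoeff N n * x ^ N) (sphBesselI n x) := by
  have hinj : Function.Injective fun k : ℕ => 2 * k + n := fun a b h => by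
    simp only at h; omega
  rw [← hinj.hasSum_iff]
  · convert hasSum_sphBesselI n hx using 2 with k
    simp [besselSeriesCoeff_add]
  · intro N hN
    rw [besselSeriesCoeff, if_neg, zero_mul]
    rintro ⟨h1, k, hk⟩
    exact hN ⟨k, by simp only; omega⟩

/-- Expansion of the exponential into Legendre polynomials. -/
theorem hasSum_expLegendreTerm {x : ℝ} (hx : 0 ≤ x) (w : ℂ) :
    HasSum (fun n => expLegendreTerm n x w) (Complex.exp (x * w)) := by
  -- The rows of this double series sum to the Legendre terms, the columns to the terms of the
  -- exponential series. Absolute summability, from `norm_expLegendreTerm_le`, allows both orders of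
  -- summation.
  set F : ℕ × ℕ → ℂ := fun p =>
    (2 * (p.1 : ℂ) + 1) * (besselSeriesCoeff p.2 p.1 : ℂ) * legendreDeriv p.1 0 w * (x : ℂ) ^ p.2
    with hF
  have hrow : ∀ n, HasSum (fun N => F (n, N)) (expLegendreTerm n x w) := by
    intro n
    have h := (Complex.hasSum_ofReal.mpr (hasSum_besselSeriesCoeff n hx)).mul_left
      ((2 * (n : ℂ) + 1) * legendreDeriv n 0 w)
    have e : (fun N => F (n, N)) = fun N => (2 * (n : ℂ) + 1) * legendreDeriv n 0 w *
        ((besselSeriesCoeff N n * x ^ N : ℝ) : ℂ) := by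
      funext N; simp only [hF]; push_cast; ring
    rw [e, expLegendreTerm, mul_right_comm]
    exact h
  have hrown : ∀ n, HasSum (fun N => ‖F (n, N)‖) ‖expLegendreTerm n x w‖ := by
    intro n
    have h := (hasSum_besselSeriesCoeff n hx).mul_left
      ‖((2 * (n : ℂ) + 1) * legendreDeriv n 0 w)‖
    have e : (fun N => ‖F (n, N)‖) = fun N => ‖((2 * (n : ℂ) + 1) * legendreDeriv n 0 w)‖ *
        (besselSeriesCoeff N n * x ^ N) := by
      funext N
      have hnn : 0 ≤ besselSeriesCoeff N n := by
        rw [besselSeriesCoeff]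
        split_ifs
        · exact (besselCoeff_pos _ _).le
        · exact le_rfl
      simp only [hF, norm_mul, norm_pow, Complex.norm_real, Real.norm_eq_abs, abs_of_nonneg hx,
        abs_of_nonneg hnn]
      ring
    have e2 : ‖expLegendreTerm n x w‖ =
        ‖((2 * (n : ℂ) + 1) * legendreDeriv n 0 w)‖ * sphBesselI n x := by
      simp only [expLegendreTerm, norm_mul, Complex.norm_real, Real.norm_eq_abs,
        abs_of_nonneg (sphBesselI_nonneg n hx)]
      ring
    rw [e, e2]
    exact h
  have hs1 : Summable fun n => ‖expLegendreTerm n x w‖ :=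
    Summable.of_nonneg_of_le (fun _ => norm_nonneg _) (fun n => norm_expLegendreTerm_le n hx w)
      ((Real.summable_pow_div_factorial _).mul_left _)
  have hsum : Summable F := by
    rw [← summable_norm_iff, summable_prod_of_nonneg fun _ => norm_nonneg _]
    refine ⟨fun n => (hrown n).summable, ?_⟩
    simpa only [(hrown _).tsum_eq] using hs1
  have hcol : ∀ N, HasSum (fun n => F (n, N)) ((x * w) ^ N / N.factorial) := by
    intro N
    have e : ((x : ℂ) * w) ^ N / N.factorial = ∑ n ∈ Finset.range (N + 1), F (n, N) := by
      rw [mul_pow, mul_div_assoc, pow_div_factorial_eq_sum_legendre, Finset.mul_sum]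
      refine Finset.sum_congr rfl fun n _ => ?_
      simp only [hF]
      ring
    rw [e]
    refine hasSum_sum_of_ne_finset_zero fun n hn => ?_
    simp only [hF]
    rw [besselSeriesCoeff_of_lt (by simpa using hn)]
    simp
  have htot := hsum.hasSum
  have h1 : HasSum (fun n => expLegendreTerm n x w) (∑' p, F p) := htot.prod_fiberwise hrow
  have h2 : HasSum (fun N : ℕ => (x * w) ^ N / N.factorial) (∑' p, F p) := by
    have : HasSum (F ∘ Prod.swap) (∑' p, F p) := (Equiv.prodComm ℕ ℕ).hasSum_iff.mpr htot
    exact HasSum.prod_fiberwise (f := F ∘ Prod.swap) this hcol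
  have h3 : HasSum (fun N : ℕ => (x * w) ^ N / (N.factorial : ℂ)) (Complex.exp (x * w)) := by
    have h := NormedSpace.expSeries_div_hasSum_exp ((x : ℂ) * w)
    rwa [← Complex.exp_eq_exp_ℂ] at h
  rw [← h2.unique h3]
  exact h1

end SphericalFunctions

/-! ### The addition theorem for Legendre polynomials at complex arguments. -/

namespace SphericalFunctions

/-- Terms of the addition theorem for Legendre polynomials. -/
noncomputable def additionTerm (z₁ S₁ z₂ S₂ : ℂ) (n m : ℕ) : ℂ :=
  ((n - m).factorial : ℂ) / ((n + m).factorial : ℂ) *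
    (S₁ ^ m * legendreDeriv n m z₁) * (S₂ ^ m * legendreDeriv n m z₂)

theorem additionTerm_eq_zero (z₁ S₁ z₂ S₂ : ℂ) {n m : ℕ} (h : n < m) :
    additionTerm z₁ S₁ z₂ S₂ n m = 0 := by
  simp [additionTerm, legendreDeriv_eq_zero h]

theorem additionTerm_rec_zero {z₁ S₁ z₂ S₂ : ℂ} (h₁ : S₁ ^ 2 = 1 - z₁ ^ 2)
    (h₂ : S₂ ^ 2 = 1 - z₂ ^ 2) (n : ℕ) :
    (2 * (n : ℂ) + 3) * (z₁ * z₂ * additionTerm z₁ S₁ z₂ S₂ (n + 1) 0 +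
      S₁ * S₂ * additionTerm z₁ S₁ z₂ S₂ (n + 1) 1) =
    (n + 2) * additionTerm z₁ S₁ z₂ S₂ (n + 2) 0 + (n + 1) * additionTerm z₁ S₁ z₂ S₂ n 0 := by
  have hK : (2 * (n : ℂ) + 3) ≠ 0 := by
    have : (2 * (n : ℂ) + 3) = ((2 * n + 3 : ℕ) : ℂ) := by push_cast; ring
    rw [this]; exact Nat.cast_ne_zero.mpr (by omega)
  have hn1 : ((n : ℂ) + 1) ≠ 0 := by exact_mod_cast n.succ_ne_zero
  have hn2 : ((n : ℂ) + 2) ≠ 0 := by exact_mod_cast (n + 1).succ_ne_zero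
  have hf : ∀ k : ℕ, (k.factorial : ℂ) ≠ 0 := fun k => by exact_mod_cast k.factorial_ne_zero
  have e1 := legendreDeriv_mul n 0 z₁
  have e2 := legendreDeriv_mul n 0 z₂
  have f1 := legendreDeriv_one_sub_sq n 0 z₁
  have f2 := legendreDeriv_one_sub_sq n 0 z₂
  have c : ((n + 1 - 1).factorial : ℂ) / ((n + 1 + 1).factorial : ℂ) =
      1 / (((n : ℂ) + 1) * (n + 2)) := by
    rw [Nat.factorial_succ, Nat.factorial_succ, Nat.add_sub_cancel]
    have := hf n
    have h2 : ((n : ℂ) + 1 + 1) ≠ 0 := by rw [add_assoc, one_add_one_eq_two]; exact hn2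
    push_cast
    field_simp
    ring
  simp only [additionTerm, c, pow_zero, one_mul, pow_one, Nat.sub_zero, Nat.add_zero,
    div_self (hf _)]
  rw [← h₁] at f1
  rw [← h₂] at f2
  push_cast at *
  have e := congrArg₂ (fun a b => a * b) e1 e2
  have f := congrArg₂ (fun a b => a * b) f1 f2
  field_simp
  apply mul_left_cancel₀ hK
  linear_combination ((n : ℂ) + 1) * (n + 2) * e + f

/-- Bonnet's recursion with `w = z₁ z₂ + S₁ S₂ (t + t⁻¹)/2`, read off at a single power of `t`: the
factors `t` and `t⁻¹` couple neighbouring orders. -/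
theorem additionTerm_rec_succ {z₁ S₁ z₂ S₂ : ℂ} (h₁ : S₁ ^ 2 = 1 - z₁ ^ 2)
    (h₂ : S₂ ^ 2 = 1 - z₂ ^ 2) (n m : ℕ) :
    (2 * (n : ℂ) + 3) * (z₁ * z₂ * additionTerm z₁ S₁ z₂ S₂ (n + 1) (m + 1) +
      S₁ * S₂ / 2 * (additionTerm z₁ S₁ z₂ S₂ (n + 1) m +
        additionTerm z₁ S₁ z₂ S₂ (n + 1) (m + 2))) =
    (n + 2) * additionTerm z₁ S₁ z₂ S₂ (n + 2) (m + 1) +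
      (n + 1) * additionTerm z₁ S₁ z₂ S₂ n (m + 1) := by
  have hK : (2 * (n : ℂ) + 3) ≠ 0 := by
    have : (2 * (n : ℂ) + 3) = ((2 * n + 3 : ℕ) : ℂ) := by push_cast; ring
    rw [this]; exact Nat.cast_ne_zero.mpr (by omega)
  have hf : ∀ k : ℕ, (k.factorial : ℂ) ≠ 0 := fun k => by exact_mod_cast k.factorial_ne_zero
  have e1 := legendreDeriv_mul n (m + 1) z₁
  have e2 := legendreDeriv_mul n (m + 1) z₂
  have f1 := legendreDeriv_one_sub_sq n (m + 1) z₁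
  have f2 := legendreDeriv_one_sub_sq n (m + 1) z₂
  have g1 := legendreDeriv_sub n m z₁
  have g2 := legendreDeriv_sub n m z₂
  rw [← h₁] at f1
  rw [← h₂] at f2
  -- Products of the same relation at `z₁` and at `z₂`: `e` serves the order `m + 1`, `f` the order
  -- `m + 2` and `g` the order `m`. With the factorial weights, the mixed products of degrees `n`
  -- and `n + 2` cancel. Each product carries `(2n+3)²`, hence the later cancellation of `hK`.
  have e := congrArg₂ (fun a b => a * b) e1 e2
  have f := congrArg₂ (fun a b => a * b) f1 f2
  have g := congrArg₂ (fun a b => a * b) g1 g2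
  -- For `m < n` all factorials are genuine. For `m = n` and `m = n + 1` some differences are
  -- truncated, but the corresponding derivatives vanish. Beyond that every term is zero.
  rcases lt_trichotomy (m + 1) (n + 1) with h | h | h
  · obtain ⟨d, rfl⟩ : ∃ d, n = m + 1 + d := ⟨n - (m + 1), by omega⟩
    set c : ℂ := (d.factorial : ℂ) / ((2 * m + d + 4).factorial : ℂ) with hc
    have w0 : ((m + 1 + d + 1 - (m + 1)).factorial : ℂ) /
        ((m + 1 + d + 1 + (m + 1)).factorial : ℂ) = c * ((d + 1) * (2 * m + d + 4)) := by
      rw [show m + 1 + d + 1 - (m + 1) = d + 1 by omega,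
        show m + 1 + d + 1 + (m + 1) = 2 * m + d + 3 by omega, hc, Nat.factorial_succ (2 * m + d + 3),
        Nat.factorial_succ d]
      have := hf (2 * m + d + 3)
      have h4 : ((2 * (m : ℂ) + d + 3 + 1)) ≠ 0 := by exact_mod_cast (2 * m + d + 3).succ_ne_zero
      push_cast
      field_simp
      ring
    have w1 : ((m + 1 + d + 1 - m).factorial : ℂ) /
        ((m + 1 + d + 1 + m).factorial : ℂ) =
        c * ((d + 1) * (d + 2) * (2 * m + d + 3) * (2 * m + d + 4)) := by
      rw [show m + 1 + d + 1 - m = d + 1 + 1 by omega,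
        show m + 1 + d + 1 + m = 2 * m + d + 2 by omega, hc, Nat.factorial_succ (2 * m + d + 3),
        Nat.factorial_succ (2 * m + d + 2), Nat.factorial_succ (d + 1), Nat.factorial_succ d]
      have := hf (2 * m + d + 2)
      have h3 : ((2 * (m : ℂ) + d + 2 + 1)) ≠ 0 := by exact_mod_cast (2 * m + d + 2).succ_ne_zero
      have h4 : ((2 * (m : ℂ) + d + 3 + 1)) ≠ 0 := by exact_mod_cast (2 * m + d + 3).succ_ne_zero
      push_cast
      field_simp
      ring
    have w2 : ((m + 1 + d + 1 - (m + 2)).factorial : ℂ) /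
        ((m + 1 + d + 1 + (m + 2)).factorial : ℂ) = c := by
      rw [show m + 1 + d + 1 - (m + 2) = d by omega,
        show m + 1 + d + 1 + (m + 2) = 2 * m + d + 4 by omega]
    have w3 : ((m + 1 + d + 2 - (m + 1)).factorial : ℂ) /
        ((m + 1 + d + 2 + (m + 1)).factorial : ℂ) = c * ((d + 1) * (d + 2)) := by
      rw [show m + 1 + d + 2 - (m + 1) = d + 1 + 1 by omega,
        show m + 1 + d + 2 + (m + 1) = 2 * m + d + 4 by omega, hc, Nat.factorial_succ (d + 1),
        Nat.factorial_succ d]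
      push_cast
      ring
    have w4 : ((m + 1 + d - (m + 1)).factorial : ℂ) /
        ((m + 1 + d + (m + 1)).factorial : ℂ) = c * ((2 * m + d + 3) * (2 * m + d + 4)) := by
      rw [show m + 1 + d - (m + 1) = d by omega,
        show m + 1 + d + (m + 1) = 2 * m + d + 2 by omega, hc, Nat.factorial_succ (2 * m + d + 3),
        Nat.factorial_succ (2 * m + d + 2)]
      have := hf (2 * m + d + 2)
      have h3 : ((2 * (m : ℂ) + d + 2 + 1)) ≠ 0 := by exact_mod_cast (2 * m + d + 2).succ_ne_zero
      have h4 : ((2 * (m : ℂ) + d + 3 + 1)) ≠ 0 := by exact_mod_cast (2 * m + d + 3).succ_ne_zero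
      push_cast
      field_simp
      ring
    simp only [additionTerm, w0, w1, w2, w3, w4]
    apply mul_left_cancel₀ hK
    push_cast at *
    linear_combination c * (S₁ * S₂) ^ (m + 1) * (((d : ℂ) + 1) * (2 * m + d + 4) * e +
      ((d : ℂ) + 1) * (d + 2) * (2 * m + d + 3) * (2 * m + d + 4) / 2 * g + 1 / 2 * f)
  · obtain rfl : m = n := by omega
    have z0 : ∀ z, legendreDeriv m (m + 1) z = 0 := legendreDeriv_eq_zero (by omega)
    rw [additionTerm_eq_zero (n := m + 1) (m := m + 2) _ _ _ _ (by omega),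
      additionTerm_eq_zero (n := m) (m := m + 1) _ _ _ _ (by omega)]
    simp only [z0] at *
    set c : ℂ := 1 / ((2 * m + 3).factorial : ℂ) with hc
    have h3 : ((2 * (m : ℂ) + 2 + 1)) ≠ 0 := by exact_mod_cast (2 * m + 2).succ_ne_zero
    have h2 : ((2 * (m : ℂ) + 1 + 1)) ≠ 0 := by exact_mod_cast (2 * m + 1).succ_ne_zero
    have h1 := hf (2 * m + 1)
    have w0 : ((m + 1 - (m + 1)).factorial : ℂ) / ((m + 1 + (m + 1)).factorial : ℂ) =
        c * (2 * m + 3) := by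
      rw [show m + 1 - (m + 1) = 0 by omega, show m + 1 + (m + 1) = 2 * m + 2 by omega, hc,
        Nat.factorial_succ (2 * m + 2)]
      have := hf (2 * m + 2)
      push_cast
      rw [show (2 * (m : ℂ) + 2 + 1) = 2 * m + 3 by ring, Nat.factorial_zero]
      push_cast
      field_simp
    have w1 : ((m + 1 - m).factorial : ℂ) / ((m + 1 + m).factorial : ℂ) =
        c * ((2 * m + 2) * (2 * m + 3)) := by
      rw [show m + 1 - m = 1 by omega, show m + 1 + m = 2 * m + 1 by omega, hc,
        Nat.factorial_succ (2 * m + 2), Nat.factorial_succ (2 * m + 1)]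
      push_cast
      rw [show (2 * (m : ℂ) + 2 + 1) = 2 * m + 3 by ring,
        show (2 * (m : ℂ) + 1 + 1) = 2 * m + 2 by ring, Nat.factorial_one]
      have : (2 * (m : ℂ) + 2) ≠ 0 := by exact_mod_cast (2 * m + 1).succ_ne_zero
      push_cast
      field_simp
    have w3 : ((m + 2 - (m + 1)).factorial : ℂ) / ((m + 2 + (m + 1)).factorial : ℂ) = c := by
      rw [show m + 2 - (m + 1) = 1 by omega, show m + 2 + (m + 1) = 2 * m + 3 by omega, hc]
      simp
    simp only [additionTerm, w0, w1, w3]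
    apply mul_left_cancel₀ hK
    push_cast at *
    linear_combination c * (S₁ * S₂) ^ (m + 1) * ((2 * m + 3) * e +
      (2 * m + 2) * (2 * m + 3) / 2 * g)
  · rw [additionTerm_eq_zero (n := n + 1) (m := m + 1) _ _ _ _ (by omega),
      additionTerm_eq_zero (n := n + 1) (m := m + 2) _ _ _ _ (by omega),
      additionTerm_eq_zero (n := n) (m := m + 1) _ _ _ _ (by omega)]
    rcases Nat.lt_or_ge (n + 1) m with h' | h'
    · rw [additionTerm_eq_zero (n := n + 1) (m := m) _ _ _ _ (by omega),
        additionTerm_eq_zero (n := n + 2) (m := m + 1) _ _ _ _ (by omega)]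
      ring
    · obtain rfl : m = n + 1 := by omega
      have z0 : ∀ z, legendreDeriv n (n + 1 + 1) z = 0 := legendreDeriv_eq_zero (by omega)
      simp only [z0] at *
      have w0 : ((n + 1 - (n + 1)).factorial : ℂ) / ((n + 1 + (n + 1)).factorial : ℂ) =
          ((2 * n + 3) * (2 * n + 4)) / ((2 * n + 4).factorial : ℂ) := by
        rw [show n + 1 - (n + 1) = 0 by omega, show n + 1 + (n + 1) = 2 * n + 2 by omega,
          Nat.factorial_succ (2 * n + 3), Nat.factorial_succ (2 * n + 2)]
        have := hf (2 * n + 2)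
        have h3 : ((2 * (n : ℂ) + 2 + 1)) ≠ 0 := by exact_mod_cast (2 * n + 2).succ_ne_zero
        have h4 : ((2 * (n : ℂ) + 4)) ≠ 0 := by exact_mod_cast (2 * n + 3).succ_ne_zero
        push_cast
        rw [show (2 * (n : ℂ) + 2 + 1) = 2 * n + 3 by ring,
          show (2 * (n : ℂ) + 3 + 1) = 2 * n + 4 by ring, Nat.factorial_zero]
        push_cast
        field_simp
      have w1 : ((n + 2 - (n + 1 + 1)).factorial : ℂ) / ((n + 2 + (n + 1 + 1)).factorial : ℂ) =
          1 / ((2 * n + 4).factorial : ℂ) := by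
        rw [show n + 2 - (n + 1 + 1) = 0 by omega, show n + 2 + (n + 1 + 1) = 2 * n + 4 by omega]
        simp
      simp only [additionTerm, w0, w1]
      apply mul_left_cancel₀ hK
      push_cast at *
      linear_combination (S₁ * S₂) ^ (n + 2) * ((2 * n + 3) * (n + 2)) /
        ((2 * n + 4).factorial : ℂ) * g

/-- The terms are even in the order, so the recursion extends to all integer orders. At order zero
the two neighbours coincide, which accounts for the missing factor `1/2` in `additionTerm_rec_zero`.
-/
theorem additionTerm_rec {z₁ S₁ z₂ S₂ : ℂ} (h₁ : S₁ ^ 2 = 1 - z₁ ^ 2)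
    (h₂ : S₂ ^ 2 = 1 - z₂ ^ 2) (n : ℕ) (m : ℤ) :
    (2 * (n : ℂ) + 3) * (z₁ * z₂ * additionTerm z₁ S₁ z₂ S₂ (n + 1) m.natAbs +
      S₁ * S₂ / 2 * (additionTerm z₁ S₁ z₂ S₂ (n + 1) (m - 1).natAbs +
        additionTerm z₁ S₁ z₂ S₂ (n + 1) (m + 1).natAbs)) =
    (n + 2) * additionTerm z₁ S₁ z₂ S₂ (n + 2) m.natAbs +
      (n + 1) * additionTerm z₁ S₁ z₂ S₂ n m.natAbs := by
  rcases lt_trichotomy m 0 with h | rfl | h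
  · obtain ⟨k, rfl⟩ : ∃ k : ℕ, m = -((k : ℤ) + 1) := ⟨(-m - 1).toNat, by omega⟩
    have := additionTerm_rec_succ h₁ h₂ n k
    rw [show (-((k : ℤ) + 1)).natAbs = k + 1 by omega,
      show (-((k : ℤ) + 1) - 1).natAbs = k + 2 by omega,
      show (-((k : ℤ) + 1) + 1).natAbs = k by omega, add_comm (additionTerm _ _ _ _ _ (k + 2))]
    exact this
  · have := additionTerm_rec_zero h₁ h₂ n
    rw [show (0 : ℤ).natAbs = 0 by rfl, show ((0 : ℤ) - 1).natAbs = 1 by rfl,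
      show ((0 : ℤ) + 1).natAbs = 1 by rfl]
    linear_combination this
  · obtain ⟨k, rfl⟩ : ∃ k : ℕ, m = (k : ℤ) + 1 := ⟨(m - 1).toNat, by omega⟩
    have := additionTerm_rec_succ h₁ h₂ n k
    rw [show ((k : ℤ) + 1).natAbs = k + 1 by omega,
      show ((k : ℤ) + 1 - 1).natAbs = k by omega,
      show ((k : ℤ) + 1 + 1).natAbs = k + 2 by omega]
    exact this

theorem hasSum_additionTerm (z₁ S₁ z₂ S₂ t : ℂ) (n : ℕ) :
    HasSum (fun m : ℤ => additionTerm z₁ S₁ z₂ S₂ n m.natAbs * t ^ m)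
      (∑ m ∈ Finset.Icc (-(n : ℤ)) n, additionTerm z₁ S₁ z₂ S₂ n m.natAbs * t ^ m) := by
  refine hasSum_sum_of_ne_finset_zero fun m hm => ?_
  rw [additionTerm_eq_zero _ _ _ _ (by simp only [Finset.mem_Icc, not_and_or] at hm; omega),
    zero_mul]

/-- The addition theorem for Legendre polynomials. -/
theorem legendre_addition {z₁ S₁ z₂ S₂ t : ℂ} (h₁ : S₁ ^ 2 = 1 - z₁ ^ 2)
    (h₂ : S₂ ^ 2 = 1 - z₂ ^ 2) (ht : t ≠ 0) (n : ℕ) :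
    ∑ m ∈ Finset.Icc (-(n : ℤ)) n, additionTerm z₁ S₁ z₂ S₂ n m.natAbs * t ^ m =
      legendreDeriv n 0 (z₁ * z₂ + S₁ * S₂ * ((t + t⁻¹) / 2)) := by
  induction n using Nat.twoStepInduction with
  | zero => simp [additionTerm, legendreDeriv_zero_zero]
  | one =>
    have : Finset.Icc (-((1 : ℕ) : ℤ)) (1 : ℕ) = {-1, 0, 1} := by decide
    rw [this]
    simp [additionTerm, legendreDeriv_one_zero, legendreDeriv_one_one]
    ring
  | more n ih0 ih1 =>
    have s0 := hasSum_additionTerm z₁ S₁ z₂ S₂ t n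
    have s1 := hasSum_additionTerm z₁ S₁ z₂ S₂ t (n + 1)
    have s2 := hasSum_additionTerm z₁ S₁ z₂ S₂ t (n + 2)
    rw [ih0] at s0
    rw [ih1] at s1
    set w := z₁ * z₂ + S₁ * S₂ * ((t + t⁻¹) / 2) with hw
    -- In sums over all of `ℤ`, multiplication by `t` or `t⁻¹` is a shift of the index, with no
    -- boundary terms. Multiplying the sum of degree `n + 1` by `w` therefore becomes
    -- `additionTerm_rec`, and Bonnet's recursion identifies the sum of degree `n + 2`.
    have sm : HasSum (fun m : ℤ => additionTerm z₁ S₁ z₂ S₂ (n + 1) (m - 1).natAbs * t ^ m)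
        (t * legendreDeriv (n + 1) 0 w) := by
      have := ((Equiv.subRight (1 : ℤ)).hasSum_iff.mpr s1).mul_left t
      refine this.congr_fun fun m => ?_
      simp only [Function.comp, Equiv.subRight_apply]
      rw [zpow_sub_one₀ ht]
      field_simp
    have sp : HasSum (fun m : ℤ => additionTerm z₁ S₁ z₂ S₂ (n + 1) (m + 1).natAbs * t ^ m)
        (t⁻¹ * legendreDeriv (n + 1) 0 w) := by
      have := ((Equiv.addRight (1 : ℤ)).hasSum_iff.mpr s1).mul_left t⁻¹
      refine this.congr_fun fun m => ?_
      simp only [Function.comp, Equiv.coe_addRight]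
      rw [zpow_add_one₀ ht]
      field_simp
    have sl := ((s1.mul_left (z₁ * z₂)).add ((sm.add sp).mul_left (S₁ * S₂ / 2))).mul_left
      (2 * (n : ℂ) + 3)
    have sr := (s2.mul_left ((n : ℂ) + 2)).add (s0.mul_left ((n : ℂ) + 1))
    have heq := sl.unique (sr.congr_fun fun m => by
      have := additionTerm_rec h₁ h₂ n m
      linear_combination (t ^ m) * this)
    have hB := legendreDeriv_mul n 0 w
    have hn2 : ((n : ℂ) + 2) ≠ 0 := by exact_mod_cast (n + 1).succ_ne_zero
    apply mul_left_cancel₀ hn2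
    push_cast at hB
    rw [hw] at *
    linear_combination hB - heq

end SphericalFunctions

/-! ### Normalized Legendre functions, their branch, and sums over the order. -/

namespace SphericalFunctions

open Polynomial

theorem ofReal_cpow_half {x : ℝ} (hx : 0 ≤ x) : (x : ℂ) ^ (1 / 2 : ℂ) = (Real.sqrt x : ℂ) := by
  rw [Real.sqrt_eq_rpow, Complex.ofReal_cpow hx]
  norm_num

theorem sqrtOneSubSq_sq (w : ℂ) : sqrtOneSubSq w ^ 2 = 1 - w ^ 2 := by
  have h : ∀ z : ℂ, (z ^ (1 / 2 : ℂ)) ^ 2 = z := fun z => by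
    rw [one_div]; exact Complex.cpow_nat_inv_pow z two_ne_zero
  rw [sqrtOneSubSq, mul_pow, mul_pow, h, h, neg_sq, Complex.I_sq]
  ring

theorem sqrtOneSubSq_of_one_le {x : ℝ} (hx : 1 ≤ x) :
    sqrtOneSubSq (x : ℂ) = -Complex.I * (Real.sqrt (x ^ 2 - 1) : ℂ) := by
  have h1 : (x : ℂ) + 1 = ((x + 1 : ℝ) : ℂ) := by push_cast; ring
  have h2 : (x : ℂ) - 1 = ((x - 1 : ℝ) : ℂ) := by push_cast; ring
  rw [sqrtOneSubSq, h1, h2, ofReal_cpow_half (by linarith), ofReal_cpow_half (by linarith),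
    ← Complex.ofReal_mul, ← Real.sqrt_mul (by linarith)]
  congr 4
  ring

theorem sqrtOneSubSq_cos {θ : ℝ} (h0 : 0 ≤ θ) (hπ : θ ≤ Real.pi) :
    sqrtOneSubSq (Real.cos θ : ℂ) = (Real.sin θ : ℂ) := by
  have h1 : (Real.cos θ : ℂ) + 1 = ((Real.cos θ + 1 : ℝ) : ℂ) := by push_cast; ring
  have h2 : (Real.cos θ : ℂ) - 1 = ((Real.cos θ - 1 : ℝ) : ℂ) := by push_cast; ring
  have c1 := Real.cos_le_one θ
  have c2 := Real.neg_one_le_cos θ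
  have h3 : ((Real.cos θ - 1 : ℝ) : ℂ) ^ (1 / 2 : ℂ) =
      (Real.sqrt (1 - Real.cos θ) : ℂ) * Complex.I := by
    rw [Complex.ofReal_cpow_of_nonpos (by linarith), ← Complex.ofReal_neg, neg_sub,
      ofReal_cpow_half (by linarith)]
    congr 1
    rw [show (Real.pi : ℂ) * Complex.I * (1 / 2) = (Real.pi / 2 : ℂ) * Complex.I by ring,
      Complex.exp_pi_div_two_mul_I]
  rw [sqrtOneSubSq, h1, h2, h3, ofReal_cpow_half (by linarith)]
  have h4 : Real.sqrt (Real.cos θ + 1) * Real.sqrt (1 - Real.cos θ) = Real.sin θ := by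
    rw [← Real.sqrt_mul (by linarith),
      show (Real.cos θ + 1) * (1 - Real.cos θ) = Real.sin θ ^ 2 by
        rw [Real.sin_sq]; ring, Real.sqrt_sq (Real.sin_nonneg_of_nonneg_of_le_pi h0 hπ)]
  rw [← h4]
  push_cast
  linear_combination (-(Real.sqrt (Real.cos θ + 1) : ℂ) * (Real.sqrt (1 - Real.cos θ) : ℂ)) *
    Complex.I_sq

/-- The sign relating `P̂_n^m` and `P̂_n^{|m|}`. -/
noncomputable def orderSign (m : ℤ) : ℂ := if 0 ≤ m then 1 else (-1) ^ m.natAbs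

theorem orderSign_mul_self (m : ℤ) : orderSign m * orderSign m = 1 := by
  rw [orderSign]
  split_ifs
  · simp
  · rw [← pow_add, ← two_mul, pow_mul]; simp

/-- The normalization factor of `P̂_n^m`. -/
noncomputable def legendreNorm (n m : ℕ) : ℝ :=
  Real.sqrt ((2 * (n : ℝ) + 1) / (4 * Real.pi) *
    (((n - m).factorial : ℝ) / ((n + m).factorial : ℝ)))

/-- The two signs `(-1)^m` in the normalization and in the associated function cancel. For `m < 0`
the factorial quotient inverts the quotient under the root, so the orders `m` and `-m` differ by a
sign only. -/
theorem normLegendre_eq {n : ℕ} {m : ℤ} (h : |m| ≤ (n : ℤ)) (w : ℂ) :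
    normLegendre n m w = orderSign m * (legendreNorm n m.natAbs : ℂ) *
      (sqrtOneSubSq w ^ m.natAbs * legendreDeriv n m.natAbs w) := by
  have hs : ∀ k : ℕ, ((-1 : ℂ) ^ k) * (-1) ^ k = 1 := fun k => by
    rw [← pow_add, ← two_mul, pow_mul]; simp
  rcases le_or_gt 0 m with hm | hm
  · obtain ⟨k, rfl⟩ := Int.eq_ofNat_of_zero_le hm
    have hk : k ≤ n := by rw [abs_of_nonneg hm] at h; exact_mod_cast h
    have e1 : ((n : ℤ) - k).toNat = n - k := by omega
    have e2 : ((n : ℤ) + k).toNat = n + k := by omega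
    simp only [normLegendre, assocLegendre, orderSign, legendreNorm, legendreDeriv, e1, e2, hm,
      if_true, Int.natAbs_natCast, zpow_natCast]
    linear_combination (Real.sqrt ((2 * (n : ℝ) + 1) / (4 * Real.pi) *
      (((n - k).factorial : ℝ) / ((n + k).factorial : ℝ))) : ℂ) *
      (sqrtOneSubSq w ^ k * (derivative^[k] (legendrePoly n)).eval w) * hs k
  · obtain ⟨k, rfl⟩ : ∃ k : ℕ, m = -(k : ℤ) := ⟨m.natAbs, by omega⟩
    have hk : k ≤ n := by rw [abs_neg, Nat.abs_cast] at h; exact_mod_cast h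
    have e1 : ((n : ℤ) - -(k : ℤ)).toNat = n + k := by omega
    have e2 : ((n : ℤ) + -(k : ℤ)).toNat = n - k := by omega
    have hroot : Real.sqrt ((2 * (n : ℝ) + 1) / (4 * Real.pi) *
        (((n + k).factorial : ℝ) / ((n - k).factorial : ℝ))) *
        (((n - k).factorial : ℝ) / ((n + k).factorial : ℝ)) = legendreNorm n k := by
      rw [legendreNorm]
      have f1 : (0 : ℝ) < (n + k).factorial := by positivity
      have f2 : (0 : ℝ) < (n - k).factorial := by positivity
      rw [← Real.sqrt_sq (show (0 : ℝ) ≤ ((n - k).factorial : ℝ) / ((n + k).factorial : ℝ) by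
        positivity), ← Real.sqrt_mul (by positivity)]
      congr 1
      rw [Real.sqrt_sq (by positivity)]
      field_simp
    have hroot' := congrArg (fun t : ℝ => (t : ℂ)) hroot
    push_cast at hroot'
    simp only [normLegendre, assocLegendre, orderSign, legendreDeriv, e1, e2, not_le.mpr hm,
      if_false, Int.natAbs_neg, Int.natAbs_natCast, zpow_neg, zpow_natCast, ← hroot']
    have hi : (((-1 : ℂ) ^ k))⁻¹ = (-1) ^ k := by
      rw [← inv_pow]; norm_num
    rw [hi]
    linear_combination (Real.sqrt ((2 * (n : ℝ) + 1) / (4 * Real.pi) *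
      (((n + k).factorial : ℝ) / ((n - k).factorial : ℝ))) : ℂ) *
      (((n - k).factorial : ℂ) / ((n + k).factorial : ℂ)) * (-1) ^ k *
      (sqrtOneSubSq w ^ k * (derivative^[k] (legendrePoly n)).eval w) * hs k

theorem normLegendre_mul {n : ℕ} {m : ℤ} (h : |m| ≤ (n : ℤ)) (z w : ℂ) :
    normLegendre n m z * normLegendre n m w = (2 * (n : ℂ) + 1) / (4 * (Real.pi : ℂ)) *
      additionTerm z (sqrtOneSubSq z) w (sqrtOneSubSq w) n m.natAbs := by
  have hl : (legendreNorm n m.natAbs : ℂ) * (legendreNorm n m.natAbs : ℂ) =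
      (2 * (n : ℂ) + 1) / (4 * (Real.pi : ℂ)) *
        (((n - m.natAbs).factorial : ℂ) / ((n + m.natAbs).factorial : ℂ)) := by
    rw [← Complex.ofReal_mul, legendreNorm, Real.mul_self_sqrt (by positivity)]
    push_cast
    ring
  rw [normLegendre_eq h, normLegendre_eq h, additionTerm]
  linear_combination (orderSign m * orderSign m) * ((sqrtOneSubSq z ^ m.natAbs *
    legendreDeriv n m.natAbs z) * (sqrtOneSubSq w ^ m.natAbs * legendreDeriv n m.natAbs w)) * hl +
    (2 * (n : ℂ) + 1) / (4 * (Real.pi : ℂ)) *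
        (((n - m.natAbs).factorial : ℂ) / ((n + m.natAbs).factorial : ℂ)) *
    ((sqrtOneSubSq z ^ m.natAbs *
    legendreDeriv n m.natAbs z) * (sqrtOneSubSq w ^ m.natAbs * legendreDeriv n m.natAbs w)) *
    orderSign_mul_self m

/-- The sign of `z₁` comes out by the parity of the Legendre derivatives, that of `S₁` from the
power `S₁ ^ m`. This is the source of the factors `(-1)^n`, `(-1)^m` and `(-1)^(n+m)` in the
theorem. -/
theorem additionTerm_signs {e₁ e₂ : ℂ} (h₁ : e₁ = 1 ∨ e₁ = -1) (z₁ S₁ z₂ S₂ : ℂ) (n m : ℕ) :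
    additionTerm (e₁ * z₁) (e₂ * S₁) z₂ S₂ n m =
      e₁ ^ (n + m) * e₂ ^ m * additionTerm z₁ S₁ z₂ S₂ n m := by
  have : legendreDeriv n m (e₁ * z₁) = e₁ ^ (n + m) * legendreDeriv n m z₁ := by
    rcases h₁ with rfl | rfl
    · simp
    · rw [neg_one_mul, legendreDeriv_neg]
  simp only [additionTerm, this, mul_pow]
  ring

/-- The addition theorem accepts either square root of `1 - z²`, hence also the pair `(e₁ z, e₂ √(1
- z²))`. The signs encode the reversal of vertical and lateral displacements. They distinguish the
two sides of the interface as well as source from target expansions. -/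
theorem sum_normLegendre_mul {e₁ e₂ : ℂ} (h₁ : e₁ = 1 ∨ e₁ = -1) (h₂ : e₂ = 1 ∨ e₂ = -1)
    (n : ℕ) (z w : ℂ) (ψ : ℝ) :
    ∑ m ∈ Finset.Icc (-(n : ℤ)) n, e₁ ^ (n + m.natAbs) * e₂ ^ m.natAbs *
      (normLegendre n m z * normLegendre n m w * Complex.exp (Complex.I * m * ψ)) =
    (2 * (n : ℂ) + 1) / (4 * (Real.pi : ℂ)) * legendreDeriv n 0
      (e₁ * z * w + e₂ * sqrtOneSubSq z * sqrtOneSubSq w * Real.cos ψ) := by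
  have s1 : e₁ ^ 2 = 1 := by rcases h₁ with rfl | rfl <;> norm_num
  have s2 : e₂ ^ 2 = 1 := by rcases h₂ with rfl | rfl <;> norm_num
  have a1 : (e₂ * sqrtOneSubSq z) ^ 2 = 1 - (e₁ * z) ^ 2 := by
    rw [mul_pow, mul_pow, s1, s2, sqrtOneSubSq_sq]; ring
  have h := legendre_addition (t := Complex.exp (Complex.I * ψ)) a1 (sqrtOneSubSq_sq w)
    (Complex.exp_ne_zero _) n
  have hc : (Complex.exp (Complex.I * ψ) + (Complex.exp (Complex.I * ψ))⁻¹) / 2 =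
      (Real.cos ψ : ℂ) := by
    rw [← Complex.exp_neg, Complex.ofReal_cos, Complex.cos, mul_comm Complex.I, neg_mul]
  rw [hc] at h
  rw [← h, Finset.mul_sum]
  refine Finset.sum_congr rfl fun m hm => ?_
  have hm' : |m| ≤ (n : ℤ) := by
    rw [Finset.mem_Icc] at hm; exact abs_le.mpr hm
  rw [normLegendre_mul hm', additionTerm_signs h₁, ← Complex.exp_int_mul]
  rw [show Complex.I * (m : ℂ) * (ψ : ℂ) = (m : ℂ) * (Complex.I * ψ) by ring]
  ring

theorem conj_legendreDeriv (n m : ℕ) (x : ℝ) :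
    (starRingEnd ℂ) (legendreDeriv n m x) = legendreDeriv n m x := by
  have hp : ((((X : ℂ[X]) ^ 2 - 1) ^ n)).map (starRingEnd ℂ) = ((X : ℂ[X]) ^ 2 - 1) ^ n := by
    simp
  have h : (derivative^[n + m] (((X : ℂ[X]) ^ 2 - 1) ^ n)).map (starRingEnd ℂ) =
      derivative^[n + m] (((X : ℂ[X]) ^ 2 - 1) ^ n) := by
    rw [← iterate_derivative_map, hp]
  have h2 : (starRingEnd ℂ) ((derivative^[n + m] (((X : ℂ[X]) ^ 2 - 1) ^ n)).eval (x : ℂ)) =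
      (derivative^[n + m] (((X : ℂ[X]) ^ 2 - 1) ^ n)).eval (x : ℂ) := by
    conv_rhs => rw [← h, ← Complex.conj_ofReal x, eval_map_apply]
  rw [legendreDeriv_eq, map_mul, h2]
  congr 1
  simp only [map_div₀, map_mul, map_pow, map_ofNat, map_natCast, map_one]

theorem conj_normLegendre_cos {n : ℕ} {m : ℤ} (h : |m| ≤ (n : ℤ)) {θ : ℝ} (h0 : 0 ≤ θ)
    (hπ : θ ≤ Real.pi) : (starRingEnd ℂ) (normLegendre n m (Real.cos θ : ℂ)) =
      normLegendre n m (Real.cos θ : ℂ) := by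
  rw [normLegendre_eq h, sqrtOneSubSq_cos h0 hπ]
  simp only [map_mul, map_pow, conj_legendreDeriv, Complex.conj_ofReal]
  congr 2
  rw [orderSign]
  split_ifs <;> simp

end SphericalFunctions

/-! ### Cartesian and spherical coordinates. -/

namespace Space3

theorem theta_nonneg (v : Space3) : 0 ≤ theta v := Real.arccos_nonneg _

theorem theta_le_pi (v : Space3) : theta v ≤ Real.pi := Real.arccos_le_pi _

theorem norm_sq_eq (v : Space3) : ‖v‖ ^ 2 = v 0 ^ 2 + v 1 ^ 2 + v 2 ^ 2 := by
  rw [EuclideanSpace.norm_sq_eq, Fin.sum_univ_three]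
  simp

theorem abs_two_le_norm (v : Space3) : |v 2| ≤ ‖v‖ := by
  apply abs_le_of_sq_le_sq _ (norm_nonneg v)
  rw [norm_sq_eq]
  nlinarith [sq_nonneg (v 0), sq_nonneg (v 1)]

theorem cos_theta (v : Space3) : Real.cos (theta v) = v 2 / ‖v‖ := by
  have h := abs_le.mp (abs_two_le_norm v)
  rcases (norm_nonneg v).eq_or_lt with h0 | h0
  · simp [theta, ← h0]
  · rw [theta, Real.cos_arccos]
    · rw [le_div_iff₀ h0]; linarith
    · rw [div_le_one h0]; exact h.2

theorem norm_mul_cos_theta (v : Space3) : ‖v‖ * Real.cos (theta v) = v 2 := by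
  have h := abs_le.mp (abs_two_le_norm v)
  rw [cos_theta]
  rcases (norm_nonneg v).eq_or_lt with h0 | h0
  · rw [← h0] at h ⊢
    simp
    linarith
  · field_simp

theorem norm_mul_sin_theta (v : Space3) :
    ‖v‖ * Real.sin (theta v) = ‖(v 0 : ℂ) + (v 1 : ℂ) * Complex.I‖ := by
  have hs := Real.sin_nonneg_of_nonneg_of_le_pi (theta_nonneg v) (theta_le_pi v)
  rw [← sq_eq_sq₀ (by positivity) (norm_nonneg _), mul_pow, Real.sin_sq, mul_sub, ← mul_pow,
    norm_mul_cos_theta, norm_sq_eq, ← Complex.normSq_eq_norm_sq, Complex.normSq_add_mul_I]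
  ring

theorem norm_mul_sin_mul_cos (v : Space3) :
    ‖v‖ * Real.sin (theta v) * Real.cos (phi v) = v 0 := by
  rw [norm_mul_sin_theta, phi, Complex.norm_mul_cos_arg]
  simp

theorem norm_mul_sin_mul_sin (v : Space3) :
    ‖v‖ * Real.sin (theta v) * Real.sin (phi v) = v 1 := by
  rw [norm_mul_sin_theta, phi, Complex.norm_mul_sin_arg]
  simp

end Space3

namespace SphericalFunctions

theorem sum_conj_sphHarmAt_mul {e₁ e₂ : ℂ} (h₁ : e₁ = 1 ∨ e₁ = -1) (h₂ : e₂ = 1 ∨ e₂ = -1)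
    (n : ℕ) (v : Space3) (w : ℂ) (α : ℝ) :
    ∑ m ∈ Finset.Icc (-(n : ℤ)) n, e₁ ^ (n + m.natAbs) * e₂ ^ m.natAbs *
      ((starRingEnd ℂ) (sphHarmAt n m v) *
        (normLegendre n m w * Complex.exp (Complex.I * m * α))) =
    (2 * (n : ℂ) + 1) / (4 * (Real.pi : ℂ)) * legendreDeriv n 0
      (e₁ * Real.cos v.theta * w +
        e₂ * Real.sin v.theta * sqrtOneSubSq w * Real.cos (α - v.phi)) := by
  have h := sum_normLegendre_mul h₁ h₂ n (Real.cos v.theta : ℂ) w (α - v.phi)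
  rw [sqrtOneSubSq_cos v.theta_nonneg v.theta_le_pi] at h
  rw [← h]
  refine Finset.sum_congr rfl fun m hm => ?_
  have hm' : |m| ≤ (n : ℤ) := by
    rw [Finset.mem_Icc] at hm; exact abs_le.mpr hm
  rw [sphHarmAt, sphHarm, map_mul, conj_normLegendre_cos hm' v.theta_nonneg v.theta_le_pi,
    ← Complex.exp_conj]
  have : Complex.exp (Complex.I * m * ((α - v.phi : ℝ) : ℂ)) =
      Complex.exp ((starRingEnd ℂ) (Complex.I * m * v.phi)) * Complex.exp (Complex.I * m * α) := by
    rw [← Complex.exp_add]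
    congr 1
    simp
    ring
  rw [this]
  ring

theorem sum_sphHarmAt_mul {e₁ e₂ : ℂ} (h₁ : e₁ = 1 ∨ e₁ = -1) (h₂ : e₂ = 1 ∨ e₂ = -1)
    (n : ℕ) (v : Space3) (w : ℂ) (α : ℝ) :
    ∑ m ∈ Finset.Icc (-(n : ℤ)) n, e₁ ^ (n + m.natAbs) * e₂ ^ m.natAbs *
      (sphHarmAt n m v * (normLegendre n m w * Complex.exp (-(Complex.I * m * α)))) =
    (2 * (n : ℂ) + 1) / (4 * (Real.pi : ℂ)) * legendreDeriv n 0
      (e₁ * Real.cos v.theta * w +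
        e₂ * Real.sin v.theta * sqrtOneSubSq w * Real.cos (α - v.phi)) := by
  have h := sum_normLegendre_mul h₁ h₂ n (Real.cos v.theta : ℂ) w (v.phi - α)
  rw [sqrtOneSubSq_cos v.theta_nonneg v.theta_le_pi] at h
  rw [← neg_sub v.phi α, Real.cos_neg, ← h]
  refine Finset.sum_congr rfl fun m hm => ?_
  rw [sphHarmAt, sphHarm]
  have : Complex.exp (Complex.I * m * ((v.phi - α : ℝ) : ℂ)) =
      Complex.exp (Complex.I * m * v.phi) * Complex.exp (-(Complex.I * m * α)) := by
    rw [← Complex.exp_add]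
    congr 1
    push_cast
    ring
  rw [this]
  ring

end SphericalFunctions

/-! ### The vertical wave number for complex `k`. -/

/-- The analytic continuation `√(λ² + k²)` of `λ_{ℓz}` to `Re k > 0`. -/
noncomputable def complexRoot (lam : ℝ) (k : ℂ) : ℂ := ((lam : ℂ) ^ 2 + k ^ 2) ^ (1 / 2 : ℂ)

namespace complexRoot

theorem sq (lam : ℝ) (k : ℂ) : complexRoot lam k ^ 2 = (lam : ℂ) ^ 2 + k ^ 2 := by
  rw [complexRoot, one_div]
  exact Complex.cpow_nat_inv_pow _ two_ne_zero

theorem mem_slitPlane (lam : ℝ) {k : ℂ} (hk : 0 < k.re) :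
    (lam : ℂ) ^ 2 + k ^ 2 ∈ Complex.slitPlane := by
  rw [Complex.mem_slitPlane_iff]
  by_cases h : k.im = 0
  · left
    have : ((lam : ℂ) ^ 2 + k ^ 2).re = lam ^ 2 + k.re ^ 2 := by
      simp [pow_two, h]
    rw [this]
    positivity
  · right
    have : ((lam : ℂ) ^ 2 + k ^ 2).im = 2 * (k.re * k.im) := by
      simp [pow_two]; ring
    rw [this]
    simp [h, hk.ne']

theorem re_pos (lam : ℝ) {k : ℂ} (hk : 0 < k.re) : 0 < (complexRoot lam k).re := by
  have h := mem_slitPlane lam hk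
  have h0 := Complex.slitPlane_ne_zero h
  rw [complexRoot, Complex.cpow_def_of_ne_zero h0, Complex.exp_re]
  have harg : |((lam : ℂ) ^ 2 + k ^ 2).arg| < Real.pi :=
    abs_lt.mpr ⟨Complex.neg_pi_lt_arg _, lt_of_le_of_ne (Complex.arg_le_pi _)
      (Complex.mem_slitPlane_iff_arg.mp h).1⟩
  have him : (Complex.log ((lam : ℂ) ^ 2 + k ^ 2) * (1 / 2 : ℂ)).im =
      ((lam : ℂ) ^ 2 + k ^ 2).arg / 2 := by
    rw [mul_one_div, Complex.div_ofNat_im, Complex.log_im]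
  rw [him]
  have := abs_lt.mp harg
  exact mul_pos (Real.exp_pos _) (Real.cos_pos_of_mem_Ioo ⟨by linarith, by linarith⟩)

theorem re_sq_sub (lam : ℝ) (k : ℂ) :
    (complexRoot lam k).re ^ 2 - (complexRoot lam k).im ^ 2 = lam ^ 2 + k.re ^ 2 - k.im ^ 2 := by
  have h := congrArg Complex.re (sq lam k)
  simp only [pow_two, Complex.mul_re, Complex.add_re, Complex.ofReal_re, Complex.ofReal_im] at h
  linarith

theorem re_mul_im (lam : ℝ) (k : ℂ) :
    (complexRoot lam k).re * (complexRoot lam k).im = k.re * k.im := by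
  have h := congrArg Complex.im (sq lam k)
  simp only [pow_two, Complex.mul_im, Complex.add_im, Complex.ofReal_re, Complex.ofReal_im] at h
  linarith

/-- If the real part were smaller than that of `k`, the real part of `l² = λ² + k²` would make the
imaginary part smaller in modulus too. This contradicts `Re l · Im l = Re k · Im k`. -/
theorem re_le (lam : ℝ) {k : ℂ} (hk : 0 < k.re) : k.re ≤ (complexRoot lam k).re := by
  have h1 := re_sq_sub lam k
  have h2 := re_mul_im lam k
  have h3 := re_pos lam hk
  set x := (complexRoot lam k).re
  set y := (complexRoot lam k).im
  by_contra hlt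
  push Not at hlt
  have h4 : x ^ 2 < k.re ^ 2 := by nlinarith
  have h5 : y ^ 2 < k.im ^ 2 := by nlinarith [sq_nonneg lam]
  have h6 : x ^ 2 * y ^ 2 < k.re ^ 2 * k.im ^ 2 := by
    have : 0 < k.im ^ 2 := lt_of_le_of_lt (sq_nonneg y) h5
    calc x ^ 2 * y ^ 2 ≤ x ^ 2 * k.im ^ 2 := by gcongr
      _ < k.re ^ 2 * k.im ^ 2 := by gcongr
  rw [← mul_pow, ← mul_pow, h2] at h6
  exact lt_irrefl _ h6

theorem abs_im_le (lam : ℝ) {k : ℂ} (hk : 0 < k.re) : |(complexRoot lam k).im| ≤ |k.im| := by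
  have h1 := re_le lam hk
  have h2 := congrArg abs (re_mul_im lam k)
  have h3 := re_pos lam hk
  rw [abs_mul, abs_mul, abs_of_pos h3, abs_of_pos hk] at h2
  by_contra hlt
  push Not at hlt
  have : k.re * |k.im| < (complexRoot lam k).re * |(complexRoot lam k).im| := by
    calc k.re * |k.im| < k.re * |(complexRoot lam k).im| := by gcongr
      _ ≤ _ := by gcongr
  linarith

/-- `(l - k)(l + k) = λ²`, and `|l - k| ≤ |l + k|` because both real and imaginary parts of `l` and
`k` have product `≥ 0`. Consequently the screened and the harmonic exponentials differ by a bounded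
factor. -/
theorem norm_sub_le {lam : ℝ} (hl : 0 ≤ lam) {k : ℂ} (hk : 0 < k.re) :
    ‖complexRoot lam k - k‖ ≤ lam := by
  have h2 := re_mul_im lam k
  have h3 := re_pos lam hk
  set l := complexRoot lam k with hldef
  have hprod : ‖l - k‖ * ‖l + k‖ = lam ^ 2 := by
    have : (l - k) * (l + k) = (lam : ℂ) ^ 2 := by
      have := sq lam k
      linear_combination this
    rw [← norm_mul, this, norm_pow, Complex.norm_real, Real.norm_eq_abs, sq_abs]
  have hy : 0 ≤ l.im * k.im := by
    have : l.re * (l.im * k.im) = k.re * k.im ^ 2 := by rw [← mul_assoc, h2]; ring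
    have h4 : 0 ≤ l.re * (l.im * k.im) := by rw [this]; positivity
    exact nonneg_of_mul_nonneg_right h4 h3
  have hle : ‖l - k‖ ≤ ‖l + k‖ := by
    rw [← sq_le_sq₀ (norm_nonneg _) (norm_nonneg _), ← Complex.normSq_eq_norm_sq,
      ← Complex.normSq_eq_norm_sq, Complex.normSq_apply, Complex.normSq_apply]
    simp only [Complex.sub_re, Complex.sub_im, Complex.add_re, Complex.add_im]
    nlinarith [mul_pos h3 hk]
  have : ‖l - k‖ ^ 2 ≤ lam ^ 2 := by
    rw [← hprod, pow_two]
    gcongr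
  exact (sq_le_sq₀ (norm_nonneg _) hl).mp this

theorem norm_le {lam : ℝ} (hl : 0 ≤ lam) {k : ℂ} (hk : 0 < k.re) :
    ‖complexRoot lam k‖ ≤ lam + ‖k‖ := by
  have := norm_sub_le hl hk
  calc ‖complexRoot lam k‖ = ‖(complexRoot lam k - k) + k‖ := by ring_nf
    _ ≤ ‖complexRoot lam k - k‖ + ‖k‖ := norm_add_le _ _
    _ ≤ _ := by gcongr

theorem differentiableAt (lam : ℝ) {k : ℂ} (hk : 0 < k.re) :
    DifferentiableAt ℂ (complexRoot lam) k := by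
  unfold complexRoot
  exact DifferentiableAt.cpow_const (by fun_prop) (mem_slitPlane lam hk)

theorem ofReal (lam k : ℝ) : complexRoot lam k = (Real.sqrt (lam ^ 2 + k ^ 2) : ℂ) := by
  rw [complexRoot, ← SphericalFunctions.ofReal_cpow_half (by positivity)]
  push_cast
  rfl

/-- In a sector `|Im l| ≤ Re l / c`, so a lower bound for `|l|` suffices. This bound is uniform down
to `k = 0`, where `re_le` gives nothing. -/
theorem le_re_of_sector {lam c : ℝ} (hl : 0 ≤ lam) (hc : 0 < c) {k : ℂ} (hk : 0 < k.re)
    (hck : c * ‖k‖ ≤ k.re) : c ^ 2 / 2 * lam ≤ (complexRoot lam k).re := by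
  have h3 := re_pos lam hk
  have h1 := re_le lam hk
  have h4 := abs_im_le lam hk
  have hk0 : 0 < ‖k‖ := norm_pos_iff.mpr (by rintro rfl; simp at hk)
  have hc1 : c ≤ 1 := by
    have := Complex.re_le_norm k
    by_contra h
    push Not at h
    nlinarith
  set l := complexRoot lam k with hldef
  have him : |l.im| ≤ l.re / c := by
    rw [le_div_iff₀ hc]
    have := Complex.abs_im_le_norm k
    nlinarith
  have hnorm : ‖l‖ ≤ l.re + l.re / c := by
    calc ‖l‖ ≤ |l.re| + |l.im| := Complex.norm_le_abs_re_add_abs_im l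
      _ ≤ _ := by rw [abs_of_pos h3]; gcongr
  have hlow : c * lam ^ 2 ≤ ‖l‖ ^ 2 := by
    -- After multiplication by the conjugate of `k`, both parts of `λ² + k²` have nonnegative real
    -- part, so they cannot cancel each other.
    have e1 : ‖l‖ ^ 2 * ‖k‖ = ‖((lam : ℂ) ^ 2 + k ^ 2) * (starRingEnd ℂ) k‖ := by
      rw [norm_mul, Complex.norm_conj, ← sq lam k, norm_pow]
    have e2 : (((lam : ℂ) ^ 2 + k ^ 2) * (starRingEnd ℂ) k).re =
        k.re * (lam ^ 2 + (k.re ^ 2 + k.im ^ 2)) := by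
      simp [pow_two]
      ring
    have e3 := Complex.re_le_norm (((lam : ℂ) ^ 2 + k ^ 2) * (starRingEnd ℂ) k)
    rw [e2, ← e1] at e3
    have e4 : c * ‖k‖ * lam ^ 2 ≤ ‖l‖ ^ 2 * ‖k‖ := by
      calc c * ‖k‖ * lam ^ 2 ≤ k.re * lam ^ 2 := by gcongr
        _ ≤ k.re * (lam ^ 2 + (k.re ^ 2 + k.im ^ 2)) := by gcongr; nlinarith
        _ ≤ _ := e3
    have e5 : ‖k‖ * (c * lam ^ 2) ≤ ‖k‖ * ‖l‖ ^ 2 := by linarith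
    exact le_of_mul_le_mul_left e5 hk0
  have h5 : c * lam ≤ ‖l‖ := by
    rw [← sq_le_sq₀ (by positivity) (norm_nonneg _)]
    calc (c * lam) ^ 2 = c * (c * lam ^ 2) := by ring
      _ ≤ 1 * (c * lam ^ 2) := by gcongr
      _ ≤ _ := by linarith
  have h6 : c * lam ≤ l.re * (2 / c) := by
    calc c * lam ≤ l.re + l.re / c := h5.trans hnorm
      _ = l.re * (1 + 1 / c) := by ring
      _ ≤ l.re * (2 / c) := by
        have : 1 ≤ 1 / c := by rw [le_div_iff₀ hc]; linarith
        have e : 2 / c = 1 / c + 1 / c := by ring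
        rw [e]
        gcongr
  have h7 : l.re * (2 / c) * (c / 2) = l.re := by field_simp
  calc c ^ 2 / 2 * lam = c * lam * (c / 2) := by ring
    _ ≤ l.re * (2 / c) * (c / 2) := by gcongr
    _ = l.re := h7

end complexRoot

/-! ### Energy estimates for a stack of layers at complex wave number. -/

/-- The energy of a layer with amplitudes `a`, `b`. -/
theorem layer_energy {lam : ℝ} {k E a b : ℂ} (hk : 0 < k.re)
    (hE : 2 * |E.im| * (complexRoot lam k).re ≤ (1 - ‖E‖ ^ 2) * |(complexRoot lam k).im|) :
    (‖a‖ ^ 2 + ‖b‖ ^ 2) * (1 - ‖E‖ ^ 2) / (complexRoot lam k).re * (k.re / ‖k‖ ^ 2) ≤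
      (k⁻¹ * ((starRingEnd ℂ) ((a * E + b) / complexRoot lam k) * (-(a * E) + b) -
        (starRingEnd ℂ) ((a + b * E) / complexRoot lam k) * (-a + b * E))).re := by
  have h1 := complexRoot.re_le lam hk
  have h2 := complexRoot.re_mul_im lam k
  have h3 := complexRoot.re_pos lam hk
  set l := complexRoot lam k with hl
  have hl0 : l ≠ 0 := by
    intro h; rw [h] at h3; simp at h3
  have hk0 : k ≠ 0 := by
    intro h; rw [h] at hk; simp at hk
  set q := (‖a‖ ^ 2 + ‖b‖ ^ 2) * (1 - ‖E‖ ^ 2) with hq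
  set s := 4 * E.im * (a.re * b.re + a.im * b.im) with hs
  -- For `E = exp (-l h)` the product of conjugate value and derivative, top minus bottom, is the
  -- integral of `|u'|² + l² |u|²` over the layer. Here `q` comes from the two waves separately and
  -- `s` from their interference.
  have hZ : (starRingEnd ℂ) (a * E + b) * (-(a * E) + b) -
      (starRingEnd ℂ) (a + b * E) * (-a + b * E) = ⟨q, -s⟩ := by
    apply Complex.ext
    · simp only [hq, ← Complex.normSq_eq_norm_sq, Complex.normSq_apply, Complex.mul_re,
        Complex.mul_im, Complex.add_re, Complex.add_im, Complex.sub_re, Complex.neg_re,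
        Complex.neg_im, Complex.conj_re, Complex.conj_im]
      ring
    · simp only [hs, Complex.mul_re,
        Complex.mul_im, Complex.add_re, Complex.add_im, Complex.sub_im, Complex.neg_re,
        Complex.neg_im, Complex.conj_re, Complex.conj_im]
      ring
  have hW : k⁻¹ * ((starRingEnd ℂ) ((a * E + b) / l) * (-(a * E) + b) -
        (starRingEnd ℂ) ((a + b * E) / l) * (-a + b * E)) =
      (((‖k‖ ^ 2 * ‖l‖ ^ 2)⁻¹ : ℝ) : ℂ) * ((starRingEnd ℂ) k * l * ⟨q, -s⟩) := by
    rw [← hZ, map_div₀, map_div₀, Complex.inv_def]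
    have e1 : ((starRingEnd ℂ) l)⁻¹ = l * (((‖l‖ ^ 2)⁻¹ : ℝ) : ℂ) := by
      rw [Complex.inv_def, Complex.conj_conj, Complex.normSq_conj, Complex.normSq_eq_norm_sq]
    rw [div_eq_mul_inv, div_eq_mul_inv, e1, Complex.normSq_eq_norm_sq]
    push_cast
    rw [mul_inv]
    ring
  rw [hW, Complex.re_ofReal_mul]
  have hre : ((starRingEnd ℂ) k * l * ⟨q, -s⟩).re =
      q * (k.re * l.re + k.im * l.im) + s * (k.re * l.im - k.im * l.re) := by
    simp only [Complex.mul_re, Complex.mul_im, Complex.conj_re, Complex.conj_im]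
    ring
  rw [hre]
  have hn : ‖l‖ ^ 2 = l.re ^ 2 + l.im ^ 2 := by
    rw [← Complex.normSq_eq_norm_sq, Complex.normSq_apply]; ring
  have hlp : 0 < ‖l‖ ^ 2 := by positivity
  have hkp : 0 < ‖k‖ ^ 2 := by positivity
  -- The hypothesis on `E` is what makes the interference term subordinate to the main term.
  have hsq : |s| * l.re ≤ q * |l.im| := by
    have t1 : |a.re * b.re + a.im * b.im| * 2 ≤ ‖a‖ ^ 2 + ‖b‖ ^ 2 := by
      rw [← Complex.normSq_eq_norm_sq, ← Complex.normSq_eq_norm_sq, Complex.normSq_apply,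
        Complex.normSq_apply]
      rcases abs_cases (a.re * b.re + a.im * b.im) with ⟨h, _⟩ | ⟨h, _⟩ <;> rw [h]
      · nlinarith [sq_nonneg (a.re - b.re), sq_nonneg (a.im - b.im)]
      · nlinarith [sq_nonneg (a.re + b.re), sq_nonneg (a.im + b.im)]
    calc |s| * l.re = (|a.re * b.re + a.im * b.im| * 2) * (2 * |E.im| * l.re) := by
          rw [hs, abs_mul, abs_mul]; norm_num; ring
      _ ≤ (‖a‖ ^ 2 + ‖b‖ ^ 2) * ((1 - ‖E‖ ^ 2) * |l.im|) := by gcongr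
      _ = q * |l.im| := by rw [hq]; ring
  have key : q * k.re * ‖l‖ ^ 2 ≤
      l.re * (q * (k.re * l.re + k.im * l.im) + s * (k.re * l.im - k.im * l.re)) := by
    have hX : 0 ≤ l.re ^ 2 - k.re ^ 2 := by nlinarith
    have hs2 : s * l.re * l.im ≤ q * l.im ^ 2 := by
      calc s * l.re * l.im ≤ |s * l.re * l.im| := le_abs_self _
        _ = |s| * l.re * |l.im| := by rw [abs_mul, abs_mul, abs_of_pos h3]
        _ ≤ q * |l.im| * |l.im| := by gcongr
        _ = q * l.im ^ 2 := by rw [mul_assoc, abs_mul_abs_self]; ring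
    -- By `Re l · Im l = Re k · Im k` the excess over the claimed bound factors. The first factor is
    -- nonnegative since `Re k ≤ Re l`, the second by `hs2`.
    have e : k.re * (l.re * (q * (k.re * l.re + k.im * l.im) + s * (k.re * l.im - k.im * l.re)) -
        q * k.re * ‖l‖ ^ 2) = (l.re ^ 2 - k.re ^ 2) * (q * l.im ^ 2 - s * l.re * l.im) := by
      rw [hn]
      linear_combination (-(q * l.re * l.im - s * l.re ^ 2)) * h2
    have : 0 ≤ k.re * (l.re * (q * (k.re * l.re + k.im * l.im) +
        s * (k.re * l.im - k.im * l.re)) - q * k.re * ‖l‖ ^ 2) := by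
      rw [e]
      exact mul_nonneg hX (by linarith)
    have := nonneg_of_mul_nonneg_right this hk
    linarith
  rw [div_mul_div_comm, div_le_iff₀ (by positivity)]
  calc q * k.re = (q * k.re * ‖l‖ ^ 2) * (‖l‖ ^ 2)⁻¹ := by field_simp
    _ ≤ (l.re * (q * (k.re * l.re + k.im * l.im) + s * (k.re * l.im - k.im * l.re))) *
        (‖l‖ ^ 2)⁻¹ := by gcongr
    _ = _ := by field_simp

/-- With `l = x + i y` this reduces to `|sin (y h)| ≤ |y| h` and `x h ≤ sinh (x h)`. -/
theorem exp_layer_bound {l : ℂ} (hl : 0 < l.re) {h : ℝ} (hh : 0 < h) :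
    2 * |(Complex.exp (-l * h)).im| * l.re ≤ (1 - ‖Complex.exp (-l * h)‖ ^ 2) * |l.im| := by
  rw [Complex.exp_im, Complex.norm_exp]
  have e1 : (-l * (h : ℂ)).re = -(l.re * h) := by simp
  have e2 : (-l * (h : ℂ)).im = -(l.im * h) := by simp
  rw [e1, e2, Real.sin_neg, abs_mul, abs_neg, abs_of_pos (Real.exp_pos _)]
  have hx : 0 < l.re * h := mul_pos hl hh
  have h1 : |Real.sin (l.im * h)| ≤ |l.im| * h := by
    calc |Real.sin (l.im * h)| ≤ |l.im * h| := Real.abs_sin_le_abs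
      _ = _ := by rw [abs_mul, abs_of_pos hh]
  have h2 : 2 * (l.re * h) * Real.exp (-(l.re * h)) ≤ 1 - Real.exp (-(l.re * h)) ^ 2 := by
    have h3 := Real.self_le_sinh_iff.mpr hx.le
    rw [Real.sinh_eq] at h3
    have h4 : Real.exp (l.re * h) * Real.exp (-(l.re * h)) = 1 := by
      rw [← Real.exp_add]; simp
    have h5 := Real.exp_pos (-(l.re * h))
    nlinarith
  calc 2 * (Real.exp (-(l.re * h)) * |Real.sin (l.im * h)|) * l.re
      ≤ 2 * (Real.exp (-(l.re * h)) * (|l.im| * h)) * l.re := by gcongr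
    _ = (2 * (l.re * h) * Real.exp (-(l.re * h))) * |l.im| := by ring
    _ ≤ _ := by gcongr

/-- The energy inequality for a stack of layers `0, …, L`. -/
theorem stack_energy {L : ℕ} {lam e : ℕ → ℝ} {k : ℂ} (hk : 0 < k.re) {a b E : ℕ → ℂ}
    (he : ∀ j ≤ L, 0 < e j)
    (hE : ∀ j ≤ L, 2 * |(E j).im| * (complexRoot (lam j) k).re ≤
      (1 - ‖E j‖ ^ 2) * |(complexRoot (lam j) k).im|)
    (hE0 : E 0 = 0) (hEL : E L = 0) (ha : a L = 0) (hb : b 0 = 0) {f g : ℕ → ℂ}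
    (hf : ∀ j < L, (a j + b j * E j) / complexRoot (lam j) k -
      (a (j + 1) * E (j + 1) + b (j + 1)) / complexRoot (lam (j + 1)) k = f j)
    (hg : ∀ j < L, (e j : ℂ) * (-a j + b j * E j) -
      (e (j + 1) : ℂ) * (-(a (j + 1) * E (j + 1)) + b (j + 1)) = g j) :
    ∑ j ∈ Finset.range (L + 1), e j * ((‖a j‖ ^ 2 + ‖b j‖ ^ 2) * (1 - ‖E j‖ ^ 2) /
        (complexRoot (lam j) k).re * (k.re / ‖k‖ ^ 2)) ≤
      ‖k‖⁻¹ * ∑ j ∈ Finset.range L,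
        (‖f j‖ * (e (j + 1) * ‖-(a (j + 1) * E (j + 1)) + b (j + 1)‖) +
        ‖(a (j + 1) * E (j + 1) + b (j + 1)) / complexRoot (lam (j + 1)) k‖ * ‖g j‖ +
        ‖f j‖ * ‖g j‖) := by
  set Vt : ℕ → ℂ := fun j => (a j * E j + b j) / complexRoot (lam j) k with hVt
  set Vb : ℕ → ℂ := fun j => (a j + b j * E j) / complexRoot (lam j) k with hVb
  set Ft : ℕ → ℂ := fun j => (e j : ℂ) * (-(a j * E j) + b j) with hFt
  set Fb : ℕ → ℂ := fun j => (e j : ℂ) * (-a j + b j * E j) with hFb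
  have step1 : ∑ j ∈ Finset.range (L + 1), e j * ((‖a j‖ ^ 2 + ‖b j‖ ^ 2) * (1 - ‖E j‖ ^ 2) /
        (complexRoot (lam j) k).re * (k.re / ‖k‖ ^ 2)) ≤
      (k⁻¹ * ∑ j ∈ Finset.range (L + 1), ((starRingEnd ℂ) (Vt j) * Ft j -
        (starRingEnd ℂ) (Vb j) * Fb j)).re := by
    rw [Finset.mul_sum, Complex.re_sum]
    refine Finset.sum_le_sum fun j hj => ?_
    have hj' : j ≤ L := by simpa [Nat.lt_succ_iff] using hj
    have h := mul_le_mul_of_nonneg_left (layer_energy (a := a j) (b := b j) hk (hE j hj'))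
      (he j hj').le
    refine h.trans (le_of_eq ?_)
    rw [← Complex.re_ofReal_mul]
    congr 1
    simp only [hVt, hVb, hFt, hFb]
    ring
  -- Regrouping from layers to interfaces. Nothing is left over at the ends: `E 0 = b 0 = 0` kills
  -- the top term of layer `0`, and `E L = a L = 0` the bottom term of layer `L`.
  have step2 : ∑ j ∈ Finset.range (L + 1), ((starRingEnd ℂ) (Vt j) * Ft j -
        (starRingEnd ℂ) (Vb j) * Fb j) =
      ∑ j ∈ Finset.range L, ((starRingEnd ℂ) (Vt (j + 1)) * Ft (j + 1) -
        (starRingEnd ℂ) (Vb j) * Fb j) := by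
    rw [Finset.sum_sub_distrib, Finset.sum_sub_distrib, Finset.sum_range_succ',
      Finset.sum_range_succ (fun j => (starRingEnd ℂ) (Vb j) * Fb j)]
    have t0 : (starRingEnd ℂ) (Vt 0) * Ft 0 = 0 := by simp [hVt, hE0, hb]
    have tL : (starRingEnd ℂ) (Vb L) * Fb L = 0 := by simp [hVb, hEL, ha]
    rw [t0, tL]
    ring
  refine step1.trans ((Complex.re_le_norm _).trans ?_)
  rw [step2, norm_mul, norm_inv]
  gcongr
  refine (norm_sum_le _ _).trans (Finset.sum_le_sum fun j hj => ?_)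
  have hj' : j < L := Finset.mem_range.mp hj
  have e1 : Vb j = Vt (j + 1) + f j := by rw [← hf j hj']; simp only [hVt, hVb]; ring
  have e2 : Fb j = Ft (j + 1) + g j := by rw [← hg j hj']; simp only [hFt, hFb]; ring
  have e3 : (starRingEnd ℂ) (Vt (j + 1)) * Ft (j + 1) - (starRingEnd ℂ) (Vb j) * Fb j =
      -((starRingEnd ℂ) (f j) * Ft (j + 1) + (starRingEnd ℂ) (Vt (j + 1)) * g j +
        (starRingEnd ℂ) (f j) * g j) := by
    rw [e1, e2, map_add]; ring
  rw [e3, norm_neg]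
  refine (norm_add₃_le).trans (le_of_eq ?_)
  simp only [norm_mul, Complex.norm_conj, hFt, Complex.norm_real, Real.norm_eq_abs,
    abs_of_pos (he (j + 1) hj')]
  rfl

/-- A stack of layers without sources carries no field. -/
theorem stack_unique {L : ℕ} {lam e : ℕ → ℝ} {k : ℂ} (hk : 0 < k.re) {a b E : ℕ → ℂ}
    (he : ∀ j ≤ L, 0 < e j)
    (hE : ∀ j ≤ L, 2 * |(E j).im| * (complexRoot (lam j) k).re ≤
      (1 - ‖E j‖ ^ 2) * |(complexRoot (lam j) k).im|) (hE1 : ∀ j ≤ L, ‖E j‖ < 1)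
    (hE0 : E 0 = 0) (hEL : E L = 0) (ha : a L = 0) (hb : b 0 = 0)
    (hf : ∀ j < L, (a j + b j * E j) / complexRoot (lam j) k -
      (a (j + 1) * E (j + 1) + b (j + 1)) / complexRoot (lam (j + 1)) k = 0)
    (hg : ∀ j < L, (e j : ℂ) * (-a j + b j * E j) -
      (e (j + 1) : ℂ) * (-(a (j + 1) * E (j + 1)) + b (j + 1)) = 0) :
    ∀ j ≤ L, a j = 0 ∧ b j = 0 := by
  have h := stack_energy hk he hE hE0 hEL ha hb (f := fun _ => 0) (g := fun _ => 0) hf hg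
  simp only [norm_zero, zero_mul, mul_zero, add_zero, Finset.sum_const_zero] at h
  have hk0 : k ≠ 0 := by rintro rfl; simp at hk
  have hpos : ∀ j ≤ L, 0 < e j * (1 - ‖E j‖ ^ 2) / (complexRoot (lam j) k).re *
      (k.re / ‖k‖ ^ 2) := by
    intro j hj
    have h1 := he j hj
    have h2 := complexRoot.re_pos (lam j) hk
    have h3 : 0 < 1 - ‖E j‖ ^ 2 := by
      have := hE1 j hj
      have := norm_nonneg (E j)
      nlinarith
    positivity
  have hre : ∀ j, e j * ((‖a j‖ ^ 2 + ‖b j‖ ^ 2) * (1 - ‖E j‖ ^ 2) /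
      (complexRoot (lam j) k).re * (k.re / ‖k‖ ^ 2)) = (‖a j‖ ^ 2 + ‖b j‖ ^ 2) *
      (e j * (1 - ‖E j‖ ^ 2) / (complexRoot (lam j) k).re * (k.re / ‖k‖ ^ 2)) := fun j => by ring
  simp only [hre] at h
  have hnn : ∀ j ∈ Finset.range (L + 1), 0 ≤ (‖a j‖ ^ 2 + ‖b j‖ ^ 2) *
      (e j * (1 - ‖E j‖ ^ 2) / (complexRoot (lam j) k).re * (k.re / ‖k‖ ^ 2)) := by
    intro j hj
    have := hpos j (by simpa [Nat.lt_succ_iff] using hj)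
    positivity
  have hz := (Finset.sum_eq_zero_iff_of_nonneg hnn).mp (le_antisymm h (Finset.sum_nonneg hnn))
  intro j hj
  have hj0 := hz j (by simpa [Nat.lt_succ_iff] using hj)
  rcases mul_eq_zero.mp hj0 with h0 | h0
  · have n1 := sq_nonneg ‖a j‖
    have n2 := sq_nonneg ‖b j‖
    constructor
    · have : ‖a j‖ ^ 2 = 0 := by linarith
      simpa using this
    · have : ‖b j‖ ^ 2 = 0 := by linarith
      simpa using this
  · exact absurd h0 (hpos j hj).ne'

/-- An a priori bound for the amplitudes in a stack of layers. -/
theorem stack_bound {L : ℕ} {lam e : ℕ → ℝ} {k : ℂ} (hk : 0 < k.re) {a b E : ℕ → ℂ}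
    (he : ∀ j ≤ L, 0 < e j)
    (hE : ∀ j ≤ L, 2 * |(E j).im| * (complexRoot (lam j) k).re ≤
      (1 - ‖E j‖ ^ 2) * |(complexRoot (lam j) k).im|) (hE1 : ∀ j ≤ L, ‖E j‖ ≤ 1)
    (hE0 : E 0 = 0) (hEL : E L = 0) (ha : a L = 0) (hb : b 0 = 0) {f g : ℕ → ℂ}
    (hf : ∀ j < L, (a j + b j * E j) / complexRoot (lam j) k -
      (a (j + 1) * E (j + 1) + b (j + 1)) / complexRoot (lam (j + 1)) k = f j)
    (hg : ∀ j < L, (e j : ℂ) * (-a j + b j * E j) -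
      (e (j + 1) : ℂ) * (-(a (j + 1) * E (j + 1)) + b (j + 1)) = g j)
    {c C μ e' Λ : ℝ} (hc : 0 < c) (hck : c * ‖k‖ ≤ k.re) (hΛ : 0 < Λ) (hμ : 0 < μ) (hC : 0 ≤ C)
    (he' : ∀ j ≤ L, e j ≤ e') (hfC : ∀ j < L, ‖f j‖ ≤ C / Λ) (hg1 : ∀ j < L, ‖g j‖ ≤ 1)
    (hlC : ∀ j ≤ L, ‖complexRoot (lam j) k‖⁻¹ ≤ C / Λ)
    (hμe : ∀ j ≤ L, μ / Λ ≤ e j * (1 - ‖E j‖ ^ 2) / (complexRoot (lam j) k).re) :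
    ∀ j ≤ L, ‖a j‖ ^ 2 + ‖b j‖ ^ 2 ≤
      2 / (μ * c) * (L * ((C * (e' + 1)) ^ 2 / (μ * c) + C)) := by
  have h := stack_energy hk he hE hE0 hEL ha hb hf hg
  have hk0 : 0 < ‖k‖ := norm_pos_iff.mpr (by rintro rfl; simp at hk)
  set N : ℕ → ℝ := fun j => ‖a j‖ ^ 2 + ‖b j‖ ^ 2 with hN
  have hN0 : ∀ j, 0 ≤ N j := fun j => by positivity
  set K := C * (e' + 1) with hK
  have he0 : 0 ≤ e' := (he 0 (Nat.zero_le _)).le.trans (he' 0 (Nat.zero_le _))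
  have hK0 : 0 ≤ K := by positivity
  -- Energy and source terms both scale like `1 / (Λ |k|)`. This factor drops out in `tot2`, so the
  -- final bound does not depend on `k`.
  have lower : (μ * c) * (∑ j ∈ Finset.range (L + 1), N j) / (Λ * ‖k‖) ≤
      ∑ j ∈ Finset.range (L + 1), e j * ((‖a j‖ ^ 2 + ‖b j‖ ^ 2) * (1 - ‖E j‖ ^ 2) /
        (complexRoot (lam j) k).re * (k.re / ‖k‖ ^ 2)) := by
    rw [Finset.mul_sum, Finset.sum_div]
    refine Finset.sum_le_sum fun j hj => ?_
    have hj' : j ≤ L := by simpa [Nat.lt_succ_iff] using hj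
    have h1 := hμe j hj'
    have h2 : c / ‖k‖ ≤ k.re / ‖k‖ ^ 2 := by
      rw [div_le_div_iff₀ hk0 (by positivity)]
      nlinarith
    calc μ * c * N j / (Λ * ‖k‖) = N j * (μ / Λ) * (c / ‖k‖) := by field_simp
      _ ≤ N j * (e j * (1 - ‖E j‖ ^ 2) / (complexRoot (lam j) k).re) * (k.re / ‖k‖ ^ 2) := by
        have : 0 ≤ e j * (1 - ‖E j‖ ^ 2) / (complexRoot (lam j) k).re :=
          le_trans (by positivity) h1
        have := hN0 j
        gcongr
      _ = _ := by simp only [hN]; ring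
  have upper : ∀ j ∈ Finset.range L,
      (‖f j‖ * (e (j + 1) * ‖-(a (j + 1) * E (j + 1)) + b (j + 1)‖) +
        ‖(a (j + 1) * E (j + 1) + b (j + 1)) / complexRoot (lam (j + 1)) k‖ * ‖g j‖ +
        ‖f j‖ * ‖g j‖) ≤ (μ * c / 2 * N (j + 1) + (K ^ 2 / (μ * c) + C)) / Λ := by
    intro j hj
    have hj' : j < L := Finset.mem_range.mp hj
    have hab1 : ‖-(a (j + 1) * E (j + 1)) + b (j + 1)‖ ≤ ‖a (j + 1)‖ + ‖b (j + 1)‖ := by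
      refine (norm_add_le _ _).trans ?_
      rw [norm_neg, norm_mul]
      have := mul_le_of_le_one_right (norm_nonneg (a (j + 1))) (hE1 (j + 1) hj')
      linarith
    have hab2 : ‖a (j + 1) * E (j + 1) + b (j + 1)‖ ≤ ‖a (j + 1)‖ + ‖b (j + 1)‖ := by
      refine (norm_add_le _ _).trans ?_
      rw [norm_mul]
      have := mul_le_of_le_one_right (norm_nonneg (a (j + 1))) (hE1 (j + 1) hj')
      linarith
    set s := ‖a (j + 1)‖ + ‖b (j + 1)‖ with hs
    have hs0 : 0 ≤ s := by positivity
    have hs2 : s ^ 2 ≤ 2 * N (j + 1) := by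
      simp only [hs, hN]; nlinarith [sq_nonneg (‖a (j + 1)‖ - ‖b (j + 1)‖)]
    -- Young's inequality, with the weight chosen so that the quadratic part is half of the energy
    -- and can be absorbed on the left.
    have hyoung : K * s ≤ μ * c / 2 * N (j + 1) + K ^ 2 / (μ * c) := by
      have hmc : 0 < μ * c := by positivity
      have h3 : 0 ≤ (μ * c * s / 2 - K) ^ 2 / (μ * c) := by positivity
      have h4 : (μ * c * s / 2 - K) ^ 2 / (μ * c) = μ * c * s ^ 2 / 4 - K * s + K ^ 2 / (μ * c) := by
        field_simp
        ring
      nlinarith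
    have t1 : ‖f j‖ * (e (j + 1) * ‖-(a (j + 1) * E (j + 1)) + b (j + 1)‖) ≤
        C / Λ * (e' * s) := by
      have := hfC j hj'
      have := he' (j + 1) hj'
      have := (he (j + 1) hj').le
      have : 0 ≤ C / Λ := by positivity
      gcongr
    have t2 : ‖(a (j + 1) * E (j + 1) + b (j + 1)) / complexRoot (lam (j + 1)) k‖ * ‖g j‖ ≤
        s * (C / Λ) * 1 := by
      rw [norm_div, div_eq_mul_inv]
      have := hlC (j + 1) hj'
      have := hg1 j hj'
      have : 0 ≤ C / Λ := by positivity
      gcongr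
    have t3 : ‖f j‖ * ‖g j‖ ≤ C / Λ * 1 := by
      have := hfC j hj'
      have := hg1 j hj'
      have : 0 ≤ C / Λ := by positivity
      gcongr
    calc _ ≤ C / Λ * (e' * s) + s * (C / Λ) * 1 + C / Λ * 1 := by linarith
      _ = (K * s + C) / Λ := by rw [hK]; ring
      _ ≤ _ := div_le_div_of_nonneg_right (by linarith) hΛ.le
  have tot := lower.trans (h.trans (mul_le_mul_of_nonneg_left (Finset.sum_le_sum upper)
    (inv_nonneg.mpr hk0.le)))
  have hup : ∑ j ∈ Finset.range L, (μ * c / 2 * N (j + 1) + (K ^ 2 / (μ * c) + C)) / Λ =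
      (μ * c / 2 * ∑ j ∈ Finset.range L, N (j + 1) + L * (K ^ 2 / (μ * c) + C)) / Λ := by
    rw [← Finset.sum_div, Finset.sum_add_distrib, ← Finset.mul_sum, Finset.sum_const,
      Finset.card_range, nsmul_eq_mul]
  rw [hup] at tot
  set T := ∑ j ∈ Finset.range (L + 1), N j with hT
  have hsub : ∑ j ∈ Finset.range L, N (j + 1) ≤ T := by
    rw [hT, Finset.sum_range_succ']
    have := hN0 0
    linarith
  have tot2 : (μ * c) * T ≤ μ * c / 2 * T + L * (K ^ 2 / (μ * c) + C) := by
    have e1 : (μ * c) * T = (μ * c) * T / (Λ * ‖k‖) * (Λ * ‖k‖) := by field_simp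
    rw [e1]
    calc (μ * c) * T / (Λ * ‖k‖) * (Λ * ‖k‖) ≤ ‖k‖⁻¹ * ((μ * c / 2 *
          ∑ j ∈ Finset.range L, N (j + 1) + L * (K ^ 2 / (μ * c) + C)) / Λ) * (Λ * ‖k‖) := by
          gcongr
      _ = μ * c / 2 * ∑ j ∈ Finset.range L, N (j + 1) + L * (K ^ 2 / (μ * c) + C) := by
          field_simp
      _ ≤ _ := by gcongr
  intro j hj
  have hjT : N j ≤ T :=
    Finset.single_le_sum (fun i _ => hN0 i) (Finset.mem_range.mpr (Nat.lt_succ_of_le hj))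
  have hmc : 0 < μ * c := by positivity
  calc N j ≤ T := hjT
    _ = 2 / (μ * c) * (μ * c / 2 * T) := by field_simp
    _ ≤ 2 / (μ * c) * (L * (K ^ 2 / (μ * c) + C)) :=
      mul_le_mul_of_nonneg_left (by linarith) (by positivity)

/-! ### Holomorphic continuation of the reaction densities. -/

namespace LayeredMedium

variable (M : LayeredMedium)

/-- The factor `exp (-λ_{jz} h_j)` of an inner layer of thickness `h_j` (zero for outer layers). -/
noncomputable def layerExp (j : ℕ) (k : ℂ) : ℂ :=
  if 0 < j ∧ j < M.L then
    Complex.exp (-complexRoot (M.lam j) k * ((M.d (j - 1) - M.d j : ℝ) : ℂ)) else 0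

/-- Amplitudes of the components `𝔞 = 1` as a sequence. -/
def upAmp {R : Type} [Zero R] (x : Fin M.L ⊕ Fin M.L → R) (j : ℕ) : R :=
  if h : j < M.L then x (Sum.inl ⟨j, h⟩) else 0

/-- Amplitudes of the components `𝔞 = 2` as a sequence. -/
def downAmp {R : Type} [Zero R] (x : Fin M.L ⊕ Fin M.L → R) (j : ℕ) : R :=
  if h : 0 < j ∧ j - 1 < M.L then x (Sum.inr ⟨j - 1, h.2⟩) else 0

/-- The linear map sending amplitudes to the jumps at the interfaces. -/
noncomputable def jumpMap (k : ℂ) : (Fin M.L ⊕ Fin M.L → ℂ) →ₗ[ℂ] (Fin M.L ⊕ Fin M.L → ℂ) where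
  toFun x := Sum.elim
    (fun j : Fin M.L =>
      (M.upAmp x j + M.downAmp x j * M.layerExp j k) / complexRoot (M.lam j) k -
        (M.upAmp x (j + 1) * M.layerExp (j + 1) k + M.downAmp x (j + 1)) /
          complexRoot (M.lam (j + 1)) k)
    (fun j : Fin M.L =>
      (M.ε j : ℂ) * (-M.upAmp x j + M.downAmp x j * M.layerExp j k) -
        (M.ε (j + 1) : ℂ) * (-(M.upAmp x (j + 1) * M.layerExp (j + 1) k) + M.downAmp x (j + 1)))
  map_add' x y := by
    have h1 : ∀ j, M.upAmp (x + y) j = M.upAmp x j + M.upAmp y j := by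
      intro j; simp only [upAmp]; split_ifs <;> simp
    have h2 : ∀ j, M.downAmp (x + y) j = M.downAmp x j + M.downAmp y j := by
      intro j; simp only [downAmp]; split_ifs <;> simp
    funext i
    rcases i with j | j <;> simp only [Sum.elim_inl, Sum.elim_inr, Pi.add_apply, h1, h2] <;> ring
  map_smul' c x := by
    have h1 : ∀ j, M.upAmp (c • x) j = c * M.upAmp x j := by
      intro j; simp only [upAmp]; split_ifs <;> simp
    have h2 : ∀ j, M.downAmp (c • x) j = c * M.downAmp x j := by
      intro j; simp only [downAmp]; split_ifs <;> simp
    funext i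
    rcases i with j | j <;>
      simp only [Sum.elim_inl, Sum.elim_inr, Pi.smul_apply, smul_eq_mul, RingHom.id_apply, h1,
        h2] <;> ring

/-- The jumps at the interfaces caused by a source in layer `ℓ'`. -/
noncomputable def sourceJump (b : Side) (ℓ' : ℕ) (k : ℂ) : Fin M.L ⊕ Fin M.L → ℂ :=
  match b with
  | Side.one => Sum.elim
      (fun j : Fin M.L => if (j : ℕ) = ℓ' then
        -1 / ((M.ε ℓ' : ℂ) * complexRoot (M.lam ℓ') k) else 0)
      (fun j : Fin M.L => if (j : ℕ) = ℓ' then -1 else 0)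
  | Side.two => Sum.elim
      (fun j : Fin M.L => if (j : ℕ) + 1 = ℓ' then
        1 / ((M.ε ℓ' : ℂ) * complexRoot (M.lam ℓ') k) else 0)
      (fun j : Fin M.L => if (j : ℕ) + 1 = ℓ' then -1 else 0)

theorem layerExp_bound (j : ℕ) {k : ℂ} (hk : 0 < k.re) :
    2 * |(M.layerExp j k).im| * (complexRoot (M.lam j) k).re ≤
      (1 - ‖M.layerExp j k‖ ^ 2) * |(complexRoot (M.lam j) k).im| := by
  rw [layerExp]
  split_ifs with h
  · have hd := M.d_lt (j - 1) (by omega)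
    rw [Nat.sub_add_cancel h.1] at hd
    exact exp_layer_bound (complexRoot.re_pos _ hk) (sub_pos.mpr hd)
  · simp

theorem norm_layerExp_lt_one (j : ℕ) {k : ℂ} (hk : 0 < k.re) : ‖M.layerExp j k‖ < 1 := by
  rw [layerExp]
  split_ifs with h
  · have hd := M.d_lt (j - 1) (by omega)
    rw [Nat.sub_add_cancel h.1] at hd
    have hl := complexRoot.re_pos (M.lam j) hk
    rw [Complex.norm_exp, Real.exp_lt_one_iff, Complex.re_mul_ofReal, Complex.neg_re]
    nlinarith
  · simp

theorem layerExp_zero (k : ℂ) : M.layerExp 0 k = 0 := by simp [layerExp]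

theorem layerExp_L (k : ℂ) : M.layerExp M.L k = 0 := by simp [layerExp]

theorem upAmp_L {R : Type} [Zero R] (x : Fin M.L ⊕ Fin M.L → R) : M.upAmp x M.L = 0 := by
  simp [upAmp]

theorem downAmp_zero {R : Type} [Zero R] (x : Fin M.L ⊕ Fin M.L → R) : M.downAmp x 0 = 0 := by
  simp [downAmp]

theorem jumpMap_injective {k : ℂ} (hk : 0 < k.re) : Function.Injective (M.jumpMap k) := by
  rw [injective_iff_map_eq_zero]
  intro x hx
  have h := stack_unique (lam := M.lam) (e := M.ε) (a := M.upAmp x) (b := M.downAmp x)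
    (E := fun j => M.layerExp j k) hk M.ε_pos (fun j _ => M.layerExp_bound j hk)
    (fun j _ => M.norm_layerExp_lt_one j hk) (M.layerExp_zero k) (M.layerExp_L k) (M.upAmp_L x)
    (M.downAmp_zero x) (fun j hj => congrFun hx (Sum.inl ⟨j, hj⟩))
    (fun j hj => congrFun hx (Sum.inr ⟨j, hj⟩))
  funext i
  rcases i with j | j
  · simpa [upAmp] using (h j j.2.le).1
  · simpa [downAmp] using (h (j + 1) j.2).2

theorem det_jumpMap_ne_zero {k : ℂ} (hk : 0 < k.re) : (LinearMap.toMatrix' (M.jumpMap k)).det ≠ 0 := by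
  rw [LinearMap.det_toMatrix']
  exact (LinearMap.isUnit_iff_isUnit_det _).mp
    ((Module.End.isUnit_iff _).mpr ⟨M.jumpMap_injective hk,
      LinearMap.injective_iff_surjective.mp (M.jumpMap_injective hk)⟩) |>.ne_zero

/-- The amplitudes generated by a source in layer `ℓ'`, for complex `λ_ρ` with `Re λ_ρ > 0`. -/
noncomputable def complexAmp (b : Side) (ℓ' : ℕ) (k : ℂ) : Fin M.L ⊕ Fin M.L → ℂ := fun i =>
  (LinearMap.toMatrix' (M.jumpMap k)).cramer (M.sourceJump b ℓ' k) i /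
    (LinearMap.toMatrix' (M.jumpMap k)).det

theorem jumpMap_complexAmp (b : Side) (ℓ' : ℕ) {k : ℂ} (hk : 0 < k.re) :
    M.jumpMap k (M.complexAmp b ℓ' k) = M.sourceJump b ℓ' k := by
  have h := M.det_jumpMap_ne_zero hk
  have e : M.complexAmp b ℓ' k = (LinearMap.toMatrix' (M.jumpMap k)).det⁻¹ •
      (LinearMap.toMatrix' (M.jumpMap k)).cramer (M.sourceJump b ℓ' k) := by
    funext i
    simp [complexAmp, div_eq_inv_mul]
  rw [e, map_smul, ← LinearMap.toMatrix'_mulVec, Matrix.mulVec_cramer, smul_smul,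
    inv_mul_cancel₀ h, one_smul]

theorem complexAmp_unique (b : Side) (ℓ' : ℕ) {k : ℂ} (hk : 0 < k.re)
    {x : Fin M.L ⊕ Fin M.L → ℂ} (hx : M.jumpMap k x = M.sourceJump b ℓ' k) :
    M.complexAmp b ℓ' k = x :=
  M.jumpMap_injective hk ((M.jumpMap_complexAmp b ℓ' hk).trans hx.symm)

/-- The reaction densities, continued analytically to `Re λ_ρ > 0`. -/
noncomputable def complexDensity (a b : Side) (ℓ ℓ' : ℕ) (k : ℂ) : ℂ :=
  match a with
  | Side.one => M.upAmp (M.complexAmp b ℓ' k) ℓ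
  | Side.two => M.downAmp (M.complexAmp b ℓ' k) ℓ

theorem differentiableAt_layerExp (j : ℕ) {k : ℂ} (hk : 0 < k.re) :
    DifferentiableAt ℂ (M.layerExp j) k := by
  have h := complexRoot.differentiableAt (M.lam j) hk
  unfold layerExp
  split_ifs
  · fun_prop
  · fun_prop

theorem complexRoot_ne_zero (j : ℕ) {k : ℂ} (hk : 0 < k.re) : complexRoot (M.lam j) k ≠ 0 := by
  have := complexRoot.re_pos (M.lam j) hk
  intro h
  rw [h] at this
  simp at this

theorem differentiableAt_jumpMap (x : Fin M.L ⊕ Fin M.L → ℂ) (i : Fin M.L ⊕ Fin M.L) {k : ℂ}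
    (hk : 0 < k.re) : DifferentiableAt ℂ (fun k => M.jumpMap k x i) k := by
  have hE := fun j => M.differentiableAt_layerExp j hk
  have hl := fun j => complexRoot.differentiableAt (M.lam j) hk
  have hn := fun j => M.complexRoot_ne_zero j hk
  rcases i with j | j
  · have := hn j
    have := hn (j + 1)
    have := hl j
    have := hl (j + 1)
    have := hE j
    have := hE (j + 1)
    simp only [jumpMap, LinearMap.coe_mk, AddHom.coe_mk, Sum.elim_inl]
    fun_prop (disch := assumption)
  · have := hE j
    have := hE (j + 1)
    simp only [jumpMap, LinearMap.coe_mk, AddHom.coe_mk, Sum.elim_inr]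
    fun_prop

theorem differentiableAt_sourceJump (b : Side) {ℓ' : ℕ} (hℓ' : ℓ' ≤ M.L) (i : Fin M.L ⊕ Fin M.L)
    {k : ℂ} (hk : 0 < k.re) : DifferentiableAt ℂ (fun k => M.sourceJump b ℓ' k i) k := by
  have hl := complexRoot.differentiableAt (M.lam ℓ') hk
  have hn : (M.ε ℓ' : ℂ) * complexRoot (M.lam ℓ') k ≠ 0 :=
    mul_ne_zero (by exact_mod_cast (M.ε_pos ℓ' hℓ').ne') (M.complexRoot_ne_zero ℓ' hk)
  rcases b with _ | _ <;> rcases i with j | j <;>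
    simp only [sourceJump, Sum.elim_inl, Sum.elim_inr] <;> split_ifs <;>
    fun_prop (disch := assumption)

theorem differentiableAt_det {ι : Type} [Fintype ι] [DecidableEq ι] {A : ℂ → Matrix ι ι ℂ} {k : ℂ}
    (h : ∀ i j, DifferentiableAt ℂ (fun k => A k i j) k) :
    DifferentiableAt ℂ (fun k => (A k).det) k := by
  simp only [Matrix.det_apply]
  fun_prop

/-- Cramer's rule writes the amplitudes as quotients of determinants with holomorphic entries. The
denominator has no zero in `Re k > 0` by the energy argument. -/
theorem differentiableAt_complexAmp (b : Side) {ℓ' : ℕ} (hℓ' : ℓ' ≤ M.L) (i : Fin M.L ⊕ Fin M.L)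
    {k : ℂ} (hk : 0 < k.re) : DifferentiableAt ℂ (fun k => M.complexAmp b ℓ' k i) k := by
  unfold complexAmp
  refine DifferentiableAt.div ?_ ?_ (M.det_jumpMap_ne_zero hk)
  · simp only [Matrix.cramer_apply]
    refine differentiableAt_det fun i₁ i₂ => ?_
    simp only [Matrix.updateCol_apply, LinearMap.toMatrix'_apply]
    split_ifs
    · exact M.differentiableAt_sourceJump b hℓ' i₁ hk
    · exact M.differentiableAt_jumpMap _ _ hk
  · refine differentiableAt_det fun i₁ i₂ => ?_
    simp only [LinearMap.toMatrix'_apply]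
    exact M.differentiableAt_jumpMap _ _ hk

theorem differentiableAt_complexDensity (a b : Side) (ℓ : ℕ) {ℓ' : ℕ} (hℓ' : ℓ' ≤ M.L) {k : ℂ}
    (hk : 0 < k.re) : DifferentiableAt ℂ (M.complexDensity a b ℓ ℓ') k := by
  rcases a with _ | _ <;> unfold complexDensity <;> simp only [upAmp, downAmp] <;> split_ifs
  · exact M.differentiableAt_complexAmp b hℓ' _ hk
  · fun_prop
  · exact M.differentiableAt_complexAmp b hℓ' _ hk
  · fun_prop

end LayeredMedium

/-! ### Boundedness of the densities on sectors. -/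

namespace LayeredMedium

variable (M : LayeredMedium)

theorem exists_pos_le_of_le {L : ℕ} {F : ℕ → ℝ} (hF : ∀ j ≤ L, 0 < F j) :
    ∃ μ > 0, ∀ j ≤ L, μ ≤ F j := by
  obtain ⟨i, hi, h⟩ := Finset.exists_min_image (Finset.range (L + 1)) F ⟨0, by simp⟩
  exact ⟨F i, hF i (Nat.lt_succ_iff.mp (Finset.mem_range.mp hi)),
    fun j hj => h j (Finset.mem_range.mpr (Nat.lt_succ_of_le hj))⟩

theorem exists_le_of_le (L : ℕ) (F : ℕ → ℝ) : ∃ C ≥ 0, ∀ j ≤ L, F j ≤ C := by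
  obtain ⟨i, hi, h⟩ := Finset.exists_max_image (Finset.range (L + 1)) F ⟨0, by simp⟩
  exact ⟨max (F i) 0, le_max_right _ _,
    fun j hj => (h j (Finset.mem_range.mpr (Nat.lt_succ_of_le hj))).trans (le_max_left _ _)⟩

/-- Adds the two lower bounds for the real part: `c |k|`, which matters for large `k`, and `c² λ /
2`, which matters near zero. -/
theorem inv_re_complexRoot_le {j : ℕ} (hj : j ≤ M.L) {c : ℝ} (hc : 0 < c) {k : ℂ}
    (hk : 0 < k.re) (hck : c * ‖k‖ ≤ k.re) :
    (complexRoot (M.lam j) k).re⁻¹ ≤ (1 / c + 2 / (c ^ 2 * M.lam j)) / (‖k‖ + 1) := by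
  have hlam := M.lam_pos j hj
  have h1 := complexRoot.re_le (M.lam j) hk
  have h2 := complexRoot.le_re_of_sector hlam.le hc hk hck
  have h3 := complexRoot.re_pos (M.lam j) hk
  set x := (complexRoot (M.lam j) k).re
  rw [inv_eq_one_div, div_le_div_iff₀ h3 (by positivity), add_mul]
  have e1 : ‖k‖ ≤ 1 / c * x := by
    rw [one_div, inv_mul_eq_div, le_div_iff₀ hc]; linarith
  have e2 : 1 ≤ 2 / (c ^ 2 * M.lam j) * x := by
    rw [div_mul_eq_mul_div, le_div_iff₀ (by positivity)]; linarith
  linarith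

/-- The reaction densities are bounded on sectors of the right half-plane. -/
theorem exists_bound_complexDensity (a b : Side) {ℓ ℓ' : ℕ} (hℓ : ℓ ≤ M.L) (hℓ' : ℓ' ≤ M.L)
    {c : ℝ} (hc : 0 < c) :
    ∃ C, ∀ k : ℂ, 0 < k.re → c * ‖k‖ ≤ k.re → ‖M.complexDensity a b ℓ ℓ' k‖ ≤ C := by
  obtain ⟨C₁, hC₁0, hC₁⟩ := exists_le_of_le M.L fun j => 1 / c + 2 / (c ^ 2 * M.lam j)
  obtain ⟨e', he'0, he'⟩ := exists_le_of_le M.L M.ε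
  -- A lower bound of `1 - |E_j|²`, uniform in the sector: the real part of the vertical wave number
  -- is at least `c² λ_j / 2`, and outer layers have `E_j = 0`.
  set η : ℕ → ℝ := fun j => if 0 < j ∧ j < M.L then
    1 - Real.exp (-(c ^ 2 / 2 * M.lam j * (M.d (j - 1) - M.d j))) ^ 2 else 1 with hη
  have hηpos : ∀ j ≤ M.L, 0 < η j := by
    intro j hj
    simp only [hη]
    split_ifs with h
    · have hd := M.d_lt (j - 1) (by omega)
      rw [Nat.sub_add_cancel h.1] at hd
      have hlam := M.lam_pos j hj
      have hd' : 0 < M.d (j - 1) - M.d j := sub_pos.mpr hd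
      have h1 : Real.exp (-(c ^ 2 / 2 * M.lam j * (M.d (j - 1) - M.d j))) < 1 := by
        rw [Real.exp_lt_one_iff, neg_lt_zero]; positivity
      have h2 := Real.exp_pos (-(c ^ 2 / 2 * M.lam j * (M.d (j - 1) - M.d j)))
      nlinarith
    · exact one_pos
  -- The denominator `λ_j + 1` comes from `Re l ≤ λ_j + |k| ≤ (λ_j + 1)(|k| + 1)`.
  obtain ⟨μ, hμ, hμle⟩ := exists_pos_le_of_le (L := M.L)
    (F := fun j => M.ε j * η j / (M.lam j + 1)) fun j hj => by
      have := M.ε_pos j hj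
      have := M.lam_pos j hj
      have := hηpos j hj
      positivity
  set C := C₁ + C₁ / M.ε ℓ' with hCdef
  have hε' := M.ε_pos ℓ' hℓ'
  have hC₁C : C₁ ≤ C := le_add_of_nonneg_right (by positivity)
  have hC₁C' : C₁ / M.ε ℓ' ≤ C := le_add_of_nonneg_left hC₁0
  have hC0 : 0 ≤ C := by positivity
  set B := 2 / (μ * c) * (M.L * ((C * (e' + 1)) ^ 2 / (μ * c) + C)) with hB
  refine ⟨Real.sqrt B, fun k hk hck => ?_⟩
  have hinv : ∀ j ≤ M.L, ‖complexRoot (M.lam j) k‖⁻¹ ≤ C₁ / (‖k‖ + 1) := by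
    intro j hj
    have h3 := complexRoot.re_pos (M.lam j) hk
    calc ‖complexRoot (M.lam j) k‖⁻¹ ≤ (complexRoot (M.lam j) k).re⁻¹ :=
          inv_anti₀ h3 (Complex.re_le_norm _)
      _ ≤ (1 / c + 2 / (c ^ 2 * M.lam j)) / (‖k‖ + 1) := M.inv_re_complexRoot_le hj hc hk hck
      _ ≤ _ := by gcongr; exact hC₁ j hj
  have hx := M.jumpMap_complexAmp b ℓ' hk
  set x := M.complexAmp b ℓ' k with hxdef
  have hsrc1 : ‖1 / ((M.ε ℓ' : ℂ) * complexRoot (M.lam ℓ') k)‖ ≤ C / (‖k‖ + 1) := by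
    rw [norm_div, norm_one, norm_mul, Complex.norm_real, Real.norm_eq_abs, abs_of_pos hε', one_div,
      mul_inv]
    calc (M.ε ℓ')⁻¹ * ‖complexRoot (M.lam ℓ') k‖⁻¹ ≤ (M.ε ℓ')⁻¹ * (C₁ / (‖k‖ + 1)) := by
          gcongr; exact hinv ℓ' hℓ'
      _ = C₁ / M.ε ℓ' / (‖k‖ + 1) := by ring
      _ ≤ _ := by gcongr
  have hpos : 0 ≤ C / (‖k‖ + 1) := by positivity
  have hbound := stack_bound (lam := M.lam) (e := M.ε) (a := M.upAmp x) (b := M.downAmp x)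
    (E := fun j => M.layerExp j k)
    (f := fun j => if h : j < M.L then M.sourceJump b ℓ' k (Sum.inl ⟨j, h⟩) else 0)
    (g := fun j => if h : j < M.L then M.sourceJump b ℓ' k (Sum.inr ⟨j, h⟩) else 0)
    hk M.ε_pos (fun j _ => M.layerExp_bound j hk)
    (fun j _ => (M.norm_layerExp_lt_one j hk).le) (M.layerExp_zero k) (M.layerExp_L k)
    (M.upAmp_L x) (M.downAmp_zero x)
    (fun j hj => by rw [dif_pos hj]; exact congrFun hx (Sum.inl ⟨j, hj⟩))
    (fun j hj => by rw [dif_pos hj]; exact congrFun hx (Sum.inr ⟨j, hj⟩))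
    (c := c) (C := C) (μ := μ) (e' := e') (Λ := ‖k‖ + 1) hc hck (by positivity) hμ hC0 he'
    (fun j hj => by
      rw [dif_pos hj]
      rcases b with _ | _ <;> simp only [sourceJump, Sum.elim_inl] <;> split_ifs
      · rw [neg_div, norm_neg]; exact hsrc1
      · rw [norm_zero]; exact hpos
      · exact hsrc1
      · rw [norm_zero]; exact hpos)
    (fun j hj => by
      rw [dif_pos hj]
      rcases b with _ | _ <;> simp only [sourceJump, Sum.elim_inr] <;> split_ifs <;> simp)
    (fun j hj => (hinv j hj).trans (by gcongr))
    (fun j hj => by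
      have hlam := M.lam_pos j hj
      have hε := M.ε_pos j hj
      have h3 := complexRoot.re_pos (M.lam j) hk
      have h4 : (complexRoot (M.lam j) k).re ≤ (M.lam j + 1) * (‖k‖ + 1) := by
        have := complexRoot.norm_le hlam.le hk
        have := Complex.re_le_norm (complexRoot (M.lam j) k)
        have := norm_nonneg k
        nlinarith
      have h5 : η j ≤ 1 - ‖M.layerExp j k‖ ^ 2 := by
        simp only [hη, layerExp]
        split_ifs with h
        · have hd := M.d_lt (j - 1) (by omega)
          rw [Nat.sub_add_cancel h.1] at hd
          rw [Complex.norm_exp, Complex.re_mul_ofReal, Complex.neg_re]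
          have h6 := complexRoot.le_re_of_sector hlam.le hc hk hck
          have h7 : -(complexRoot (M.lam j) k).re * (M.d (j - 1) - M.d j) ≤
              -(c ^ 2 / 2 * M.lam j * (M.d (j - 1) - M.d j)) := by
            nlinarith
          have h8 := Real.exp_le_exp.mpr h7
          gcongr
        · simp
      have h6 := hηpos j hj
      calc μ / (‖k‖ + 1) ≤ (M.ε j * η j / (M.lam j + 1)) / (‖k‖ + 1) := by
            gcongr; exact hμle j hj
        _ = M.ε j * η j / ((M.lam j + 1) * (‖k‖ + 1)) := by rw [div_div]
        _ ≤ M.ε j * η j / (complexRoot (M.lam j) k).re := by gcongr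
        _ ≤ _ := by gcongr)
  have h := hbound ℓ hℓ
  rw [← hB] at h
  apply Real.le_sqrt_of_sq_le
  rcases a with _ | _ <;> simp only [complexDensity] <;> rw [← hxdef]
  · have := sq_nonneg ‖M.downAmp x ℓ‖
    linarith
  · have := sq_nonneg ‖M.upAmp x ℓ‖
    linarith

/-! ### Identification with the reaction densities on the positive real axis. -/

/-- The part of the transmission conditions that is linear in the amplitudes: for every source
position in layer `ℓ'`, in terms of the coefficients `A`, `B` of the two reaction components. -/
theorem transmission_amplitudes {σ : Side → Side → ℕ → ℕ → ℝ → ℝ} (hσ : M.IsReactionDensity σ)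
    {k : ℝ} (hk : 0 < k) {ℓ' : ℕ} (hℓ' : ℓ' ≤ M.L) {z' : ℝ} (hz' : M.InLayer ℓ' z') {j : ℕ}
    (hj : j < M.L) (A B : ℕ → ℝ)
    (hA : A = fun ℓ => if ℓ < M.L then M.psi σ Side.one ℓ ℓ' k z' else 0)
    (hB : B = fun ℓ => if 0 < ℓ then M.psi σ Side.two ℓ ℓ' k z' else 0) :
    (A j + B j * Real.exp (-M.lamz j k * (M.d (j - 1) - M.d j))) / M.lamz j k -
      (A (j + 1) * Real.exp (-M.lamz (j + 1) k * (M.d j - M.d (j + 1))) + B (j + 1)) /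
        M.lamz (j + 1) k =
      -(if j = ℓ' then Real.exp (-M.lamz ℓ' k * (z' - M.d ℓ')) / (M.ε ℓ' * M.lamz ℓ' k) else 0) +
      (if j + 1 = ℓ' then Real.exp (-M.lamz ℓ' k * (M.d (ℓ' - 1) - z')) / (M.ε ℓ' * M.lamz ℓ' k)
        else 0) ∧
    M.ε j * (-A j + B j * Real.exp (-M.lamz j k * (M.d (j - 1) - M.d j))) -
      M.ε (j + 1) * (-(A (j + 1) * Real.exp (-M.lamz (j + 1) k * (M.d j - M.d (j + 1)))) +
        B (j + 1)) =
      -(if j = ℓ' then Real.exp (-M.lamz ℓ' k * (z' - M.d ℓ')) else 0) -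
      (if j + 1 = ℓ' then Real.exp (-M.lamz ℓ' k * (M.d (ℓ' - 1) - z')) else 0) := by
  have hG : ∀ ℓ, M.spectralGreen σ ℓ ℓ' k z' = fun z =>
      Real.exp (-M.lamz ℓ k * (z - M.d ℓ)) / (2 * M.lamz ℓ k) * A ℓ +
      Real.exp (-M.lamz ℓ k * (M.d (ℓ - 1) - z)) / (2 * M.lamz ℓ k) * B ℓ +
      (if ℓ = ℓ' then Real.exp (-M.lamz ℓ k * |z - z'|) / (2 * M.ε ℓ * M.lamz ℓ k) else 0) := by
    intro ℓ
    funext z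
    simp only [spectralGreen, hA, hB, mul_ite, mul_zero]
  have hd1 : ∀ c lm t x : ℝ, HasDerivAt (fun z => Real.exp (-lm * (z - t)) / (2 * lm) * c)
      (Real.exp (-lm * (x - t)) * (-lm) / (2 * lm) * c) x := by
    intro c lm t x
    have := ((((hasDerivAt_id x).sub_const t).const_mul (-lm)).exp.div_const (2 * lm)).mul_const c
    simpa using this
  have hd2 : ∀ c lm t x : ℝ, HasDerivAt (fun z => Real.exp (-lm * (t - z)) / (2 * lm) * c)
      (Real.exp (-lm * (t - x)) * lm / (2 * lm) * c) x := by
    intro c lm t x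
    have := ((((hasDerivAt_id x).const_sub t).const_mul (-lm)).exp.div_const (2 * lm)).mul_const c
    simpa using this
  have hlj := M.lamz_pos hj.le k
  have hlj1 := M.lamz_pos (show j + 1 ≤ M.L from hj) k
  have hej := M.ε_pos j hj.le
  have hej1 := M.ε_pos (j + 1) hj
  set Ej := Real.exp (-M.lamz j k * (M.d (j - 1) - M.d j)) with hEj
  set Ej1 := Real.exp (-M.lamz (j + 1) k * (M.d j - M.d (j + 1))) with hEj1
  set s1 := Real.exp (-M.lamz ℓ' k * (z' - M.d ℓ')) with hs1
  set s2 := Real.exp (-M.lamz ℓ' k * (M.d (ℓ' - 1) - z')) with hs2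
  set D1 : ℝ := if j = ℓ' then s1 else 0 with hD1
  set D2 : ℝ := if j + 1 = ℓ' then s2 else 0 with hD2
  have v1 : M.spectralGreen σ j ℓ' k z' (M.d j) =
      (A j + B j * Ej) / (2 * M.lamz j k) + D1 / (2 * M.ε j * M.lamz j k) := by
    rw [hG j]
    have : (if j = ℓ' then Real.exp (-M.lamz j k * |M.d j - z'|) / (2 * M.ε j * M.lamz j k)
        else 0) = D1 / (2 * M.ε j * M.lamz j k) := by
      by_cases h : j = ℓ'
      · have hz := hz'.1 (h ▸ hj)
        subst h
        rw [abs_of_neg (by linarith)]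
        simp [hD1, hs1]
      · simp [hD1, h]
    simp only [this, sub_self, mul_zero, Real.exp_zero]
    rw [← hEj]; ring
  have v2 : M.spectralGreen σ (j + 1) ℓ' k z' (M.d j) =
      (A (j + 1) * Ej1 + B (j + 1)) / (2 * M.lamz (j + 1) k) +
        D2 / (2 * M.ε (j + 1) * M.lamz (j + 1) k) := by
    rw [hG (j + 1)]
    have : (if j + 1 = ℓ' then Real.exp (-M.lamz (j + 1) k * |M.d j - z'|) /
        (2 * M.ε (j + 1) * M.lamz (j + 1) k) else 0) =
        D2 / (2 * M.ε (j + 1) * M.lamz (j + 1) k) := by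
      by_cases h : j + 1 = ℓ'
      · have hz := hz'.2 (by omega)
        subst h
        rw [Nat.add_sub_cancel] at hz
        rw [abs_of_pos (by linarith)]
        simp [hD2, hs2]
      · simp [hD2, h]
    simp only [this, Nat.add_sub_cancel, sub_self, mul_zero, Real.exp_zero]
    rw [← hEj1]; ring
  have w1 : deriv (M.spectralGreen σ j ℓ' k z') (M.d j) =
      (-A j + B j * Ej) / 2 + D1 / (2 * M.ε j) := by
    rw [hG j]
    have h3 : HasDerivAt (fun z => if j = ℓ' then Real.exp (-M.lamz j k * |z - z'|) /
        (2 * M.ε j * M.lamz j k) else 0) (D1 / (2 * M.ε j)) (M.d j) := by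
      by_cases h : j = ℓ'
      · have hz := hz'.1 (h ▸ hj)
        subst h
        have h4 := hd2 (1 / M.ε j) (M.lamz j k) z' (M.d j)
        have h5 : D1 / (2 * M.ε j) =
            Real.exp (-M.lamz j k * (z' - M.d j)) * M.lamz j k / (2 * M.lamz j k) *
              (1 / M.ε j) := by
          simp only [hD1, hs1, if_true]; field_simp
        rw [h5]
        refine h4.congr_of_eventuallyEq ?_
        -- The source lies strictly inside its layer, so `|z - z'|` is smooth near the interface.
        filter_upwards [Iio_mem_nhds hz] with z hzz
        have hzz' : z < z' := hzz
        simp only [if_true]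
        rw [abs_of_neg (by linarith), neg_sub]
        field_simp
      · simpa [hD1, h] using hasDerivAt_const (M.d j) (0 : ℝ)
    have := (((hd1 (A j) (M.lamz j k) (M.d j) (M.d j)).add
      (hd2 (B j) (M.lamz j k) (M.d (j - 1)) (M.d j))).add h3).deriv
    refine this.trans ?_
    rw [← hEj, sub_self, mul_zero, Real.exp_zero]
    field_simp
  have w2 : deriv (M.spectralGreen σ (j + 1) ℓ' k z') (M.d j) =
      (-(A (j + 1) * Ej1) + B (j + 1)) / 2 - D2 / (2 * M.ε (j + 1)) := by
    rw [hG (j + 1)]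
    have h3 : HasDerivAt (fun z => if j + 1 = ℓ' then Real.exp (-M.lamz (j + 1) k * |z - z'|) /
        (2 * M.ε (j + 1) * M.lamz (j + 1) k) else 0) (-(D2 / (2 * M.ε (j + 1)))) (M.d j) := by
      by_cases h : j + 1 = ℓ'
      · have hz := hz'.2 (by omega)
        subst h
        rw [Nat.add_sub_cancel] at hz
        have h4 := hd1 (1 / M.ε (j + 1)) (M.lamz (j + 1) k) z' (M.d j)
        have h5 : -(D2 / (2 * M.ε (j + 1))) =
            Real.exp (-M.lamz (j + 1) k * (M.d j - z')) * (-M.lamz (j + 1) k) /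
              (2 * M.lamz (j + 1) k) * (1 / M.ε (j + 1)) := by
          simp only [hD2, hs2, if_true, Nat.add_sub_cancel]; field_simp
        rw [h5]
        refine h4.congr_of_eventuallyEq ?_
        filter_upwards [Ioi_mem_nhds hz] with z hzz
        have hzz' : z' < z := hzz
        simp only [if_true]
        rw [abs_of_pos (by linarith)]
        field_simp
      · simpa [hD2, h] using hasDerivAt_const (M.d j) (0 : ℝ)
    have := (((hd1 (A (j + 1)) (M.lamz (j + 1) k) (M.d (j + 1)) (M.d j)).add
      (hd2 (B (j + 1)) (M.lamz (j + 1) k) (M.d j) (M.d j))).add h3).deriv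
    refine this.trans ?_
    rw [← hEj1, sub_self, mul_zero, Real.exp_zero]
    field_simp
    ring
  obtain ⟨t1, t2⟩ := hσ k hk ℓ' hℓ' z' hz' j hj
  rw [v1, v2] at t1
  rw [w1, w2] at t2
  have c1 : (if j = ℓ' then s1 / (M.ε ℓ' * M.lamz ℓ' k) else 0) = D1 / (M.ε j * M.lamz j k) := by
    by_cases h : j = ℓ'
    · subst h; simp [hD1]
    · simp [hD1, h]
  have c2 : (if j + 1 = ℓ' then s2 / (M.ε ℓ' * M.lamz ℓ' k) else 0) =
      D2 / (M.ε (j + 1) * M.lamz (j + 1) k) := by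
    by_cases h : j + 1 = ℓ'
    · subst h; simp [hD2]
    · simp [hD2, h]
  have r1 : M.ε j * (D1 / (2 * M.ε j)) = D1 / 2 := by field_simp
  have r2 : M.ε (j + 1) * (D2 / (2 * M.ε (j + 1))) = D2 / 2 := by field_simp
  rw [mul_add, mul_sub, r1, r2] at t2
  constructor
  · rw [c1, c2]
    linear_combination 2 * t1
  · linear_combination 2 * t2

end LayeredMedium

namespace LayeredMedium

variable (M : LayeredMedium)

/-- The growing and the decaying exponential in `z'` are linearly independent on any layer. This
separates the parts `𝔟 = 1` and `𝔟 = 2` of the transmission conditions. In an outer layer only one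
exponential is present. -/
theorem eq_zero_of_source_exponentials {ℓ' : ℕ} {l : ℝ} (hl : 0 < l) (P Q : ℝ)
    (h : ∀ z', M.InLayer ℓ' z' →
      (if ℓ' < M.L then Real.exp (-l * (z' - M.d ℓ')) else 0) * P +
        (if 0 < ℓ' then Real.exp (-l * (M.d (ℓ' - 1) - z')) else 0) * Q = 0) :
    (ℓ' < M.L → P = 0) ∧ (0 < ℓ' → Q = 0) := by
  by_cases h1 : ℓ' < M.L <;> by_cases h2 : 0 < ℓ'
  · have hd := M.d_lt (ℓ' - 1) (by omega)
    rw [Nat.sub_add_cancel h2] at hd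
    simp only [h1, h2, if_true] at h
    obtain ⟨z₁, hz₁, hz₁'⟩ := exists_between hd
    obtain ⟨z₂, hz₂, hz₂'⟩ := exists_between hz₁'
    have e₁ := h z₁ ⟨fun _ => hz₁, fun _ => hz₁'⟩
    have e₂ := h z₂ ⟨fun _ => hz₁.trans hz₂, fun _ => hz₂'⟩
    have f₁ : Real.exp (-l * (z₁ - M.d ℓ')) =
        Real.exp (-l * (z₂ - M.d ℓ')) * Real.exp (l * (z₂ - z₁)) := by
      rw [← Real.exp_add]; ring_nf
    have f₂ : Real.exp (-l * (M.d (ℓ' - 1) - z₂)) =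
        Real.exp (-l * (M.d (ℓ' - 1) - z₁)) * Real.exp (l * (z₂ - z₁)) := by
      rw [← Real.exp_add]; ring_nf
    have hT : 1 < Real.exp (l * (z₂ - z₁)) :=
      Real.one_lt_exp_iff.mpr (mul_pos hl (sub_pos.mpr hz₂))
    have p₁ := Real.exp_pos (-l * (z₂ - M.d ℓ'))
    have p₂ := Real.exp_pos (-l * (M.d (ℓ' - 1) - z₁))
    rw [f₁] at e₁
    rw [f₂] at e₂
    set T := Real.exp (l * (z₂ - z₁))
    -- Moving the source from `z₁` up to `z₂` multiplies one exponential by `T` and divides the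
    -- other by `T`. The `2 × 2` system is regular because `T > 1`.
    have hQ : Real.exp (-l * (M.d (ℓ' - 1) - z₁)) * (T ^ 2 - 1) * Q = 0 := by
      linear_combination T * e₂ - e₁
    have hQ0 : Q = 0 := by
      have : Real.exp (-l * (M.d (ℓ' - 1) - z₁)) * (T ^ 2 - 1) ≠ 0 :=
        mul_ne_zero p₂.ne' (by nlinarith)
      exact (mul_eq_zero.mp hQ).resolve_left this
    rw [hQ0, mul_zero, add_zero] at e₂
    exact ⟨fun _ => (mul_eq_zero.mp e₂).resolve_left p₁.ne', fun _ => hQ0⟩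
  · have := h (M.d ℓ' + 1) ⟨fun _ => by linarith, fun h => absurd h h2⟩
    simp only [h1, h2, if_true, if_false, zero_mul, add_zero] at this
    exact ⟨fun _ => (mul_eq_zero.mp this).resolve_left (Real.exp_pos _).ne', fun h => absurd h h2⟩
  · have := h (M.d (ℓ' - 1) - 1) ⟨fun h => absurd h h1, fun _ => by linarith⟩
    simp only [h1, h2, if_true, if_false, zero_mul, zero_add] at this
    exact ⟨fun h => absurd h h1, fun _ => (mul_eq_zero.mp this).resolve_left (Real.exp_pos _).ne'⟩
  · exact ⟨fun h => absurd h h1, fun h => absurd h h2⟩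

/-- The reaction densities as one vector of amplitudes. -/
def densityAmp (σ : Side → Side → ℕ → ℕ → ℝ → ℝ) (b : Side) (ℓ' : ℕ) (k : ℝ) :
    Fin M.L ⊕ Fin M.L → ℝ :=
  Sum.elim (fun j : Fin M.L => σ Side.one b j ℓ' k) (fun j : Fin M.L => σ Side.two b (j + 1) ℓ' k)

theorem upAmp_densityAmp (σ : Side → Side → ℕ → ℕ → ℝ → ℝ) (b : Side) (ℓ' : ℕ) (k : ℝ) (j : ℕ) :
    M.upAmp (M.densityAmp σ b ℓ' k) j = if j < M.L then σ Side.one b j ℓ' k else 0 := by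
  simp [upAmp, densityAmp]

theorem downAmp_densityAmp (σ : Side → Side → ℕ → ℕ → ℝ → ℝ) (b : Side) (ℓ' : ℕ) (k : ℝ) {j : ℕ}
    (hj : j ≤ M.L) :
    M.downAmp (M.densityAmp σ b ℓ' k) j = if 0 < j then σ Side.two b j ℓ' k else 0 := by
  by_cases h : 0 < j
  · have h' : 0 < j ∧ j - 1 < M.L := ⟨h, by omega⟩
    simp [downAmp, densityAmp, h', Nat.sub_add_cancel h]
  · simp [downAmp, h]

theorem upAmp_ofReal (x : Fin M.L ⊕ Fin M.L → ℝ) (j : ℕ) :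
    M.upAmp (fun i => (x i : ℂ)) j = ((M.upAmp x j : ℝ) : ℂ) := by
  unfold upAmp; split_ifs <;> simp

theorem downAmp_ofReal (x : Fin M.L ⊕ Fin M.L → ℝ) (j : ℕ) :
    M.downAmp (fun i => (x i : ℂ)) j = ((M.downAmp x j : ℝ) : ℂ) := by
  unfold downAmp; split_ifs <;> simp

theorem complexRoot_eq_lamz (ℓ : ℕ) (k : ℝ) : complexRoot (M.lam ℓ) k = (M.lamz ℓ k : ℂ) :=
  complexRoot.ofReal _ _

theorem layerExp_ofReal {j : ℕ} (h : 0 < j ∧ j < M.L) (k : ℝ) :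
    M.layerExp j k = (Real.exp (-M.lamz j k * (M.d (j - 1) - M.d j)) : ℂ) := by
  rw [layerExp, if_pos h, complexRoot_eq_lamz]
  push_cast
  rfl

/-- The reaction densities are the amplitudes caused by the two parts of the source field. -/
theorem densityAmp_jump {σ : Side → Side → ℕ → ℕ → ℝ → ℝ} (hσ : M.IsReactionDensity σ) {k : ℝ}
    (hk : 0 < k) {ℓ' : ℕ} (hℓ' : ℓ' ≤ M.L) {b : Side} (hb : M.Admissible b ℓ') :
    M.jumpMap k (fun i => (M.densityAmp σ b ℓ' k i : ℂ)) = M.sourceJump b ℓ' k := by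
  set x := fun b => M.densityAmp σ b ℓ' k with hx
  set E : ℕ → ℝ := fun j => Real.exp (-M.lamz j k * (M.d (j - 1) - M.d j)) with hE
  set F : Side → ℕ → ℝ := fun b j =>
    (M.upAmp (x b) j + M.downAmp (x b) j * E j) / M.lamz j k -
      (M.upAmp (x b) (j + 1) * E (j + 1) + M.downAmp (x b) (j + 1)) / M.lamz (j + 1) k with hF
  set G : Side → ℕ → ℝ := fun b j =>
    M.ε j * (-M.upAmp (x b) j + M.downAmp (x b) j * E j) -
      M.ε (j + 1) * (-(M.upAmp (x b) (j + 1) * E (j + 1)) + M.downAmp (x b) (j + 1)) with hG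
  -- The height `z'` enters the jump conditions only through the two source exponentials. Their
  -- coefficients are the defects of the equations that the densities should satisfy.
  have key : ∀ j, j < M.L → ∀ z', M.InLayer ℓ' z' →
      (if ℓ' < M.L then Real.exp (-M.lamz ℓ' k * (z' - M.d ℓ')) else 0) *
          (F Side.one j + if j = ℓ' then 1 / (M.ε ℓ' * M.lamz ℓ' k) else 0) +
        (if 0 < ℓ' then Real.exp (-M.lamz ℓ' k * (M.d (ℓ' - 1) - z')) else 0) *
          (F Side.two j - if j + 1 = ℓ' then 1 / (M.ε ℓ' * M.lamz ℓ' k) else 0) = 0 ∧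
      (if ℓ' < M.L then Real.exp (-M.lamz ℓ' k * (z' - M.d ℓ')) else 0) *
          (G Side.one j + if j = ℓ' then 1 else 0) +
        (if 0 < ℓ' then Real.exp (-M.lamz ℓ' k * (M.d (ℓ' - 1) - z')) else 0) *
          (G Side.two j + if j + 1 = ℓ' then 1 else 0) = 0 := by
    intro j hj z' hz'
    set s1 : ℝ := if ℓ' < M.L then Real.exp (-M.lamz ℓ' k * (z' - M.d ℓ')) else 0 with hs1
    set s2 : ℝ := if 0 < ℓ' then Real.exp (-M.lamz ℓ' k * (M.d (ℓ' - 1) - z')) else 0 with hs2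
    have hpsi : ∀ a ℓ, M.psi σ a ℓ ℓ' k z' =
        s1 * σ a Side.one ℓ ℓ' k + s2 * σ a Side.two ℓ ℓ' k := by
      intro a ℓ; simp only [psi, hs1, hs2]; split_ifs <;> simp
    obtain ⟨t1, t2⟩ := M.transmission_amplitudes hσ hk hℓ' hz' hj _ _ rfl rfl
    have eA : ∀ i, (if i < M.L then M.psi σ Side.one i ℓ' k z' else 0) =
        s1 * M.upAmp (x Side.one) i + s2 * M.upAmp (x Side.two) i := by
      intro i
      simp only [hx, upAmp_densityAmp, hpsi]
      split_ifs <;> simp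
    have eB : ∀ i ≤ M.L, (if 0 < i then M.psi σ Side.two i ℓ' k z' else 0) =
        s1 * M.downAmp (x Side.one) i + s2 * M.downAmp (x Side.two) i := by
      intro i hi
      simp only [hx, M.downAmp_densityAmp _ _ _ _ hi, hpsi]
      split_ifs <;> simp
    have c1 : ∀ u : ℝ, (if j = ℓ' then Real.exp (-M.lamz ℓ' k * (z' - M.d ℓ')) / u else 0) =
        s1 * (if j = ℓ' then 1 / u else 0) := by
      intro u
      split_ifs with h
      · rw [hs1, if_pos (h ▸ hj)]; ring
      · simp
    have c2 : ∀ u : ℝ, (if j + 1 = ℓ' then Real.exp (-M.lamz ℓ' k * (M.d (ℓ' - 1) - z')) / u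
        else 0) = s2 * (if j + 1 = ℓ' then 1 / u else 0) := by
      intro u
      split_ifs with h
      · rw [hs2, if_pos (by omega)]; ring
      · simp
    have c3 := c1 1
    have c4 := c2 1
    simp only [div_one] at c3 c4
    simp only [eA, eB j hj.le, eB (j + 1) hj, c1, c2, c3, c4] at t1 t2
    have hE1 : E (j + 1) = Real.exp (-M.lamz (j + 1) k * (M.d j - M.d (j + 1))) := by
      simp [hE]
    rw [← hE1] at t1 t2
    constructor
    · simp only [hF]
      linear_combination t1
    · simp only [hG]
      linear_combination t2
  have hl := M.lamz_pos hℓ' k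
  have hFG : M.sourceJump b ℓ' k =
      Sum.elim (fun j : Fin M.L => (F b j : ℂ)) (fun j : Fin M.L => (G b j : ℂ)) := by
    funext i
    rcases i with j | j
    · have := M.eq_zero_of_source_exponentials hl _ _ (fun z' hz' => (key j j.2 z' hz').1)
      rcases b with _ | _
      · have h := this.1 hb
        simp only [sourceJump, Sum.elim_inl, complexRoot_eq_lamz]
        rw [eq_neg_of_add_eq_zero_left h]
        split_ifs
        · push_cast; ring
        · simp
      · have h := this.2 hb.1
        simp only [sourceJump, Sum.elim_inl, complexRoot_eq_lamz]
        rw [sub_eq_zero.mp h]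
        split_ifs
        · push_cast; ring
        · simp
    · have := M.eq_zero_of_source_exponentials hl _ _ (fun z' hz' => (key j j.2 z' hz').2)
      rcases b with _ | _
      · have h := this.1 hb
        simp only [sourceJump, Sum.elim_inr]
        rw [eq_neg_of_add_eq_zero_left h]
        split_ifs <;> simp
      · have h := this.2 hb.1
        simp only [sourceJump, Sum.elim_inr]
        rw [eq_neg_of_add_eq_zero_left h]
        split_ifs <;> simp
  -- `layerExp` is zero in the outer layers while `E` is not. The two agree after multiplication
  -- because the amplitude in question vanishes there.
  have hd : ∀ j, j < M.L → ((M.downAmp (x b) j : ℝ) : ℂ) * M.layerExp j k =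
      ((M.downAmp (x b) j * E j : ℝ) : ℂ) := by
    intro j hj
    rcases Nat.eq_zero_or_pos j with h | h
    · subst h; simp [downAmp_zero]
    · rw [M.layerExp_ofReal ⟨h, hj⟩, Complex.ofReal_mul]
  have hu : ∀ j, j < M.L → ((M.upAmp (x b) (j + 1) : ℝ) : ℂ) * M.layerExp (j + 1) k =
      ((M.upAmp (x b) (j + 1) * E (j + 1) : ℝ) : ℂ) := by
    intro j hj
    rcases Nat.lt_or_ge (j + 1) M.L with h | h
    · rw [M.layerExp_ofReal ⟨by omega, h⟩, Complex.ofReal_mul]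
    · have : j + 1 = M.L := by omega
      rw [this]; simp [upAmp_L]
  have hxb : M.densityAmp σ b ℓ' k = x b := rfl
  funext i
  rcases i with j | j <;> rw [hFG] <;>
    simp only [jumpMap, LinearMap.coe_mk, AddHom.coe_mk, Sum.elim_inl, Sum.elim_inr, upAmp_ofReal,
      downAmp_ofReal, hxb, hd j j.2, hu j j.2, complexRoot_eq_lamz, hF, hG] <;> push_cast <;> rfl

theorem complexDensity_ofReal {a b : Side} {ℓ ℓ' : ℕ} (hℓ' : ℓ' ≤ M.L)
    (ha : M.Admissible a ℓ) (hb : M.Admissible b ℓ') {k : ℝ} (hk : 0 < k) :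
    M.complexDensity a b ℓ ℓ' k = (M.reactionDensity a b ℓ ℓ' k : ℂ) := by
  have h := M.complexAmp_unique b ℓ' (k := (k : ℂ)) (by simpa using hk)
    (M.densityAmp_jump M.isReactionDensity_reactionDensity hk hℓ' hb)
  rcases a with _ | _
  · simp only [complexDensity, h]
    rw [upAmp_ofReal, upAmp_densityAmp, if_pos (show ℓ < M.L from ha)]
  · simp only [complexDensity, h]
    rw [downAmp_ofReal, M.downAmp_densityAmp _ _ _ _ ha.2, if_pos ha.1]

end LayeredMedium

/-! ### Sommerfeld integrals and their invariance under divergence-free flows. -/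

open MeasureTheory Set Filter Topology

theorem ContinuousOn.integrable_prod_Ioc {f : ℝ × ℝ → ℂ} {a b c d : ℝ}
    (hf : ContinuousOn f (Icc a b ×ˢ Icc c d)) :
    Integrable f ((volume.restrict (Ioc a b)).prod (volume.restrict (Ioc c d))) := by
  rw [Measure.prod_restrict]
  exact (hf.integrableOn_compact (isCompact_Icc.prod isCompact_Icc)).mono_set
    (prod_mono Ioc_subset_Icc_self Ioc_subset_Icc_self)

theorem ContinuousOn.integrable_prod_prod_Ioc {f : ℝ × ℝ × ℝ → ℂ} {a b c d e g : ℝ}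
    (hf : ContinuousOn f (Icc a b ×ˢ Icc c d ×ˢ Icc e g)) :
    Integrable f ((volume.restrict (Ioc a b)).prod
      ((volume.restrict (Ioc c d)).prod (volume.restrict (Ioc e g)))) := by
  rw [Measure.prod_restrict, Measure.prod_restrict]
  exact (hf.integrableOn_compact (isCompact_Icc.prod (isCompact_Icc.prod isCompact_Icc))).mono_set
    (prod_mono Ioc_subset_Icc_self (prod_mono Ioc_subset_Icc_self Ioc_subset_Icc_self))

/-- The change of the integral over a rectangle under a flow `∂_φ u = ∂_κ P + ∂_α Q` with `Q`
periodic in `α` is given by the flux of `P` through two sides. -/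
theorem norm_integral_sub_le_of_flux {u P Q D₁ D₂ : ℝ → ℝ → ℝ → ℂ} {φ δ K T B : ℝ}
    (hφ : 0 ≤ φ) (hδ : δ ≤ K) (hT : 0 ≤ T)
    (hu : ∀ t ∈ Icc 0 φ, ∀ κ ∈ Icc δ K, ∀ α ∈ Icc 0 T,
      HasDerivAt (fun t => u t κ α) (D₁ t κ α + D₂ t κ α) t)
    (hP : ∀ t ∈ Icc 0 φ, ∀ κ ∈ Icc δ K, ∀ α ∈ Icc 0 T,
      HasDerivAt (fun κ => P t κ α) (D₁ t κ α) κ)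
    (hQ : ∀ t ∈ Icc 0 φ, ∀ κ ∈ Icc δ K, ∀ α ∈ Icc 0 T,
      HasDerivAt (fun α => Q t κ α) (D₂ t κ α) α)
    (hper : ∀ t κ, Q t κ T = Q t κ 0)
    (hD₁ : ContinuousOn (fun x : ℝ × ℝ × ℝ => D₁ x.1 x.2.1 x.2.2) (Icc 0 φ ×ˢ Icc δ K ×ˢ Icc 0 T))
    (hD₂ : ContinuousOn (fun x : ℝ × ℝ × ℝ => D₂ x.1 x.2.1 x.2.2) (Icc 0 φ ×ˢ Icc δ K ×ˢ Icc 0 T))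
    (hB : ∀ t ∈ Icc 0 φ, ∀ α ∈ Icc 0 T, ‖P t K α - P t δ α‖ ≤ B) :
    ‖∫ κ in Ioc δ K, ∫ α in Ioc 0 T, (u φ κ α - u 0 κ α)‖ ≤ B * (φ * T) := by
  set μφ := volume.restrict (Ioc 0 φ)
  set μα := volume.restrict (Ioc 0 T)
  set μκ := volume.restrict (Ioc δ K)
  have comp : ∀ D : ℝ → ℝ → ℝ → ℂ,
      ContinuousOn (fun x : ℝ × ℝ × ℝ => D x.1 x.2.1 x.2.2) (Icc 0 φ ×ˢ Icc δ K ×ˢ Icc 0 T) →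
      ∀ κ ∈ Icc δ K, ContinuousOn (fun x : ℝ × ℝ => D x.2 κ x.1) (Icc 0 T ×ˢ Icc 0 φ) := by
    intro D hD κ hκ
    exact hD.comp (f := fun x : ℝ × ℝ => (x.2, κ, x.1)) (by fun_prop)
      fun x hx => ⟨hx.2, hκ, hx.1⟩
  have hinner : ∀ κ ∈ Ioc δ K, ∫ α, (u φ κ α - u 0 κ α) ∂μα =
      ∫ x, D₁ x.2 κ x.1 ∂(μα.prod μφ) := by
    intro κ hκ
    have hκ' := Ioc_subset_Icc_self hκ
    have i₁ := (comp D₁ hD₁ κ hκ').integrable_prod_Ioc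
    have i₂ := (comp D₂ hD₂ κ hκ').integrable_prod_Ioc
    -- The angular part of the divergence integrates to zero over a period.
    have z₂ : ∫ x, D₂ x.2 κ x.1 ∂(μα.prod μφ) = 0 := by
      rw [integral_prod_symm _ i₂]
      refine integral_eq_zero_of_ae ?_
      filter_upwards [ae_restrict_mem measurableSet_Ioc] with t ht
      have ht' := Ioc_subset_Icc_self ht
      change ∫ α in Ioc 0 T, D₂ t κ α = 0
      rw [← intervalIntegral.integral_of_le hT,
        intervalIntegral.integral_eq_sub_of_hasDerivAt (f := fun α => Q t κ α)
        (fun α hα => hQ t ht' κ hκ' α (by rwa [uIcc_of_le hT] at hα)), hper, sub_self]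
      refine ContinuousOn.intervalIntegrable ?_
      rw [uIcc_of_le hT]
      exact hD₂.comp (f := fun α : ℝ => (t, κ, α)) (by fun_prop) fun α hα => ⟨ht', hκ', hα⟩
    have : ∫ x, D₁ x.2 κ x.1 ∂(μα.prod μφ) =
        ∫ x, (D₁ x.2 κ x.1 + D₂ x.2 κ x.1) ∂(μα.prod μφ) := by
      rw [integral_add i₁ i₂, z₂, add_zero]
    have i₃ : Integrable (fun x : ℝ × ℝ => D₁ x.2 κ x.1 + D₂ x.2 κ x.1) (μα.prod μφ) := i₁.add i₂
    rw [this, integral_prod _ i₃]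
    refine integral_congr_ae ?_
    filter_upwards [ae_restrict_mem measurableSet_Ioc] with α hα
    have hα' := Ioc_subset_Icc_self hα
    change _ = ∫ t in Ioc 0 φ, (D₁ t κ α + D₂ t κ α)
    rw [← intervalIntegral.integral_of_le hφ,
      intervalIntegral.integral_eq_sub_of_hasDerivAt (f := fun t => u t κ α)
      (fun t ht => hu t (by rwa [uIcc_of_le hφ] at ht) κ hκ' α hα')]
    refine ContinuousOn.intervalIntegrable ?_
    rw [uIcc_of_le hφ]
    exact (hD₁.add hD₂).comp (f := fun t : ℝ => (t, κ, α)) (by fun_prop)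
      fun t ht => ⟨ht, hκ', hα'⟩
  -- Fubini makes the `κ` integration innermost. It leaves the flux difference between `κ = K` and
  -- `κ = δ`, bounded by `B`, on a region of measure `φ T`.
  have iκ : Integrable (Function.uncurry fun κ (x : ℝ × ℝ) => D₁ x.2 κ x.1)
      (μκ.prod (μα.prod μφ)) :=
    ContinuousOn.integrable_prod_prod_Ioc (hD₁.comp
      (f := fun x : ℝ × ℝ × ℝ => (x.2.2, x.1, x.2.1)) (by fun_prop)
      fun x hx => ⟨hx.2.2, hx.1, hx.2.1⟩)
  rw [setIntegral_congr_fun measurableSet_Ioc hinner, integral_integral_swap iκ]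
  have hbound : ∀ᵐ x ∂(μα.prod μφ), ‖∫ κ, D₁ x.2 κ x.1 ∂μκ‖ ≤ B := by
    rw [Measure.prod_restrict]
    filter_upwards [ae_restrict_mem (measurableSet_Ioc.prod measurableSet_Ioc)] with x hx
    have hα := Ioc_subset_Icc_self hx.1
    have ht := Ioc_subset_Icc_self hx.2
    change ‖∫ κ in Ioc δ K, D₁ x.2 κ x.1‖ ≤ B
    rw [← intervalIntegral.integral_of_le hδ,
      intervalIntegral.integral_eq_sub_of_hasDerivAt (f := fun κ => P x.2 κ x.1)
      (fun κ hκ => hP _ ht κ (by rwa [uIcc_of_le hδ] at hκ) _ hα)]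
    · exact hB _ ht _ hα
    · refine ContinuousOn.intervalIntegrable ?_
      rw [uIcc_of_le hδ]
      exact hD₁.comp (f := fun κ : ℝ => (x.2, κ, x.1)) (by fun_prop) fun κ hκ => ⟨ht, hκ, hα⟩
  refine (norm_integral_le_of_norm_le_const hbound).trans (le_of_eq ?_)
  have : (μα.prod μφ).real univ = φ * T := by
    rw [← univ_prod_univ, measureReal_prod_prod]
    simp [μα, μφ, hφ, hT, mul_comm]
  rw [this]

theorem integrableOn_exp_sommerfeld (C : ℝ) {c : ℝ} (hc : 0 < c) :
    IntegrableOn (fun x : ℝ × ℝ => C * Real.exp (-c * x.1))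
      (Ioi (0 : ℝ) ×ˢ Ioc (0 : ℝ) (2 * Real.pi)) := by
  rw [IntegrableOn, Measure.volume_eq_prod, ← Measure.prod_restrict]
  have h := ((exp_neg_integrableOn_Ioi 0 hc).const_mul C)
  simpa using h.mul_prod (integrable_const (μ := volume.restrict (Ioc 0 (2 * Real.pi))) (1 : ℝ))

/-- A bounded continuous integrand with exponential decay gives a convergent integral. -/
theorem sommerfeldConvergent_of_bound {g : ℝ → ℝ → ℂ}
    (hg : ContinuousOn (Function.uncurry g) (Ioi 0 ×ˢ univ)) {C c : ℝ} (hc : 0 < c)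
    (hb : ∀ κ, 0 < κ → ∀ α, ‖g κ α‖ ≤ C * Real.exp (-c * κ)) : SommerfeldConvergent g := by
  have hm : MeasurableSet (Ioi (0 : ℝ) ×ˢ Ioc (0 : ℝ) (2 * Real.pi)) :=
    measurableSet_Ioi.prod measurableSet_Ioc
  refine Integrable.mono' (integrableOn_exp_sommerfeld C hc) ?_ ?_
  · exact (hg.mono (prod_mono_right (subset_univ _))).aestronglyMeasurable hm
  · filter_upwards [ae_restrict_mem hm] with x hx
    exact hb x.1 hx.1 x.2

theorem SommerfeldConvergent.integral_eq {g : ℝ → ℝ → ℂ} (hg : SommerfeldConvergent g) :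
    sommerfeldIntegral g =
      ∫ x in Ioi (0 : ℝ) ×ˢ Ioc (0 : ℝ) (2 * Real.pi), Function.uncurry g x := by
  rw [Measure.volume_eq_prod, setIntegral_prod _ (by rwa [← Measure.volume_eq_prod]),
    sommerfeldIntegral]
  simp only [intervalIntegral.integral_of_le Real.two_pi_pos.le, Function.uncurry_apply_pair]

theorem SommerfeldConvergent.integrableOn {g : ℝ → ℝ → ℂ} (hg : SommerfeldConvergent g) :
    IntegrableOn (fun κ => ∫ α in (0 : ℝ)..(2 * Real.pi), g κ α) (Ioi 0) := by
  rw [SommerfeldConvergent, IntegrableOn, Measure.volume_eq_prod, ← Measure.prod_restrict] at hg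
  simp only [intervalIntegral.integral_of_le Real.two_pi_pos.le]
  exact hg.integral_prod_left

theorem SommerfeldConvergent.congr {g h : ℝ → ℝ → ℂ} (hg : SommerfeldConvergent g)
    (e : ∀ κ, 0 < κ → ∀ α, g κ α = h κ α) : SommerfeldConvergent h :=
  IntegrableOn.congr_fun hg (fun x hx => e x.1 hx.1 x.2) (measurableSet_Ioi.prod measurableSet_Ioc)

theorem sommerfeldIntegral_congr {g h : ℝ → ℝ → ℂ} (e : ∀ κ, 0 < κ → ∀ α, g κ α = h κ α) :
    sommerfeldIntegral g = sommerfeldIntegral h :=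
  setIntegral_congr_fun measurableSet_Ioi fun κ hκ => by simp only [e κ hκ]

/-- A one-parameter family of convergent integrals, with uniform exponential decay, does not depend
on the parameter if it is driven by a divergence-free flow. -/
theorem sommerfeldIntegral_eq_of_flow {u Dκ Dα : ℝ → ℝ → ℝ → ℂ} {φ C c : ℝ} (hφ : 0 ≤ φ)
    (hc : 0 < c)
    (hu : ∀ t ∈ Icc 0 φ, ∀ κ, 0 < κ → ∀ α, HasDerivAt (fun t => u t κ α)
      (Complex.I * κ * Real.cos α * Dκ t κ α - Complex.I * Real.sin α * Dα t κ α) t)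
    (hκ : ∀ t ∈ Icc 0 φ, ∀ κ, 0 < κ → ∀ α, HasDerivAt (fun κ => u t κ α) (Dκ t κ α) κ)
    (hα : ∀ t ∈ Icc 0 φ, ∀ κ, 0 < κ → ∀ α, HasDerivAt (fun α => u t κ α) (Dα t κ α) α)
    (hu0 : ContinuousOn (fun x : ℝ × ℝ × ℝ => u x.1 x.2.1 x.2.2) (Icc 0 φ ×ˢ Ioi 0 ×ˢ univ))
    (hκ0 : ContinuousOn (fun x : ℝ × ℝ × ℝ => Dκ x.1 x.2.1 x.2.2) (Icc 0 φ ×ˢ Ioi 0 ×ˢ univ))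
    (hα0 : ContinuousOn (fun x : ℝ × ℝ × ℝ => Dα x.1 x.2.1 x.2.2) (Icc 0 φ ×ˢ Ioi 0 ×ˢ univ))
    (hb : ∀ t ∈ Icc 0 φ, ∀ κ, 0 < κ → ∀ α, ‖u t κ α‖ ≤ C * Real.exp (-c * κ)) :
    sommerfeldIntegral (u φ) = sommerfeldIntegral (u 0) := by
  have conv : ∀ t ∈ Icc 0 φ, SommerfeldConvergent (u t) := by
    intro t ht
    refine sommerfeldConvergent_of_bound ?_ hc (hb t ht)
    exact hu0.comp (f := fun x : ℝ × ℝ => (t, x.1, x.2)) (by fun_prop) fun x hx => ⟨ht, hx.1, hx.2⟩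
  have h0 : (0 : ℝ) ∈ Icc 0 φ := ⟨le_rfl, hφ⟩
  have h1 : φ ∈ Icc 0 φ := ⟨hφ, le_rfl⟩
  have hC : 0 ≤ C := by
    have := (norm_nonneg _).trans (hb 0 h0 1 one_pos 0)
    exact nonneg_of_mul_nonneg_left this (Real.exp_pos _)
  have ii : ∀ t ∈ Icc 0 φ, ∀ κ, 0 < κ →
      IntervalIntegrable (u t κ) volume 0 (2 * Real.pi) := by
    intro t ht κ hκ'
    refine Continuous.intervalIntegrable ?_ _ _
    exact continuous_iff_continuousAt.mpr fun α => (hα t ht κ hκ' α).continuousAt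
  set H : ℝ → ℂ := fun κ => ∫ α in Ioc 0 (2 * Real.pi), (u φ κ α - u 0 κ α)
  have hHeq : ∀ κ ∈ Ioi (0 : ℝ), (∫ α in (0 : ℝ)..(2 * Real.pi), u φ κ α) -
      (∫ α in (0 : ℝ)..(2 * Real.pi), u 0 κ α) = H κ := by
    intro κ hκ'
    rw [← intervalIntegral.integral_sub (ii φ h1 κ hκ') (ii 0 h0 κ hκ'),
      intervalIntegral.integral_of_le Real.two_pi_pos.le]
  have hHi : IntegrableOn H (Ioi 0) :=
    IntegrableOn.congr_fun ((conv φ h1).integrableOn.sub (conv 0 h0).integrableOn) hHeq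
      measurableSet_Ioi
  rw [← sub_eq_zero, sommerfeldIntegral, sommerfeldIntegral,
    ← integral_sub (conv φ h1).integrableOn (conv 0 h0).integrableOn,
    setIntegral_congr_fun measurableSet_Ioi hHeq]
  -- Exhaustion of the half-line by compact pieces away from `κ = 0`, since nothing is assumed there
  -- beyond boundedness of the integrand.
  set s : ℕ → Set ℝ := fun n => Ioc (1 / ((n : ℝ) + 1)) ((n : ℝ) + 1)
  have hs : ⋃ n, s n = Ioi 0 := by
    ext x
    simp only [mem_iUnion, mem_Ioi, s, mem_Ioc]
    constructor
    · rintro ⟨n, hn, -⟩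
      exact lt_trans (by positivity) hn
    · intro hx
      obtain ⟨n, hn⟩ := exists_nat_gt (max x x⁻¹)
      have hn1 := (le_max_left _ _).trans_lt hn
      have hn2 := (le_max_right _ _).trans_lt hn
      refine ⟨n, ?_, by linarith⟩
      rw [one_div]
      exact inv_lt_of_inv_lt₀ hx (by linarith)
  have hmono : Monotone s := by
    intro m n hmn
    have : (m : ℝ) ≤ n := by exact_mod_cast hmn
    exact Ioc_subset_Ioc (by gcongr) (by gcongr)
  have lim1 : Tendsto (fun n => ∫ κ in s n, H κ) atTop (𝓝 (∫ κ in Ioi 0, H κ)) := by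
    have := tendsto_setIntegral_of_monotone (μ := volume) (f := H)
      (fun n => (measurableSet_Ioc : MeasurableSet (s n))) hmono (by rw [hs]; exact hHi)
    rwa [hs] at this
  have bnd : ∀ n : ℕ, ‖∫ κ in s n, H κ‖ ≤
      (C * (((n : ℝ) + 1) * Real.exp (-c * ((n : ℝ) + 1))) + C * (1 / ((n : ℝ) + 1))) *
        (φ * (2 * Real.pi)) := by
    intro n
    have hn : (0 : ℝ) < (n : ℝ) + 1 := by positivity
    have hn' : (0 : ℝ) < 1 / ((n : ℝ) + 1) := by positivity
    have sub : Icc 0 φ ×ˢ Icc (1 / ((n : ℝ) + 1)) ((n : ℝ) + 1) ×ˢ Icc 0 (2 * Real.pi) ⊆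
        Icc 0 φ ×ˢ Ioi 0 ×ˢ univ :=
      prod_mono_right (prod_mono (fun x hx => hn'.trans_le hx.1) (subset_univ _))
    -- The field `i κ cos α ∂_κ - i sin α ∂_α` has divergence `i cos α - i cos α = 0`, so the flow
    -- equation is in conservation form. The radial flux `i κ cos α u` tends to zero as `κ → 0`
    -- through the factor `κ`, and as `κ → ∞` through the exponential decay.
    refine norm_integral_sub_le_of_flux
      (P := fun t κ α => Complex.I * κ * Real.cos α * u t κ α)
      (Q := fun t κ α => -(Complex.I * Real.sin α * u t κ α))
      (D₁ := fun t κ α => Complex.I * κ * Real.cos α * Dκ t κ α + Complex.I * Real.cos α * u t κ α)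
      (D₂ := fun t κ α =>
        -(Complex.I * Real.sin α * Dα t κ α + Complex.I * Real.cos α * u t κ α))
      hφ ?_ Real.two_pi_pos.le ?_ ?_ ?_ ?_ ?_ ?_ ?_
    · rw [div_le_iff₀ hn]
      have : (0 : ℝ) ≤ n := n.cast_nonneg
      nlinarith
    · intro t ht κ hκ' α _
      convert hu t ht κ (hn'.trans_le hκ'.1) α using 1
      ring
    · intro t ht κ hκ' α _
      have h := ((((hasDerivAt_id κ).ofReal_comp).const_mul Complex.I).mul_const
        (Real.cos α : ℂ)).mul (hκ t ht κ (hn'.trans_le hκ'.1) α)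
      refine h.congr_deriv ?_
      simp only [id, Complex.ofReal_one]
      ring
    · intro t ht κ hκ' α _
      have h := ((((Real.hasDerivAt_sin α).ofReal_comp).const_mul Complex.I).mul
        (hα t ht κ (hn'.trans_le hκ'.1) α)).neg
      refine h.congr_deriv ?_
      ring
    · intro t κ; simp
    · have c1 := hκ0.mono sub
      have c2 := hu0.mono sub
      fun_prop
    · have c1 := hα0.mono sub
      have c2 := hu0.mono sub
      fun_prop
    · intro t ht α _
      have e : ∀ κ, 0 < κ → ‖Complex.I * κ * Real.cos α * u t κ α‖ ≤
          κ * (C * Real.exp (-c * κ)) := by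
        intro κ hκ'
        rw [norm_mul, norm_mul, norm_mul, Complex.norm_I, one_mul, Complex.norm_real,
          Complex.norm_real, Real.norm_eq_abs, Real.norm_eq_abs, abs_of_pos hκ']
        have h1 := hb t ht κ hκ' α
        have h2 := Real.abs_cos_le_one α
        calc κ * |Real.cos α| * ‖u t κ α‖ ≤ κ * 1 * (C * Real.exp (-c * κ)) := by gcongr
          _ = _ := by ring
      refine (norm_sub_le _ _).trans (add_le_add ((e _ hn).trans (le_of_eq (by ring)))
        ((e _ hn').trans ?_))
      have : Real.exp (-c * (1 / ((n : ℝ) + 1))) ≤ 1 := by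
        rw [Real.exp_le_one_iff]
        have := mul_pos hc hn'
        linarith
      calc 1 / ((n : ℝ) + 1) * (C * Real.exp (-c * (1 / ((n : ℝ) + 1))))
          ≤ 1 / ((n : ℝ) + 1) * (C * 1) := by gcongr
        _ = _ := by ring
  have lim2 : Tendsto (fun n : ℕ => (C * (((n : ℝ) + 1) * Real.exp (-c * ((n : ℝ) + 1))) +
      C * (1 / ((n : ℝ) + 1))) * (φ * (2 * Real.pi))) atTop (𝓝 0) := by
    have t1 : Tendsto (fun x : ℝ => x * Real.exp (-c * x)) atTop (𝓝 0) := by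
      have h := ((Real.tendsto_pow_mul_exp_neg_atTop_nhds_zero 1).comp
        (tendsto_id.const_mul_atTop hc)).const_mul c⁻¹
      rw [mul_zero] at h
      refine h.congr fun x => ?_
      simp only [Function.comp_apply, id, pow_one, neg_mul]
      field_simp
    have t2 : Tendsto (fun n : ℕ => (n : ℝ) + 1) atTop atTop :=
      tendsto_atTop_add_const_right _ _ tendsto_natCast_atTop_atTop
    have t3 := tendsto_one_div_add_atTop_nhds_zero_nat (𝕜 := ℝ)
    simpa using ((((t1.comp t2).const_mul C).add (t3.const_mul C)).mul_const (φ * (2 * Real.pi)))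
  exact tendsto_nhds_unique lim1 (squeeze_zero_norm bnd lim2)

/-! ### Rotation of the null cone into complex directions. -/

/-- The half-space `Re k > 0` of complex wave vectors `(k_x, k_y, k)`. -/
def waveDomain : Set (ℂ × ℂ × ℂ) := {z | 0 < z.2.2.re}

theorem isOpen_waveDomain : IsOpen waveDomain :=
  isOpen_lt continuous_const (Complex.continuous_re.comp (continuous_snd.comp continuous_snd))

/-- Rotation by the angle `β` in the lateral plane. -/
noncomputable def lateralRotation (β : ℝ) (p q k : ℂ) : ℂ × ℂ × ℂ :=
  (p * Real.cos β - q * Real.sin β, p * Real.sin β + q * Real.cos β, k)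

/-- The cone of real null wave vectors, rotated by an imaginary angle `t` about a horizontal axis
and by the angle `β` about the vertical one. -/
noncomputable def waveContour (β t κ α : ℝ) : ℂ × ℂ × ℂ :=
  lateralRotation β (κ * (Real.cos α * Real.cos t + Complex.I * Real.sin t)) (κ * Real.sin α)
    (κ * (Real.cos t + Complex.I * (Real.sin t * Real.cos α)))

/-- The real null cone. -/
noncomputable def realWave (κ α : ℝ) : ℂ × ℂ × ℂ := (κ * Real.cos α, κ * Real.sin α, κ)

theorem waveContour_zero (β κ α : ℝ) : waveContour β 0 κ α = realWave κ (α + β) := by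
  simp only [waveContour, lateralRotation, realWave, Real.cos_add, Real.sin_add, Real.cos_zero,
    Real.sin_zero]
  push_cast
  refine Prod.ext ?_ (Prod.ext ?_ ?_) <;> simp <;> ring

theorem waveContour_re (β t κ α : ℝ) : (waveContour β t κ α).2.2.re = κ * Real.cos t := by
  simp only [waveContour, lateralRotation]
  simp only [Complex.re_ofReal_mul, Complex.add_re, Complex.ofReal_re, Complex.I_mul_re,
    ← Complex.ofReal_mul, Complex.ofReal_im]
  ring

theorem norm_cos_mul_cos_add_le (a t : ℝ) :
    ‖(Real.cos a * Real.cos t + Complex.I * Real.sin t : ℂ)‖ ≤ 1 := by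
  rw [← sq_le_one_iff₀ (norm_nonneg _), ← Complex.normSq_eq_norm_sq, mul_comm Complex.I,
    ← Complex.ofReal_mul, Complex.normSq_add_mul_I]
  nlinarith [Real.sin_sq_add_cos_sq a, Real.sin_sq_add_cos_sq t, sq_nonneg (Real.sin a),
    sq_nonneg (Real.cos t), mul_nonneg (sq_nonneg (Real.sin a)) (sq_nonneg (Real.cos t))]

theorem norm_waveContour_le (β t α : ℝ) {κ : ℝ} (hκ : 0 ≤ κ) : ‖waveContour β t κ α‖ ≤ 2 * κ := by
  have hp : ‖(κ * (Real.cos α * Real.cos t + Complex.I * Real.sin t) : ℂ)‖ ≤ κ := by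
    rw [norm_mul, Complex.norm_real, Real.norm_eq_abs, abs_of_nonneg hκ]
    exact mul_le_of_le_one_right hκ (norm_cos_mul_cos_add_le α t)
  have hq : ‖(κ * Real.sin α : ℂ)‖ ≤ κ := by
    rw [norm_mul, Complex.norm_real, Real.norm_eq_abs, abs_of_nonneg hκ, Complex.norm_real]
    exact mul_le_of_le_one_right hκ (Real.abs_sin_le_one α)
  have hk : ‖(κ * (Real.cos t + Complex.I * (Real.sin t * Real.cos α)) : ℂ)‖ ≤ κ := by
    rw [norm_mul, Complex.norm_real, Real.norm_eq_abs, abs_of_nonneg hκ]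
    refine mul_le_of_le_one_right hκ ?_
    rw [← sq_le_one_iff₀ (norm_nonneg _), ← Complex.normSq_eq_norm_sq, mul_comm Complex.I,
      ← Complex.ofReal_mul, Complex.normSq_add_mul_I]
    nlinarith [Real.sin_sq_add_cos_sq α, Real.sin_sq_add_cos_sq t, sq_nonneg (Real.sin α),
      sq_nonneg (Real.cos t), mul_nonneg (sq_nonneg (Real.sin α)) (sq_nonneg (Real.sin t))]
  have hcs : ∀ (x : ℂ) (c : ℝ), |c| ≤ 1 → ‖x‖ ≤ κ → ‖x * c‖ ≤ κ := by
    intro x c hc hx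
    rw [norm_mul, Complex.norm_real, Real.norm_eq_abs]
    exact (mul_le_of_le_one_right (norm_nonneg _) hc).trans hx
  simp only [waveContour, lateralRotation, Prod.norm_def]
  refine max_le ?_ (max_le ?_ (by linarith))
  · refine (norm_sub_le _ _).trans ?_
    linarith [hcs _ _ (Real.abs_cos_le_one β) hp, hcs _ _ (Real.abs_sin_le_one β) hq]
  · refine (norm_add_le _ _).trans ?_
    linarith [hcs _ _ (Real.abs_sin_le_one β) hp, hcs _ _ (Real.abs_cos_le_one β) hq]

/-- The derivative of `waveContour` in `α`. -/
noncomputable def waveContourDeriv (β t κ α : ℝ) : ℂ × ℂ × ℂ :=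
  lateralRotation β (κ * (-Real.sin α * Real.cos t)) (κ * Real.cos α)
    (κ * (Complex.I * (Real.sin t * -Real.sin α)))

theorem hasDerivAt_lateralRotation {β : ℝ} {p q k : ℝ → ℂ} {p' q' k' : ℂ} {x : ℝ}
    (hp : HasDerivAt p p' x) (hq : HasDerivAt q q' x) (hk : HasDerivAt k k' x) :
    HasDerivAt (fun x => lateralRotation β (p x) (q x) (k x)) (lateralRotation β p' q' k') x :=
  ((hp.mul_const _).sub (hq.mul_const _)).prodMk
    (((hp.mul_const _).add (hq.mul_const _)).prodMk hk)

theorem hasDerivAt_waveContour_radius (β t κ α : ℝ) :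
    HasDerivAt (fun κ => waveContour β t κ α) (waveContour β t 1 α) κ := by
  have h : ∀ c : ℂ, HasDerivAt (fun κ : ℝ => (κ : ℂ) * c) ((1 : ℝ) * c) κ := fun c =>
    ((hasDerivAt_id κ).ofReal_comp).mul_const c
  exact hasDerivAt_lateralRotation (h _) (h _) (h _)

theorem hasDerivAt_waveContour_angle (β t κ α : ℝ) :
    HasDerivAt (fun α => waveContour β t κ α) (waveContourDeriv β t κ α) α := by
  have hc := (Real.hasDerivAt_cos α).ofReal_comp
  have hs := (Real.hasDerivAt_sin α).ofReal_comp
  rw [Complex.ofReal_neg] at hc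
  exact hasDerivAt_lateralRotation (((hc.mul_const _).add_const _).const_mul _)
    (hs.const_mul _) ((((hc.const_mul _).const_mul _).const_add _).const_mul _)

/-- The imaginary rotations preserve the complex null cone, so their generator is tangent to it and
combines the two parameter derivatives. The coefficients found here form the divergence-free field
required by `sommerfeldIntegral_eq_of_flow`. -/
theorem hasDerivAt_waveContour_boost (β t κ α : ℝ) :
    HasDerivAt (fun t => waveContour β t κ α)
      ((Complex.I * κ * Real.cos α : ℂ) • waveContour β t 1 α -
        (Complex.I * Real.sin α : ℂ) • waveContourDeriv β t κ α) t := by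
  have hc := (Real.hasDerivAt_cos t).ofReal_comp
  have hs := (Real.hasDerivAt_sin t).ofReal_comp
  rw [Complex.ofReal_neg] at hc
  have h := hasDerivAt_lateralRotation (β := β)
    (((hc.const_mul (Real.cos α : ℂ)).add (hs.const_mul Complex.I)).const_mul (κ : ℂ))
    (hasDerivAt_const t (κ * Real.sin α : ℂ))
    ((hc.add ((hs.mul_const (Real.cos α : ℂ)).const_mul Complex.I)).const_mul (κ : ℂ))
  refine h.congr_deriv ?_
  have h1 : (Real.sin α : ℂ) ^ 2 + (Real.cos α : ℂ) ^ 2 = 1 := by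
    exact_mod_cast Real.sin_sq_add_cos_sq α
  have h2 := Complex.I_sq
  simp only [waveContour, waveContourDeriv, lateralRotation]
  generalize (Real.cos α : ℂ) = ca at *
  generalize (Real.sin α : ℂ) = sa at *
  generalize (Real.cos t : ℂ) = ct at *
  generalize (Real.sin t : ℂ) = st at *
  generalize (Real.cos β : ℂ) = cb at *
  generalize (Real.sin β : ℂ) = sb at *
  generalize (κ : ℂ) = x at *
  refine Prod.ext ?_ (Prod.ext ?_ ?_) <;>
    simp only [Prod.smul_mk, Prod.mk_sub_mk, smul_eq_mul, Complex.ofReal_one]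
  · linear_combination (-x * ca * st * cb) * h2 - Complex.I * x * ct * cb * h1
  · linear_combination (-x * ca * st * sb) * h2 - Complex.I * x * ct * sb * h1
  · linear_combination (-x * st * (ca ^ 2 + sa ^ 2)) * h2 + x * st * h1

/-- Cauchy's theorem in this setting: the flow carries the rotated cone back to `t = 0` inside `Re k
> 0`. Uniform decay along the whole way is essential, holomorphy alone is not enough. -/
theorem sommerfeldIntegral_waveContour {G : ℂ × ℂ × ℂ → ℂ} (hG : ContDiffOn ℂ 1 G waveDomain)
    (β : ℝ) {φ C c : ℝ} (hφ : 0 ≤ φ) (hφ' : φ < Real.pi / 2) (hc : 0 < c)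
    (hb : ∀ t ∈ Icc 0 φ, ∀ κ, 0 < κ → ∀ α, ‖G (waveContour β t κ α)‖ ≤ C * Real.exp (-c * κ)) :
    sommerfeldIntegral (fun κ α => G (waveContour β φ κ α)) =
      sommerfeldIntegral (fun κ α => G (realWave κ α)) := by
  have hcos : ∀ t ∈ Icc 0 φ, 0 < Real.cos t := fun t ht =>
    Real.cos_pos_of_mem_Ioo ⟨by linarith [ht.1, Real.pi_pos], by linarith [ht.2]⟩
  have hmem : ∀ t ∈ Icc 0 φ, ∀ κ, 0 < κ → ∀ α, waveContour β t κ α ∈ waveDomain := by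
    intro t ht κ hκ α
    rw [waveDomain, mem_ofPred_eq, waveContour_re]
    exact mul_pos hκ (hcos t ht)
  have hdiff : ∀ t ∈ Icc 0 φ, ∀ κ, 0 < κ → ∀ α, HasFDerivAt G
      ((fderiv ℂ G (waveContour β t κ α)).restrictScalars ℝ) (waveContour β t κ α) := by
    intro t ht κ hκ α
    exact (((hG.differentiableOn one_ne_zero).differentiableAt
      (isOpen_waveDomain.mem_nhds (hmem t ht κ hκ α))).hasFDerivAt).restrictScalars ℝ
  have hcont : Continuous fun x : ℝ × ℝ × ℝ => waveContour β x.1 x.2.1 x.2.2 := by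
    unfold waveContour lateralRotation; fun_prop
  have hmaps : MapsTo (fun x : ℝ × ℝ × ℝ => waveContour β x.1 x.2.1 x.2.2)
      (Icc 0 φ ×ˢ Ioi 0 ×ˢ univ) waveDomain := fun x hx => hmem _ hx.1 _ hx.2.1 _
  have hf : ContinuousOn (fun x : ℝ × ℝ × ℝ => fderiv ℂ G (waveContour β x.1 x.2.1 x.2.2))
      (Icc 0 φ ×ˢ Ioi 0 ×ˢ univ) :=
    (hG.continuousOn_fderiv_of_isOpen isOpen_waveDomain le_rfl).comp hcont.continuousOn hmaps
  have flow := sommerfeldIntegral_eq_of_flow (u := fun t κ α => G (waveContour β t κ α))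
    (Dκ := fun t κ α => fderiv ℂ G (waveContour β t κ α) (waveContour β t 1 α))
    (Dα := fun t κ α => fderiv ℂ G (waveContour β t κ α) (waveContourDeriv β t κ α)) hφ hc
    (fun t ht κ hκ α => by
      have h := (hdiff t ht κ hκ α).comp_hasDerivAt t (hasDerivAt_waveContour_boost β t κ α)
      refine h.congr_deriv ?_
      rw [ContinuousLinearMap.coe_restrictScalars', map_sub, map_smul, map_smul]
      rfl)
    (fun t ht κ hκ α => by
      exact (hdiff t ht κ hκ α).comp_hasDerivAt κ (hasDerivAt_waveContour_radius β t κ α))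
    (fun t ht κ hκ α => by
      exact (hdiff t ht κ hκ α).comp_hasDerivAt α (hasDerivAt_waveContour_angle β t κ α))
    (hG.continuousOn.comp hcont.continuousOn hmaps)
    (hf.clm_apply (Continuous.continuousOn (by unfold waveContour lateralRotation; fun_prop)))
    (hf.clm_apply (Continuous.continuousOn (by unfold waveContourDeriv lateralRotation; fun_prop)))
    hb
  refine flow.trans ?_
  simp only [waveContour_zero, sommerfeldIntegral]
  refine setIntegral_congr_fun measurableSet_Ioi fun κ _ => ?_
  -- At `t = 0` the lateral rotation `β` is only a translation of `α`.
  have hper : Function.Periodic (fun α => G (realWave κ α)) (2 * Real.pi) := by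
    intro α
    simp only [realWave, Real.cos_add_two_pi, Real.sin_add_two_pi]
  have h1 := intervalIntegral.integral_comp_add_right (a := 0) (b := 2 * Real.pi)
    (fun α => G (realWave κ α)) β
  simp only [zero_add] at h1
  refine h1.trans ?_
  rw [add_comm (2 * Real.pi) β, hper.intervalIntegral_add_eq β 0, zero_add]

/-! ### Amplitudes and plane waves on rotated contours. -/

/-- Holomorphic functions on `Re k > 0` that grow slower than any exponential on cones. -/
def IsAmplitude (Φ : ℂ × ℂ × ℂ → ℂ) : Prop :=
  ContDiffOn ℂ 1 Φ waveDomain ∧ ∀ c > 0, ∀ ε > 0, ∃ C : ℝ, ∀ z : ℂ × ℂ × ℂ, 0 < z.2.2.re →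
    c * ‖z‖ ≤ z.2.2.re → ‖Φ z‖ ≤ C * Real.exp (ε * ‖z‖)

theorem le_mul_exp {ε x : ℝ} (hε : 0 < ε) : x ≤ 1 / ε * Real.exp (ε * x) := by
  rw [one_div, inv_mul_eq_div, le_div_iff₀ hε]
  linarith [Real.add_one_le_exp (ε * x)]

namespace IsAmplitude

theorem of_affine_bound {Φ : ℂ × ℂ × ℂ → ℂ} (h : ContDiffOn ℂ 1 Φ waveDomain)
    (hb : ∀ c > 0, ∃ A ≥ 0, ∀ z : ℂ × ℂ × ℂ, 0 < z.2.2.re → c * ‖z‖ ≤ z.2.2.re →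
      ‖Φ z‖ ≤ A + ‖z‖) : IsAmplitude Φ := by
  refine ⟨h, fun c hc ε hε => ?_⟩
  obtain ⟨A, hA, hz⟩ := hb c hc
  refine ⟨A + 1 / ε, fun z h1 h2 => (hz z h1 h2).trans ?_⟩
  have e1 : 1 ≤ Real.exp (ε * ‖z‖) := Real.one_le_exp (by positivity)
  have e2 := le_mul_exp (x := ‖z‖) hε
  nlinarith

theorem const (a : ℂ) : IsAmplitude fun _ => a :=
  of_affine_bound contDiffOn_const fun c _ => ⟨‖a‖, norm_nonneg a, fun z _ _ => by
    linarith [norm_nonneg z]⟩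

theorem fst : IsAmplitude fun z => z.1 :=
  of_affine_bound contDiff_fst.contDiffOn fun _ _ => ⟨0, le_rfl, fun z _ _ => by
    simpa using norm_fst_le z⟩

theorem snd_fst : IsAmplitude fun z => z.2.1 :=
  of_affine_bound (contDiff_fst.comp contDiff_snd).contDiffOn fun _ _ => ⟨0, le_rfl, fun z _ _ => by
    simpa using (norm_fst_le z.2).trans (norm_snd_le z)⟩

/-- Functions of the radial wave number alone. -/
theorem of_radial {f : ℂ → ℂ} (hf : ∀ k : ℂ, 0 < k.re → DifferentiableAt ℂ f k)
    (hb : ∀ c > 0, ∃ A ≥ 0, ∀ k : ℂ, 0 < k.re → c * ‖k‖ ≤ k.re → ‖f k‖ ≤ A + ‖k‖) :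
    IsAmplitude fun z => f z.2.2 := by
  have hd : DifferentiableOn ℂ f {k : ℂ | 0 < k.re} := fun k hk =>
    (hf k hk).differentiableWithinAt
  have ho : IsOpen {k : ℂ | 0 < k.re} := isOpen_lt continuous_const Complex.continuous_re
  refine of_affine_bound ((hd.contDiffOn ho).comp
    (contDiff_snd.comp contDiff_snd).contDiffOn fun z hz => hz) fun c hc => ?_
  obtain ⟨A, hA, h⟩ := hb c hc
  have hle : ∀ z : ℂ × ℂ × ℂ, ‖z.2.2‖ ≤ ‖z‖ := fun z => (norm_snd_le z.2).trans (norm_snd_le z)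
  refine ⟨A, hA, fun z h1 h2 => (h z.2.2 h1 ?_).trans (by linarith [hle z])⟩
  exact (mul_le_mul_of_nonneg_left (hle z) (le_of_lt hc)).trans h2

theorem complexRoot {lam : ℝ} (hl : 0 ≤ lam) : IsAmplitude fun z => complexRoot lam z.2.2 :=
  of_radial (fun _ hk => complexRoot.differentiableAt lam hk) fun _ _ =>
    ⟨lam, hl, fun _ hk _ => complexRoot.norm_le hl hk⟩

theorem add {Φ Ψ : ℂ × ℂ × ℂ → ℂ} (hΦ : IsAmplitude Φ) (hΨ : IsAmplitude Ψ) :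
    IsAmplitude fun z => Φ z + Ψ z := by
  refine ⟨hΦ.1.add hΨ.1, fun c hc ε hε => ?_⟩
  obtain ⟨C₁, h₁⟩ := hΦ.2 c hc ε hε
  obtain ⟨C₂, h₂⟩ := hΨ.2 c hc ε hε
  refine ⟨C₁ + C₂, fun z hz hcz => (norm_add_le _ _).trans ?_⟩
  rw [add_mul]
  exact add_le_add (h₁ z hz hcz) (h₂ z hz hcz)

theorem mul {Φ Ψ : ℂ × ℂ × ℂ → ℂ} (hΦ : IsAmplitude Φ) (hΨ : IsAmplitude Ψ) :
    IsAmplitude fun z => Φ z * Ψ z := by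
  refine ⟨hΦ.1.mul hΨ.1, fun c hc ε hε => ?_⟩
  obtain ⟨C₁, h₁⟩ := hΦ.2 c hc (ε / 2) (half_pos hε)
  obtain ⟨C₂, h₂⟩ := hΨ.2 c hc (ε / 2) (half_pos hε)
  refine ⟨C₁ * C₂, fun z hz hcz => ?_⟩
  rw [norm_mul]
  have e : Real.exp (ε * ‖z‖) = Real.exp (ε / 2 * ‖z‖) * Real.exp (ε / 2 * ‖z‖) := by
    rw [← Real.exp_add]; ring_nf
  rw [e, mul_mul_mul_comm]
  exact mul_le_mul (h₁ z hz hcz) (h₂ z hz hcz) (norm_nonneg _)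
    ((norm_nonneg _).trans (h₁ z hz hcz))

theorem pow {Φ : ℂ × ℂ × ℂ → ℂ} (hΦ : IsAmplitude Φ) (n : ℕ) : IsAmplitude fun z => Φ z ^ n := by
  induction n with
  | zero => simpa using const 1
  | succ n ih => simpa only [pow_succ] using ih.mul hΦ

theorem eval {Φ : ℂ × ℂ × ℂ → ℂ} (hΦ : IsAmplitude Φ) (p : Polynomial ℂ) :
    IsAmplitude fun z => p.eval (Φ z) := by
  induction p using Polynomial.induction_on' with
  | add p q hp hq => simpa only [Polynomial.eval_add] using hp.add hq
  | monomial n a =>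
    simpa only [Polynomial.eval_monomial] using (const a).mul (hΦ.pow n)

end IsAmplitude

/-- The exponential `exp (i (k_x X + k_y Y) - k D)`. -/
noncomputable def wavePhase (X Y D : ℝ) (z : ℂ × ℂ × ℂ) : ℂ :=
  Complex.exp (Complex.I * (z.1 * X + z.2.1 * Y) - z.2.2 * D)

theorem contDiff_wavePhase (X Y D : ℝ) : ContDiff ℂ 1 (wavePhase X Y D) := by
  unfold wavePhase
  fun_prop

/-- On the contour neither `Im k_x`, `Im k_y` nor `Re k` depends on `α`. When `β` and `t` are the
spherical angles of `(X, Y, D)`, the rate is the full length of this vector; at `t = 0` it is only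
`D`. -/
theorem norm_wavePhase_waveContour (X Y D β t κ α : ℝ) :
    ‖wavePhase X Y D (waveContour β t κ α)‖ =
      Real.exp (-κ * ((X * Real.cos β + Y * Real.sin β) * Real.sin t + D * Real.cos t)) := by
  rw [wavePhase, Complex.norm_exp]
  congr 1
  rw [Complex.sub_re, Complex.re_mul_ofReal, waveContour_re, Complex.I_mul_re]
  simp only [waveContour, lateralRotation, Complex.add_im, Complex.sub_im, Complex.im_mul_ofReal,
    Complex.im_ofReal_mul, Complex.ofReal_im, Complex.I_im]
  ring

namespace IsAmplitude

theorem bound_waveContour {Φ : ℂ × ℂ × ℂ → ℂ} (hΦ : IsAmplitude Φ) {φ : ℝ}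
    (hφ' : φ < Real.pi / 2) {ε : ℝ} (hε : 0 < ε) : ∃ C : ℝ, ∀ β, ∀ t ∈ Icc 0 φ, ∀ κ, 0 < κ → ∀ α,
      ‖Φ (waveContour β t κ α)‖ ≤ C * Real.exp (ε * κ) := by
  rcases lt_or_ge φ 0 with h | hφ
  · exact ⟨0, fun β t ht => absurd (ht.1.trans ht.2) (not_le.mpr h)⟩
  have hcos : 0 < Real.cos φ :=
    Real.cos_pos_of_mem_Ioo ⟨by linarith [Real.pi_pos], by linarith⟩
  -- On the contour `Re k = κ cos t ≥ κ cos φ` while the wave vector has norm at most `2 κ`. This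
  -- fixes the opening of the cone and the halving of `ε`.
  obtain ⟨C, hC⟩ := hΦ.2 (Real.cos φ / 2) (half_pos hcos) (ε / 2) (half_pos hε)
  have key : ∀ β, ∀ t ∈ Icc 0 φ, ∀ κ, 0 < κ → ∀ α, ‖Φ (waveContour β t κ α)‖ ≤
      C * Real.exp (ε / 2 * ‖waveContour β t κ α‖) := by
    intro β t ht κ hκ α
    have h1 : Real.cos φ ≤ Real.cos t :=
      Real.cos_le_cos_of_nonneg_of_le_pi ht.1 (by linarith [Real.pi_pos]) ht.2
    have h2 := norm_waveContour_le β t α hκ.le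
    apply hC
    · rw [waveContour_re]; exact mul_pos hκ (hcos.trans_le h1)
    · rw [waveContour_re]; nlinarith
  have hC0 : 0 ≤ C := nonneg_of_mul_nonneg_left
    ((norm_nonneg _).trans (key 0 0 ⟨le_rfl, hφ⟩ 1 one_pos 0)) (Real.exp_pos _)
  refine ⟨C, fun β t ht κ hκ α => (key β t ht κ hκ α).trans ?_⟩
  have h2 := norm_waveContour_le β t α hκ.le
  exact mul_le_mul_of_nonneg_left (Real.exp_le_exp.mpr (by nlinarith)) hC0

/-- The decay rate is a combination of `sin t` and `cos t`, so on an interval shorter than `π/2` its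
positivity at both ends implies positivity in between. -/
theorem bound_wavePhase {Φ : ℂ × ℂ × ℂ → ℂ} (hΦ : IsAmplitude Φ) {X Y D β φ : ℝ} (hφ : 0 ≤ φ)
    (hφ' : φ < Real.pi / 2) (hD : 0 < D)
    (hR : 0 < (X * Real.cos β + Y * Real.sin β) * Real.sin φ + D * Real.cos φ) :
    ∃ C c : ℝ, 0 < c ∧ ∀ t ∈ Icc 0 φ, ∀ κ, 0 < κ → ∀ α,
      ‖Φ (waveContour β t κ α) * wavePhase X Y D (waveContour β t κ α)‖ ≤
        C * Real.exp (-c * κ) := by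
  set f : ℝ → ℝ := fun t => (X * Real.cos β + Y * Real.sin β) * Real.sin t + D * Real.cos t with hf
  have hpos : ∀ t ∈ Icc 0 φ, 0 < f t := by
    intro t ht
    rcases eq_or_lt_of_le hφ with h0 | h0
    · have : t = 0 := le_antisymm (ht.2.trans h0.ge) ht.1
      rw [this]
      simpa [hf] using hD
    · have hs : 0 < Real.sin φ := Real.sin_pos_of_pos_of_lt_pi h0 (by linarith [Real.pi_pos])
      have h1 : 0 ≤ Real.sin t := Real.sin_nonneg_of_nonneg_of_le_pi ht.1
        (by linarith [Real.pi_pos, ht.2])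
      -- Interpolation of `f` from its end values `f φ` and `f 0 = D`, with the nonnegative weights
      -- `sin t` and `sin (φ - t)`.
      have e : Real.sin φ * f t = Real.sin t *
          ((X * Real.cos β + Y * Real.sin β) * Real.sin φ + D * Real.cos φ) +
          D * Real.sin (φ - t) := by
        simp only [hf, Real.sin_sub]; ring
      have h2 : 0 ≤ Real.sin (φ - t) := Real.sin_nonneg_of_nonneg_of_le_pi (by linarith [ht.2])
        (by linarith [Real.pi_pos, ht.1])
      refine pos_of_mul_pos_right ?_ hs.le
      rw [e]
      rcases eq_or_lt_of_le ht.1 with h3 | h3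
      · rw [← h3]; simpa using mul_pos hD hs
      · have := Real.sin_pos_of_pos_of_lt_pi h3 (by linarith [Real.pi_pos, ht.2])
        have := mul_pos this hR
        have := mul_nonneg hD.le h2
        linarith
  -- Half of the minimal rate pays for the subexponential growth of the amplitude, the other half
  -- remains.
  obtain ⟨t₀, ht₀, hmin⟩ := isCompact_Icc.exists_isMinOn (s := Icc 0 φ) ⟨0, le_rfl, hφ⟩
    (f := f) (by fun_prop)
  have hm := hpos t₀ ht₀
  obtain ⟨C, hC⟩ := hΦ.bound_waveContour hφ' (half_pos hm)
  refine ⟨C, f t₀ / 2, half_pos hm, fun t ht κ hκ α => ?_⟩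
  have h1 := hC β t ht κ hκ α
  have h2 : f t₀ ≤ f t := hmin ht
  rw [norm_mul, norm_wavePhase_waveContour]
  have h3 : Real.exp (-κ * f t) ≤ Real.exp (-κ * f t₀) := Real.exp_le_exp.mpr (by nlinarith)
  calc _ ≤ C * Real.exp (f t₀ / 2 * κ) * Real.exp (-κ * f t₀) :=
        mul_le_mul h1 h3 (Real.exp_pos _).le ((norm_nonneg _).trans h1)
    _ = _ := by rw [mul_assoc, ← Real.exp_add]; ring_nf

theorem contDiffOn_wavePhase {Φ : ℂ × ℂ × ℂ → ℂ} (hΦ : IsAmplitude Φ) (X Y D : ℝ) :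
    ContDiffOn ℂ 1 (fun z => Φ z * wavePhase X Y D z) waveDomain :=
  hΦ.1.mul (contDiff_wavePhase X Y D).contDiffOn

theorem sommerfeldIntegral_waveContour {Φ : ℂ × ℂ × ℂ → ℂ} (hΦ : IsAmplitude Φ) {X Y D β φ : ℝ}
    (hφ : 0 ≤ φ) (hφ' : φ < Real.pi / 2) (hD : 0 < D)
    (hR : 0 < (X * Real.cos β + Y * Real.sin β) * Real.sin φ + D * Real.cos φ) :
    sommerfeldIntegral (fun κ α =>
      Φ (waveContour β φ κ α) * wavePhase X Y D (waveContour β φ κ α)) =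
    sommerfeldIntegral (fun κ α => Φ (realWave κ α) * wavePhase X Y D (realWave κ α)) := by
  obtain ⟨C, c, hc, hb⟩ := hΦ.bound_wavePhase hφ hφ' hD hR
  exact _root_.sommerfeldIntegral_waveContour (hΦ.contDiffOn_wavePhase X Y D) β hφ hφ' hc hb

theorem sommerfeldConvergent_waveContour {Φ : ℂ × ℂ × ℂ → ℂ} (hΦ : IsAmplitude Φ) {X Y D β φ : ℝ}
    (hφ : 0 ≤ φ) (hφ' : φ < Real.pi / 2) (hD : 0 < D)
    (hR : 0 < (X * Real.cos β + Y * Real.sin β) * Real.sin φ + D * Real.cos φ) :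
    SommerfeldConvergent (fun κ α =>
      Φ (waveContour β φ κ α) * wavePhase X Y D (waveContour β φ κ α)) := by
  obtain ⟨C, c, hc, hb⟩ := hΦ.bound_wavePhase hφ hφ' hD hR
  refine sommerfeldConvergent_of_bound ?_ hc (hb φ ⟨hφ, le_rfl⟩)
  have hcont : Continuous fun x : ℝ × ℝ => waveContour β φ x.1 x.2 := by
    unfold waveContour lateralRotation; fun_prop
  refine (hΦ.contDiffOn_wavePhase X Y D).continuousOn.comp hcont.continuousOn fun x hx => ?_
  rw [waveDomain, mem_ofPred_eq, waveContour_re]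
  exact mul_pos hx.1 (Real.cos_pos_of_mem_Ioo ⟨by linarith [Real.pi_pos], hφ'⟩)

theorem sommerfeldConvergent {Φ : ℂ × ℂ × ℂ → ℂ} (hΦ : IsAmplitude Φ) (X Y : ℝ) {D : ℝ}
    (hD : 0 < D) :
    SommerfeldConvergent (fun κ α => Φ (realWave κ α) * wavePhase X Y D (realWave κ α)) := by
  have h := hΦ.sommerfeldConvergent_waveContour (X := X) (Y := Y) (β := 0) le_rfl
    Real.pi_div_two_pos hD (by simpa using hD)
  simpa only [waveContour_zero, add_zero] using h

end IsAmplitude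

/-! ### The Legendre expansion under the integral in the full region. -/

/-- The cosine `(-i (k_x u₀ + k_y u₁) + λ_z u₂) / λ` between a complex wave vector and a direction. -/
noncomputable def waveCos (lam u₀ u₁ u₂ : ℝ) (z : ℂ × ℂ × ℂ) : ℂ :=
  (-Complex.I * (z.1 * u₀ + z.2.1 * u₁) + complexRoot lam z.2.2 * u₂) / lam

/-- With `λ_z` replaced by `k`, the numerator is `κ (A + i B)`, where `A` and `B` are components of
the unit vector `u` along two orthonormal directions. The replacement costs at most `λ`. -/
theorem norm_waveCos_waveContour_le {lam u₀ u₁ u₂ : ℝ} (hl : 0 < lam)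
    (hu : u₀ ^ 2 + u₁ ^ 2 + u₂ ^ 2 = 1) (β α : ℝ) {t κ : ℝ} (hκ : 0 < κ) (ht : 0 < Real.cos t) :
    ‖waveCos lam u₀ u₁ u₂ (waveContour β t κ α)‖ ≤ κ / lam + 1 := by
  set U : ℝ := u₀ * Real.cos β + u₁ * Real.sin β with hU
  set V : ℝ := -u₀ * Real.sin β + u₁ * Real.cos β with hV
  have hUV : U ^ 2 + V ^ 2 + u₂ ^ 2 = 1 := by
    have h := Real.sin_sq_add_cos_sq β
    simp only [hU, hV]
    linear_combination hu + (u₀ ^ 2 + u₁ ^ 2) * h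
  set k := (waveContour β t κ α).2.2 with hk
  have hkre : 0 < k.re := by rw [hk, waveContour_re]; exact mul_pos hκ ht
  set A : ℝ := Real.sin t * U + Real.cos t * u₂ with hA
  set B : ℝ := -Real.cos α * Real.cos t * U - Real.sin α * V + Real.sin t * Real.cos α * u₂ with hB
  have e : waveCos lam u₀ u₁ u₂ (waveContour β t κ α) =
      (κ * ((A : ℂ) + B * Complex.I) + (complexRoot lam k - k) * u₂) / lam := by
    rw [waveCos, ← hk]
    congr 1
    have : (κ : ℂ) * ((A : ℂ) + B * Complex.I) =
        -Complex.I * ((waveContour β t κ α).1 * u₀ + (waveContour β t κ α).2.1 * u₁) + k * u₂ := by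
      simp only [hk, hA, hB, hU, hV, waveContour, lateralRotation]
      push_cast
      have h2 := Complex.I_sq
      linear_combination (κ * Complex.sin t * (Complex.cos β * u₀ + Complex.sin β * u₁) : ℂ) * h2
    rw [this]
    ring
  have hAB : A ^ 2 + B ^ 2 ≤ 1 := by
    have h1 := Real.sin_sq_add_cos_sq α
    have h2 := Real.sin_sq_add_cos_sq t
    -- The third square is the component of `u` along the direction completing the orthonormal
    -- frame.
    have h3 : A ^ 2 + B ^ 2 +
        (Real.cos t * Real.sin α * U - Real.cos α * V - Real.sin t * Real.sin α * u₂) ^ 2 = 1 := by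
      simp only [hA, hB]
      rw [← hUV]
      linear_combination (V ^ 2 + (Real.cos t * U - Real.sin t * u₂) ^ 2) * h1 +
        (U ^ 2 + u₂ ^ 2) * h2
    nlinarith [sq_nonneg
      (Real.cos t * Real.sin α * U - Real.cos α * V - Real.sin t * Real.sin α * u₂)]
  have hn1 : ‖(κ : ℂ) * ((A : ℂ) + B * Complex.I)‖ ≤ κ := by
    rw [norm_mul, Complex.norm_real, Real.norm_eq_abs, abs_of_pos hκ]
    refine mul_le_of_le_one_right hκ.le ?_
    rwa [← sq_le_one_iff₀ (norm_nonneg _), ← Complex.normSq_eq_norm_sq, Complex.normSq_add_mul_I]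
  have hu2 : |u₂| ≤ 1 := by
    rw [← sq_le_one_iff_abs_le_one]
    nlinarith [sq_nonneg u₀, sq_nonneg u₁]
  have hn2 : ‖(complexRoot lam k - k) * u₂‖ ≤ lam := by
    rw [norm_mul, Complex.norm_real, Real.norm_eq_abs]
    exact (mul_le_of_le_one_right (norm_nonneg _) hu2).trans (complexRoot.norm_sub_le hl.le hkre)
  rw [e, norm_div, Complex.norm_real, Real.norm_eq_abs, abs_of_pos hl]
  calc _ ≤ (κ + lam) / lam := by
        gcongr
        exact (norm_add_le _ _).trans (add_le_add hn1 hn2)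
    _ = _ := by field_simp

namespace IsAmplitude

theorem waveCos {lam : ℝ} (hl : 0 ≤ lam) (u₀ u₁ u₂ : ℝ) : IsAmplitude (waveCos lam u₀ u₁ u₂) := by
  have h := (((const (-Complex.I)).mul ((fst.mul (const u₀)).add (snd_fst.mul (const u₁)))).add
    ((complexRoot hl).mul (const u₂))).mul (const (lam : ℂ)⁻¹)
  exact h

theorem legendreDeriv {Φ : ℂ × ℂ × ℂ → ℂ} (hΦ : IsAmplitude Φ) (n m : ℕ) :
    IsAmplitude fun z => SphericalFunctions.legendreDeriv n m (Φ z) :=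
  hΦ.eval _

theorem expLegendreTerm {Φ : ℂ × ℂ × ℂ → ℂ} (hΦ : IsAmplitude Φ) (n : ℕ) (x : ℝ) :
    IsAmplitude fun z => SphericalFunctions.expLegendreTerm n x (Φ z) :=
  (const _).mul (hΦ.legendreDeriv n 0)

/-- The factor `exp ((√(λ² + k²) - k) v)`. -/
theorem exp_root_sub {lam : ℝ} (hl : 0 ≤ lam) (v : ℝ) :
    IsAmplitude fun z => Complex.exp ((_root_.complexRoot lam z.2.2 - z.2.2) * v) := by
  refine of_radial (f := fun k => Complex.exp ((_root_.complexRoot lam k - k) * v))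
    (fun k hk => ?_) fun c _ => ⟨Real.exp (lam * |v|), (Real.exp_pos _).le, fun k hk _ => ?_⟩
  · have := complexRoot.differentiableAt lam hk
    fun_prop
  · refine (Complex.norm_exp_le_exp_norm _).trans ?_
    rw [norm_mul, Complex.norm_real, Real.norm_eq_abs]
    have h : Real.exp (‖_root_.complexRoot lam k - k‖ * |v|) ≤ Real.exp (lam * |v|) :=
      Real.exp_le_exp.mpr
        (mul_le_mul_of_nonneg_right (complexRoot.norm_sub_le hl hk) (abs_nonneg v))
    linarith [norm_nonneg k]

end IsAmplitude

/-- A screened plane wave is a harmonic one times a bounded amplitude, so the exponential translates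
`(X, Y, D)` by `-ρ u`. The limit of the series thus has the same form as its terms and can be moved
to the same contour. -/
theorem exp_waveCos_mul_wavePhase {lam ρ : ℝ} (hl : 0 < lam) (u₀ u₁ u₂ X Y D : ℝ)
    (z : ℂ × ℂ × ℂ) :
    Complex.exp ((lam * ρ : ℝ) * waveCos lam u₀ u₁ u₂ z) * wavePhase X Y D z =
      Complex.exp ((complexRoot lam z.2.2 - z.2.2) * (ρ * u₂ : ℝ)) *
        wavePhase (X - ρ * u₀) (Y - ρ * u₁) (D - ρ * u₂) z := by
  rw [waveCos, wavePhase, wavePhase, ← Complex.exp_add, ← Complex.exp_add]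
  congr 1
  have : (lam : ℂ) ≠ 0 := by exact_mod_cast hl.ne'
  push_cast
  field_simp
  ring

/-- The Sommerfeld integral of the expansion of a plane wave in Legendre functions converges in the
full region `ρ < |R|`. -/
theorem IsAmplitude.hasSum_expansion {Φ : ℂ × ℂ × ℂ → ℂ} (hΦ : IsAmplitude Φ)
    {lam ρ u₀ u₁ u₂ X Y D : ℝ} (hl : 0 < lam) (hu : u₀ ^ 2 + u₁ ^ 2 + u₂ ^ 2 = 1) (hρ : 0 ≤ ρ)
    (hD : 0 < D) (hDρ : ρ * u₂ < D) (hR : ρ ^ 2 < X ^ 2 + Y ^ 2 + D ^ 2) :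
    HasSum (fun n => sommerfeldIntegral fun κ α => Φ (realWave κ α) *
        SphericalFunctions.expLegendreTerm n (lam * ρ) (_root_.waveCos lam u₀ u₁ u₂ (realWave κ α)) *
        wavePhase X Y D (realWave κ α))
      (sommerfeldIntegral fun κ α => Φ (realWave κ α) *
        Complex.exp ((lam * ρ : ℝ) * _root_.waveCos lam u₀ u₁ u₂ (realWave κ α)) *
        wavePhase X Y D (realWave κ α)) := by
  set R : Space3 := !₂[X, Y, D] with hRdef
  have hR0 : R 0 = X := by simp [hRdef]
  have hR1 : R 1 = Y := by simp [hRdef]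
  have hR2 : R 2 = D := by simp [hRdef]
  have hRn : ‖R‖ ^ 2 = X ^ 2 + Y ^ 2 + D ^ 2 := by rw [Space3.norm_sq_eq, hR0, hR1, hR2]
  have hρR : ρ < ‖R‖ := by
    rw [← hRn] at hR
    exact lt_of_pow_lt_pow_left₀ 2 (norm_nonneg _) hR
  have hRpos : 0 < ‖R‖ := hρ.trans_lt hρR
  -- The spherical angles of `R` fix the contour; `D > 0` keeps `φ` below `π/2` and the contour
  -- inside `Re k > 0`.
  set φ := Space3.theta R
  set β := Space3.phi R
  have hφ : 0 ≤ φ := Space3.theta_nonneg R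
  have hφ' : φ < Real.pi / 2 := by
    rw [show φ = Real.arccos (R 2 / ‖R‖) from rfl, Real.arccos_lt_pi_div_two, hR2]
    positivity
  have hcos : 0 < Real.cos φ :=
    Real.cos_pos_of_mem_Ioo ⟨by linarith [Real.pi_pos], by linarith⟩
  have hX : ‖R‖ * Real.sin φ * Real.cos β = X := hR0 ▸ Space3.norm_mul_sin_mul_cos R
  have hY : ‖R‖ * Real.sin φ * Real.sin β = Y := hR1 ▸ Space3.norm_mul_sin_mul_sin R
  have hZ : ‖R‖ * Real.cos φ = D := hR2 ▸ Space3.norm_mul_cos_theta R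
  have hRR : (X * Real.cos β + Y * Real.sin β) * Real.sin φ + D * Real.cos φ = ‖R‖ := by
    rw [← hX, ← hY, ← hZ]
    linear_combination ‖R‖ * Real.sin φ ^ 2 * Real.sin_sq_add_cos_sq β +
      ‖R‖ * Real.sin_sq_add_cos_sq φ
  -- The decay rate of the limit on the contour aligned with `R`. It equals `|R| - ρ s`, where `s ≤
  -- 1` is the cosine between `u` and `R`.
  have hRR' : 0 < ((X - ρ * u₀) * Real.cos β + (Y - ρ * u₁) * Real.sin β) * Real.sin φ +
      (D - ρ * u₂) * Real.cos φ := by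
    set s := (u₀ * Real.cos β + u₁ * Real.sin β) * Real.sin φ + u₂ * Real.cos φ with hs
    have hs1 : s ≤ 1 := by
      have h : s ^ 2 ≤ 1 := by
        have h1 := Real.sin_sq_add_cos_sq β
        have h2 := Real.sin_sq_add_cos_sq φ
        have h3 : s ^ 2 + ((u₀ * Real.cos β + u₁ * Real.sin β) * Real.cos φ - u₂ * Real.sin φ) ^ 2 +
            (u₁ * Real.cos β - u₀ * Real.sin β) ^ 2 = 1 := by
          rw [← hu]
          linear_combination ((u₀ * Real.cos β + u₁ * Real.sin β) ^ 2 + u₂ ^ 2) * h2 +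
            (u₀ ^ 2 + u₁ ^ 2) * h1
        nlinarith [sq_nonneg
          ((u₀ * Real.cos β + u₁ * Real.sin β) * Real.cos φ - u₂ * Real.sin φ),
          sq_nonneg (u₁ * Real.cos β - u₀ * Real.sin β)]
      exact (abs_le.mp (sq_le_one_iff_abs_le_one _ |>.mp h)).2
    have : ((X - ρ * u₀) * Real.cos β + (Y - ρ * u₁) * Real.sin β) * Real.sin φ +
      (D - ρ * u₂) * Real.cos φ = ‖R‖ - ρ * s := by rw [← hRR, hs]; ring
    rw [this]
    nlinarith
  have hF : ∀ n, IsAmplitude fun z =>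
      Φ z * SphericalFunctions.expLegendreTerm n (lam * ρ) (_root_.waveCos lam u₀ u₁ u₂ z) := fun n =>
    hΦ.mul ((waveCos hl.le u₀ u₁ u₂).expLegendreTerm n _)
  have hE : IsAmplitude fun z =>
      Φ z * Complex.exp ((_root_.complexRoot lam z.2.2 - z.2.2) * (ρ * u₂ : ℝ)) :=
    hΦ.mul (exp_root_sub hl.le _)
  have hEeq : ∀ z : ℂ × ℂ × ℂ, Φ z * Complex.exp ((lam * ρ : ℝ) * _root_.waveCos lam u₀ u₁ u₂ z) *
        wavePhase X Y D z =
      Φ z * Complex.exp ((_root_.complexRoot lam z.2.2 - z.2.2) * (ρ * u₂ : ℝ)) *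
        wavePhase (X - ρ * u₀) (Y - ρ * u₁) (D - ρ * u₂) z := by
    intro z
    rw [mul_assoc, exp_waveCos_mul_wavePhase hl, mul_assoc]
  have hRR0 := hRR.symm ▸ hRpos
  have cF : ∀ n, _ := fun n =>
    (hF n).sommerfeldConvergent_waveContour (β := β) hφ hφ' hD hRR0
  have cE := hE.sommerfeldConvergent_waveContour (β := β) hφ hφ' (sub_pos.mpr hDρ) hRR'
  simp only [hEeq]
  -- The limit and all terms are now moved to one common contour, where dominated convergence is
  -- applied.
  rw [← hE.sommerfeldIntegral_waveContour (β := β) hφ hφ' (sub_pos.mpr hDρ) hRR', cE.integral_eq]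
  simp only [← (hF _).sommerfeldIntegral_waveContour (β := β) hφ hφ' hD hRR0, (cF _).integral_eq]
  have hm : MeasurableSet (Ioi (0 : ℝ) ×ˢ Ioc (0 : ℝ) (2 * Real.pi)) :=
    measurableSet_Ioi.prod measurableSet_Ioc
  have hgap : 0 < (‖R‖ - ρ) / 2 := half_pos (sub_pos.mpr hρR)
  obtain ⟨C, hC⟩ := hΦ.bound_waveContour hφ' hgap
  set x := lam * ρ with hx
  have hx0 : 0 ≤ x := by positivity
  -- Here `κ/λ + 2` is the bound of the cosine plus the one of `norm_expLegendreTerm_le`. Since `x κ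
  -- / λ = ρ κ`, the total rate is `(|R| - ρ)/2 + ρ - |R|`, which is minus half of the gap.
  have hsum : ∀ κ : ℝ, HasSum (fun n : ℕ => C * Real.exp ((‖R‖ - ρ) / 2 * κ) *
      (Real.exp (x ^ 2 / 4) * ((x * (κ / lam + 2)) ^ n / n.factorial)) * Real.exp (-κ * ‖R‖))
      (C * Real.exp (x ^ 2 / 4 + 2 * x) * Real.exp (-((‖R‖ - ρ) / 2) * κ)) := by
    intro κ
    have h := (((SphericalFunctions.hasSum_pow_div_factorial (x * (κ / lam + 2))).mul_left
      (Real.exp (x ^ 2 / 4))).mul_left (C * Real.exp ((‖R‖ - ρ) / 2 * κ))).mul_right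
      (Real.exp (-κ * ‖R‖))
    have e : C * Real.exp ((‖R‖ - ρ) / 2 * κ) * (Real.exp (x ^ 2 / 4) *
        Real.exp (x * (κ / lam + 2))) * Real.exp (-κ * ‖R‖) =
        C * Real.exp (x ^ 2 / 4 + 2 * x) * Real.exp (-((‖R‖ - ρ) / 2) * κ) := by
      rw [mul_assoc C, mul_assoc C, mul_assoc C, ← Real.exp_add, ← Real.exp_add, ← Real.exp_add,
        ← Real.exp_add]
      congr 2
      rw [hx]
      field_simp
      ring
    rwa [e] at h
  refine hasSum_integral_of_dominated_convergence
    (fun n p => C * Real.exp ((‖R‖ - ρ) / 2 * p.1) *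
      (Real.exp (x ^ 2 / 4) * ((x * (p.1 / lam + 2)) ^ n / n.factorial)) * Real.exp (-p.1 * ‖R‖))
    (fun n => (cF n).aestronglyMeasurable) (fun n => ?_)
    (Eventually.of_forall fun p => (hsum p.1).summable) ?_ ?_
  · filter_upwards [ae_restrict_mem hm] with p hp
    obtain ⟨κ, α⟩ := p
    have hκ : 0 < κ := hp.1
    simp only [Function.uncurry_apply_pair, norm_mul, norm_wavePhase_waveContour, hRR]
    have h1 := hC β φ ⟨hφ, le_rfl⟩ κ hκ α
    have h2 := SphericalFunctions.norm_expLegendreTerm_le n hx0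
      (_root_.waveCos lam u₀ u₁ u₂ (waveContour β φ κ α))
    have h3 := norm_waveCos_waveContour_le hl hu β α hκ hcos
    have h4 : Real.exp (x ^ 2 / 4) * ((x * (‖_root_.waveCos lam u₀ u₁ u₂
        (waveContour β φ κ α)‖ + 1)) ^ n / n.factorial) ≤
        Real.exp (x ^ 2 / 4) * ((x * (κ / lam + 2)) ^ n / n.factorial) := by
      have : ‖_root_.waveCos lam u₀ u₁ u₂ (waveContour β φ κ α)‖ + 1 ≤ κ / lam + 2 := by linarith
      gcongr
    exact mul_le_mul_of_nonneg_right (mul_le_mul h1 (h2.trans h4) (norm_nonneg _)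
      ((norm_nonneg _).trans h1)) (Real.exp_pos _).le
  · simp only [(hsum _).tsum_eq]
    exact integrableOn_exp_sommerfeld _ hgap
  · filter_upwards with p
    simp only [Function.uncurry_def, ← hEeq]
    exact ((SphericalFunctions.hasSum_expLegendreTerm hx0 _).mul_left _).mul_right _

theorem SommerfeldConvergent.sum_const_mul {ι : Type} {s : Finset ι} {f : ι → ℝ → ℝ → ℂ}
    (hf : ∀ i ∈ s, SommerfeldConvergent (f i)) (c : ι → ℂ) :
    sommerfeldIntegral (fun κ α => ∑ i ∈ s, c i * f i κ α) =
      ∑ i ∈ s, c i * sommerfeldIntegral (f i) := by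
  have h : ∀ i ∈ s, SommerfeldConvergent fun κ α => c i * f i κ α := fun i hi =>
    (hf i hi).const_mul (c i)
  have hs : SommerfeldConvergent fun κ α => ∑ i ∈ s, c i * f i κ α := by
    have := integrable_finsetSum s h
    refine this.congr (Eventually.of_forall fun x => ?_)
    simp [Function.uncurry_def]
  rw [hs.integral_eq, Finset.sum_congr rfl fun i hi => by rw [(hf i hi).integral_eq]]
  simp only [Function.uncurry_def]
  refine (integral_finsetSum s (f := fun i (x : ℝ × ℝ) => c i * f i x.1 x.2) h).trans ?_
  exact Finset.sum_congr rfl fun i _ => integral_const_mul _ _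

/-! ### Legendre factors and cosines as functions of the wave vector. -/

theorem neg_one_zpow_eq_natAbs (m : ℤ) : (-1 : ℂ) ^ m = (-1) ^ m.natAbs := by
  rcases Int.natAbs_eq m with h | h
  · conv_lhs => rw [h]
    rw [zpow_natCast]
  · conv_lhs => rw [h]
    rw [zpow_neg, zpow_natCast, ← inv_pow]
    norm_num

/-- Orientation of the interface at which the reaction components arise. -/
def Side.sign : Side → ℝ
  | Side.one => 1
  | Side.two => -1

theorem Side.sign_eq (a : Side) : (a.sign : ℂ) = 1 ∨ (a.sign : ℂ) = -1 := by
  rcases a with _ | _ <;> simp [Side.sign]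

theorem Side.sign_mul_self (a : Side) : a.sign * a.sign = 1 := by
  rcases a with _ | _ <;> simp [Side.sign]

/-- The factor `P̂_n^m(√(λ² + k²) / λ) e^{i s m α}` (with `s = ±1`) as a function of the wave vector. -/
noncomputable def legendreWave (lam : ℝ) (s : ℤ) (n : ℕ) (m : ℤ) (z : ℂ × ℂ × ℂ) : ℂ :=
  SphericalFunctions.orderSign m * (SphericalFunctions.legendreNorm n m.natAbs : ℂ) *
    ((-Complex.I / lam * (z.1 + Complex.I * ((s * m.sign : ℤ) : ℂ) * z.2.1)) ^ m.natAbs *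
      SphericalFunctions.legendreDeriv n m.natAbs (complexRoot lam z.2.2 * (lam : ℂ)⁻¹))

theorem isAmplitude_legendreWave {lam : ℝ} (hl : 0 ≤ lam) (s : ℤ) (n : ℕ) (m : ℤ) :
    IsAmplitude (legendreWave lam s n m) :=
  (IsAmplitude.const _).mul ((((IsAmplitude.const _).mul (IsAmplitude.fst.add
    ((IsAmplitude.const _).mul IsAmplitude.snd_fst))).pow _).mul
    (((IsAmplitude.complexRoot hl).mul (IsAmplitude.const _)).legendreDeriv _ _))

theorem sqrtOneSubSq_root {lam κ : ℝ} (hl : 0 < lam) (hκ : 0 ≤ κ) :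
    SphericalFunctions.sqrtOneSubSq ((Real.sqrt (lam ^ 2 + κ ^ 2) / lam : ℝ) : ℂ) =
      -Complex.I * (κ / lam : ℝ) := by
  have h1 : 1 ≤ Real.sqrt (lam ^ 2 + κ ^ 2) / lam := by
    rw [one_le_div hl]
    exact Real.le_sqrt_of_sq_le (by nlinarith)
  rw [SphericalFunctions.sqrtOneSubSq_of_one_le h1]
  congr 2
  rw [div_pow, Real.sq_sqrt (by positivity)]
  rw [show (lam ^ 2 + κ ^ 2) / lam ^ 2 - 1 = (κ / lam) ^ 2 by field_simp; ring]
  exact Real.sqrt_sq (by positivity)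

/-- The branch gives `√(1 - w²) = -i κ/λ`, and `κ exp (± i α) = k_x ± i k_y`. The angular factor and
the root therefore merge into a polynomial in the wave vector, which is why the product is
holomorphic. -/
theorem legendreWave_realWave {lam κ : ℝ} (hl : 0 < lam) (hκ : 0 ≤ κ) {s : ℤ}
    (hs : s = 1 ∨ s = -1) {n : ℕ} {m : ℤ} (hm : |m| ≤ (n : ℤ)) (α : ℝ) :
    legendreWave lam s n m (realWave κ α) =
      SphericalFunctions.normLegendre n m ((Real.sqrt (lam ^ 2 + κ ^ 2) / lam : ℝ) : ℂ) *
        Complex.exp (Complex.I * ((s * m : ℤ) : ℂ) * α) := by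
  have hlz : (lam : ℂ) ≠ 0 := by exact_mod_cast hl.ne'
  rw [SphericalFunctions.normLegendre_eq hm, sqrtOneSubSq_root hl hκ, legendreWave]
  have e1 : complexRoot lam (realWave κ α).2.2 * (lam : ℂ)⁻¹ =
      ((Real.sqrt (lam ^ 2 + κ ^ 2) / lam : ℝ) : ℂ) := by
    rw [show (realWave κ α).2.2 = (κ : ℂ) from rfl, complexRoot.ofReal]
    push_cast
    rfl
  have e2 : ((-Complex.I / lam * ((realWave κ α).1 +
      Complex.I * ((s * m.sign : ℤ) : ℂ) * (realWave κ α).2.1)) ^ m.natAbs) =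
      (-Complex.I * (κ / lam : ℝ)) ^ m.natAbs *
        Complex.exp (Complex.I * ((s * m : ℤ) : ℂ) * α) := by
    rcases eq_or_ne m 0 with h0 | h0
    · subst h0; simp
    have hsm : s * m.sign = 1 ∨ s * m.sign = -1 := by
      rcases lt_or_gt_of_ne h0 with h | h
      · rw [Int.sign_eq_neg_one_of_neg h]; omega
      · rw [Int.sign_eq_one_of_pos h]; omega
    have hexp : Complex.exp (Complex.I * ((s * m : ℤ) : ℂ) * α) =
        Complex.exp (Complex.I * ((s * m.sign : ℤ) : ℂ) * α) ^ m.natAbs := by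
      rw [← Complex.exp_nat_mul]
      congr 1
      have : s * m = (s * m.sign) * (m.natAbs : ℤ) := by
        rw [mul_assoc, Int.sign_mul_natAbs]
      rw [this, Int.cast_mul, Int.cast_natCast]
      ring
    rw [hexp, ← mul_pow]
    congr 1
    have : Complex.exp (Complex.I * ((s * m.sign : ℤ) : ℂ) * α) =
        Real.cos α + Complex.I * ((s * m.sign : ℤ) : ℂ) * Real.sin α := by
      rcases hsm with h | h
      · rw [h]
        simp only [Int.cast_one, mul_one]
        rw [mul_comm Complex.I (α : ℂ), Complex.exp_mul_I]
        push_cast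
        ring
      · rw [h, show Complex.I * ((-1 : ℤ) : ℂ) * α = ((-α : ℝ) : ℂ) * Complex.I by push_cast; ring,
          Complex.exp_mul_I]
        push_cast
        rw [Complex.cos_neg, Complex.sin_neg]
        ring
    rw [this]
    simp only [realWave]
    push_cast
    field_simp
  rw [e1, e2]
  ring

/-- Matches the cosine of the contour argument with the argument produced by the addition theorem,
including its signs. -/
theorem waveCos_realWave {lam κ : ℝ} (hl : 0 < lam) (hκ : 0 ≤ κ) (e₁ e₂ θ φ α : ℝ) :
    waveCos lam (e₂ * (Real.sin θ * Real.cos φ)) (e₂ * (Real.sin θ * Real.sin φ))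
        (e₁ * Real.cos θ) (realWave κ α) =
      e₁ * Real.cos θ * ((Real.sqrt (lam ^ 2 + κ ^ 2) / lam : ℝ) : ℂ) +
        e₂ * Real.sin θ * SphericalFunctions.sqrtOneSubSq
          ((Real.sqrt (lam ^ 2 + κ ^ 2) / lam : ℝ) : ℂ) * Real.cos (α - φ) := by
  have hlz : (lam : ℂ) ≠ 0 := by exact_mod_cast hl.ne'
  rw [sqrtOneSubSq_root hl hκ, waveCos, Real.cos_sub,
    show (realWave κ α).2.2 = (κ : ℂ) from rfl, complexRoot.ofReal]
  simp only [realWave]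
  push_cast
  field_simp
  ring

theorem mul_waveCos_realWave {lam : ℝ} (hl : 0 < lam) (κ e₁ e₂ α : ℝ) (v : Space3) :
    ((lam * ‖v‖ : ℝ) : ℂ) * waveCos lam (e₂ * (Real.sin v.theta * Real.cos v.phi))
        (e₂ * (Real.sin v.theta * Real.sin v.phi)) (e₁ * Real.cos v.theta) (realWave κ α) =
      -Complex.I * (κ * (e₂ * (Real.cos α * v 0 + Real.sin α * v 1)) : ℝ) +
        (Real.sqrt (lam ^ 2 + κ ^ 2) * (e₁ * v 2) : ℝ) := by
  have hlz : (lam : ℂ) ≠ 0 := by exact_mod_cast hl.ne'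
  rw [waveCos, show (realWave κ α).2.2 = (κ : ℂ) from rfl, complexRoot.ofReal,
    ← v.norm_mul_cos_theta, ← v.norm_mul_sin_mul_cos, ← v.norm_mul_sin_mul_sin]
  simp only [realWave]
  push_cast
  field_simp

theorem sq_add_sq_direction {e₁ e₂ : ℝ} (h₁ : e₁ * e₁ = 1) (h₂ : e₂ * e₂ = 1) (θ φ : ℝ) :
    (e₂ * (Real.sin θ * Real.cos φ)) ^ 2 + (e₂ * (Real.sin θ * Real.sin φ)) ^ 2 +
      (e₁ * Real.cos θ) ^ 2 = 1 := by
  linear_combination (Real.sin θ ^ 2 * (Real.sin φ ^ 2 + Real.cos φ ^ 2)) * h₂ +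
    Real.cos θ ^ 2 * h₁ + Real.sin θ ^ 2 * Real.sin_sq_add_cos_sq φ + Real.sin_sq_add_cos_sq θ

/-! ### The integrands of the layered medium as amplitudes times plane waves. -/

namespace LayeredMedium

variable (M : LayeredMedium)

/-- Height of the interface at which the reaction components arise. -/
def interfaceHeight : Side → ℕ → ℝ
  | Side.one, ℓ => M.d ℓ
  | Side.two, ℓ => M.d (ℓ - 1)

theorem sourceCenterCond_iff (a : Side) (ℓ : ℕ) (s : Space3) :
    M.SourceCenterCond a ℓ s ↔ 0 < a.sign * (M.interfaceHeight a ℓ - s 2) := by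
  rcases a with _ | _ <;> simp [SourceCenterCond, Side.sign, interfaceHeight]

theorem targetCenterCond_iff (a : Side) (ℓ : ℕ) (t : Space3) :
    M.TargetCenterCond a ℓ t ↔ 0 < a.sign * (t 2 - M.interfaceHeight a ℓ) := by
  rcases a with _ | _ <;> simp [TargetCenterCond, Side.sign, interfaceHeight]

theorem targetCenterCond_of_inLayer {a : Side} {ℓ : ℕ} (ha : M.Admissible a ℓ) {t : Space3}
    (ht : M.InLayer ℓ (t 2)) : M.TargetCenterCond a ℓ t := by
  rcases a with _ | _
  · exact ht.1 ha
  · exact ht.2 ha.1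

theorem sourceCenterCond_polarizationSource (a : Side) {b : Side} (ℓ : ℕ) {ℓ' : ℕ}
    (hb : M.Admissible b ℓ') {r' : Space3} (hr' : M.InLayer ℓ' (r' 2)) :
    M.SourceCenterCond a ℓ (M.polarizationSource a b ℓ ℓ' r') := by
  rcases a with _ | _ <;> rcases b with _ | _ <;>
    simp only [SourceCenterCond, polarizationSource, PiLp.toLp_apply, Matrix.cons_val]
  · have := hr'.1 hb; linarith
  · have := hr'.2 hb.1; linarith
  · have := hr'.1 hb; linarith
  · have := hr'.2 hb.1; linarith

/-- The amplitude of the integrand common to all integrals, relative to a plane wave of the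
Laplace equation. -/
noncomputable def baseAmp (a b : Side) (ℓ ℓ' : ℕ) (t s : Space3) (z : ℂ × ℂ × ℂ) : ℂ :=
  z.2.2 / complexRoot (M.lam ℓ) z.2.2 * M.complexDensity a b ℓ ℓ' z.2.2 *
    (Complex.exp ((complexRoot (M.lam ℓ) z.2.2 - z.2.2) *
        (-(a.sign * (t 2 - M.interfaceHeight a ℓ)) : ℝ)) *
      Complex.exp ((complexRoot (M.lam ℓ') z.2.2 - z.2.2) *
        (-(a.sign * (M.interfaceHeight a ℓ - s 2)) : ℝ)))

theorem isAmplitude_baseAmp (a b : Side) {ℓ ℓ' : ℕ} (hℓ : ℓ ≤ M.L) (hℓ' : ℓ' ≤ M.L)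
    (t s : Space3) : IsAmplitude (M.baseAmp a b ℓ ℓ' t s) := by
  refine ((IsAmplitude.of_radial (f := fun k => k / complexRoot (M.lam ℓ) k) ?_ ?_).mul
    (IsAmplitude.of_radial (f := M.complexDensity a b ℓ ℓ') ?_ ?_)).mul
    ((IsAmplitude.exp_root_sub (M.lam_pos ℓ hℓ).le _).mul
      (IsAmplitude.exp_root_sub (M.lam_pos ℓ' hℓ').le _))
  · intro k hk
    exact differentiableAt_id.div (complexRoot.differentiableAt _ hk) (M.complexRoot_ne_zero ℓ hk)
  · intro c hc
    refine ⟨1 / c, by positivity, fun k hk hck => ?_⟩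
    have h1 := complexRoot.re_le (M.lam ℓ) hk
    have h2 := Complex.re_le_norm (complexRoot (M.lam ℓ) k)
    have h3 : ‖k / complexRoot (M.lam ℓ) k‖ ≤ 1 / c := by
      rw [norm_div, div_le_div_iff₀ (by linarith) hc]
      linarith
    linarith [norm_nonneg k]
  · exact fun k hk => M.differentiableAt_complexDensity a b ℓ hℓ' hk
  · intro c hc
    obtain ⟨C, hC⟩ := M.exists_bound_complexDensity a b hℓ hℓ' hc
    refine ⟨max C 0, le_max_right _ _, fun k hk hck => ?_⟩
    linarith [hC k hk hck, le_max_left C 0, norm_nonneg k]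

theorem expPol_eq (a : Side) (ℓ ℓ' : ℕ) (t s : Space3) (κ α : ℝ) :
    M.expPol a ℓ ℓ' t s κ α = Complex.exp (lateralPhase κ α t s -
      M.lamz ℓ κ * (a.sign * (t 2 - M.interfaceHeight a ℓ) : ℝ) -
      M.lamz ℓ' κ * (a.sign * (M.interfaceHeight a ℓ - s 2) : ℝ)) := by
  rcases a with _ | _ <;>
  · simp only [expPol, Side.sign, interfaceHeight]
    congr 1
    push_cast
    ring

/-- Splitting `λ_z = k + (λ_z - k)` in both layers, the parts with `k` add up to the single vertical
distance of `t` and `s`, and the rest is bounded. This is why the distance to the polarization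
source governs convergence. -/
theorem baseIntegrand_eq {a b : Side} {ℓ ℓ' : ℕ} (hℓ' : ℓ' ≤ M.L) (ha : M.Admissible a ℓ)
    (hb : M.Admissible b ℓ') (t s : Space3) {κ : ℝ} (hκ : 0 < κ) (α : ℝ) :
    M.baseIntegrand a b ℓ ℓ' t s κ α = M.baseAmp a b ℓ ℓ' t s (realWave κ α) *
      wavePhase (t 0 - s 0) (t 1 - s 1) (a.sign * (t 2 - s 2)) (realWave κ α) := by
  rw [baseIntegrand, baseAmp, show (realWave κ α).2.2 = (κ : ℂ) from rfl,
    M.complexDensity_ofReal hℓ' ha hb hκ, complexRoot_eq_lamz, complexRoot_eq_lamz, expPol_eq,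
    wavePhase, ← Complex.exp_add]
  have e : ∀ A B C E₁ E₂ : ℂ, E₁ = E₂ + C → A / B * Complex.exp E₁ * M.reactionDensity a b ℓ ℓ' κ =
      A / B * M.reactionDensity a b ℓ ℓ' κ * Complex.exp E₂ * Complex.exp C := by
    intro A B C E₁ E₂ h
    rw [h, Complex.exp_add]
    ring
  rw [Complex.ofReal_div]
  refine e _ _ _ _ _ ?_
  simp only [lateralPhase, realWave]
  push_cast
  ring

/-- The exponential of the cosine moves the source from `c` to `s`, using the wave number of the
source layer. Shifts of the target use that of layer `ℓ` and the opposite direction. -/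
theorem baseIntegrand_exp_source (a b : Side) {ℓ ℓ' : ℕ} (hℓ' : ℓ' ≤ M.L) (t s c : Space3)
    (κ α : ℝ) :
    M.baseIntegrand a b ℓ ℓ' t c κ α * Complex.exp ((M.lam ℓ' * ‖s - c‖ : ℝ) *
      waveCos (M.lam ℓ') (1 * (Real.sin (s - c).theta * Real.cos (s - c).phi))
        (1 * (Real.sin (s - c).theta * Real.sin (s - c).phi)) (a.sign * Real.cos (s - c).theta)
        (realWave κ α)) = M.baseIntegrand a b ℓ ℓ' t s κ α := by
  rw [mul_waveCos_realWave (M.lam_pos ℓ' hℓ'), baseIntegrand, baseIntegrand, mul_right_comm,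
    mul_assoc _ (M.expPol _ _ _ _ _ _ _), expPol_eq, expPol_eq, ← Complex.exp_add]
  congr 3
  simp only [lateralPhase, lamz, PiLp.sub_apply]
  push_cast
  ring

theorem baseIntegrand_exp_target (a b : Side) {ℓ ℓ' : ℕ} (hℓ : ℓ ≤ M.L) (t s r : Space3)
    (κ α : ℝ) :
    M.baseIntegrand a b ℓ ℓ' t s κ α * Complex.exp ((M.lam ℓ * ‖r - t‖ : ℝ) *
      waveCos (M.lam ℓ) (-1 * (Real.sin (r - t).theta * Real.cos (r - t).phi))
        (-1 * (Real.sin (r - t).theta * Real.sin (r - t).phi)) (-a.sign * Real.cos (r - t).theta)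
        (realWave κ α)) = M.baseIntegrand a b ℓ ℓ' r s κ α := by
  rw [mul_waveCos_realWave (M.lam_pos ℓ hℓ), baseIntegrand, baseIntegrand, mul_right_comm,
    mul_assoc _ (M.expPol _ _ _ _ _ _ _), expPol_eq, expPol_eq, ← Complex.exp_add]
  congr 3
  simp only [lateralPhase, lamz, PiLp.sub_apply]
  push_cast
  ring

end LayeredMedium

/-! ### Expansions about source and target centers. -/

namespace LayeredMedium

variable (M : LayeredMedium)

theorem sommerfeldConvergent_base_mul {a b : Side} {ℓ ℓ' : ℕ} (hℓ : ℓ ≤ M.L) (hℓ' : ℓ' ≤ M.L)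
    (ha : M.Admissible a ℓ) (hb : M.Admissible b ℓ') {t s : Space3}
    (ht : M.TargetCenterCond a ℓ t) (hs : M.SourceCenterCond a ℓ s) {g : ℂ × ℂ × ℂ → ℂ}
    (hg : IsAmplitude g) :
    SommerfeldConvergent fun κ α => M.baseIntegrand a b ℓ ℓ' t s κ α * g (realWave κ α) := by
  rw [targetCenterCond_iff] at ht
  rw [sourceCenterCond_iff] at hs
  refine SommerfeldConvergent.congr (((M.isAmplitude_baseAmp a b hℓ hℓ' t s).mul hg).sommerfeldConvergent
    (t 0 - s 0) (t 1 - s 1) (D := a.sign * (t 2 - s 2)) (by linarith)) fun κ hκ α => ?_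
  rw [M.baseIntegrand_eq hℓ' ha hb t s hκ]
  ring

/-- Expansion of a Sommerfeld integral about a source center. -/
theorem hasSum_source_expansion {a b : Side} {ℓ ℓ' : ℕ} (hℓ : ℓ ≤ M.L) (hℓ' : ℓ' ≤ M.L)
    (ha : M.Admissible a ℓ) (hb : M.Admissible b ℓ') {t s c : Space3}
    (ht : M.TargetCenterCond a ℓ t) (hs : M.SourceCenterCond a ℓ s)
    (hc : M.SourceCenterCond a ℓ c) (h : ‖s - c‖ < ‖t - c‖) {g : ℂ × ℂ × ℂ → ℂ}
    (hg : IsAmplitude g) :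
    HasSum (fun n : ℕ => ∑ m ∈ Finset.Icc (-(n : ℤ)) n, M.multipoleCoeff ℓ' n m s c *
      ((a.sign : ℂ) ^ (n + m.natAbs) * sommerfeldIntegral fun κ α =>
        M.baseIntegrand a b ℓ ℓ' t c κ α *
          (g (realWave κ α) * legendreWave (M.lam ℓ') 1 n m (realWave κ α))))
      (sommerfeldIntegral fun κ α => M.baseIntegrand a b ℓ ℓ' t s κ α * g (realWave κ α)) := by
  have ht' := (M.targetCenterCond_iff a ℓ t).mp ht
  have hs' := (M.sourceCenterCond_iff a ℓ s).mp hs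
  have hc' := (M.sourceCenterCond_iff a ℓ c).mp hc
  have hlam := M.lam_pos ℓ' hℓ'
  have hz := (s - c).norm_mul_cos_theta
  have hn : ‖s - c‖ ^ 2 < ‖t - c‖ ^ 2 := by gcongr
  rw [(t - c).norm_sq_eq] at hn
  simp only [PiLp.sub_apply] at hn hz
  -- The vertical condition holds because `D - ρ u₂ = ± (t 2 - s 2)` is positive: `s` and `t` lie on
  -- opposite sides of the interface.
  have H := ((M.isAmplitude_baseAmp a b hℓ hℓ' t c).mul hg).hasSum_expansion hlam
    (sq_add_sq_direction a.sign_mul_self (one_mul 1) (s - c).theta (s - c).phi)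
    (ρ := ‖s - c‖) (X := t 0 - c 0) (Y := t 1 - c 1) (D := a.sign * (t 2 - c 2)) (norm_nonneg _)
    (by linarith) (by rw [mul_left_comm, hz]; linarith)
    (by rw [mul_pow, pow_two a.sign, a.sign_mul_self]; linarith)
  have hlim : ∀ κ, 0 < κ → ∀ α, M.baseAmp a b ℓ ℓ' t c (realWave κ α) * g (realWave κ α) *
      Complex.exp ((M.lam ℓ' * ‖s - c‖ : ℝ) *
        waveCos (M.lam ℓ') (1 * (Real.sin (s - c).theta * Real.cos (s - c).phi))
          (1 * (Real.sin (s - c).theta * Real.sin (s - c).phi)) (a.sign * Real.cos (s - c).theta)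
          (realWave κ α)) *
      wavePhase (t 0 - c 0) (t 1 - c 1) (a.sign * (t 2 - c 2)) (realWave κ α) =
      M.baseIntegrand a b ℓ ℓ' t s κ α * g (realWave κ α) := by
    intro κ hκ α
    rw [← M.baseIntegrand_exp_source a b hℓ' t s c, M.baseIntegrand_eq hℓ' ha hb t c hκ]
    ring
  rw [sommerfeldIntegral_congr hlim] at H
  refine Eq.mpr (congrArg (fun f => HasSum f _) (funext fun n => ?_)) H
  simp only [← mul_assoc (M.multipoleCoeff _ _ _ _ _)]
  rw [← SommerfeldConvergent.sum_const_mul fun m _ => M.sommerfeldConvergent_base_mul hℓ hℓ' ha hb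
    ht hc (hg.mul (isAmplitude_legendreWave hlam.le 1 n m))]
  refine sommerfeldIntegral_congr fun κ hκ α => ?_
  -- The addition theorem splits `P_n` of the cosine into spherical harmonics of `s - c` and
  -- Legendre factors of the wave vector.
  have hsum := SphericalFunctions.sum_conj_sphHarmAt_mul a.sign_eq
    (e₂ := ((1 : ℝ) : ℂ)) (by simp) n (s - c)
    ((Real.sqrt (M.lam ℓ' ^ 2 + κ ^ 2) / M.lam ℓ' : ℝ) : ℂ) α
  rw [← waveCos_realWave hlam hκ.le] at hsum
  have hπ : (Real.pi : ℂ) ≠ 0 := by exact_mod_cast Real.pi_ne_zero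
  have hterm : SphericalFunctions.expLegendreTerm n (M.lam ℓ' * ‖s - c‖)
      (waveCos (M.lam ℓ') (1 * (Real.sin (s - c).theta * Real.cos (s - c).phi))
        (1 * (Real.sin (s - c).theta * Real.sin (s - c).phi)) (a.sign * Real.cos (s - c).theta)
        (realWave κ α)) = 4 * Real.pi *
      (SphericalFunctions.sphBesselI n (M.lam ℓ' * ‖s - c‖) : ℂ) *
      ((2 * (n : ℂ) + 1) / (4 * (Real.pi : ℂ)) * SphericalFunctions.legendreDeriv n 0
        (waveCos (M.lam ℓ') (1 * (Real.sin (s - c).theta * Real.cos (s - c).phi))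
        (1 * (Real.sin (s - c).theta * Real.sin (s - c).phi)) (a.sign * Real.cos (s - c).theta)
        (realWave κ α))) := by
    rw [SphericalFunctions.expLegendreTerm]
    field_simp
  rw [hterm, ← hsum, Finset.mul_sum, Finset.mul_sum, Finset.sum_mul]
  refine Finset.sum_congr rfl fun m hm => ?_
  rw [M.baseIntegrand_eq hℓ' ha hb t c hκ, legendreWave_realWave hlam hκ.le (Or.inl rfl)
    (abs_le.mpr (Finset.mem_Icc.mp hm)), multipoleCoeff, one_mul, Complex.ofReal_one, one_pow]
  ring

/-- Expansion of a Sommerfeld integral about a target center. -/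
theorem hasSum_target_expansion {a b : Side} {ℓ ℓ' : ℕ} (hℓ : ℓ ≤ M.L) (hℓ' : ℓ' ≤ M.L)
    (ha : M.Admissible a ℓ) (hb : M.Admissible b ℓ') {t s r : Space3}
    (ht : M.TargetCenterCond a ℓ t) (hs : M.SourceCenterCond a ℓ s)
    (hr : M.TargetCenterCond a ℓ r) (h : ‖r - t‖ < ‖s - t‖) :
    HasSum (fun n : ℕ => ∑ m ∈ Finset.Icc (-(n : ℤ)) n,
      ((-a.sign : ℝ) : ℂ) ^ (n + m.natAbs) * ((-1 : ℝ) : ℂ) ^ m.natAbs *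
        (4 * Real.pi * (SphericalFunctions.sphBesselI n (M.lam ℓ * ‖r - t‖) : ℂ) *
          SphericalFunctions.sphHarmAt n m (r - t)) *
        sommerfeldIntegral fun κ α => M.baseIntegrand a b ℓ ℓ' t s κ α *
          legendreWave (M.lam ℓ) (-1) n m (realWave κ α))
      (sommerfeldIntegral (M.baseIntegrand a b ℓ ℓ' r s)) := by
  have ht' := (M.targetCenterCond_iff a ℓ t).mp ht
  have hs' := (M.sourceCenterCond_iff a ℓ s).mp hs
  have hr' := (M.targetCenterCond_iff a ℓ r).mp hr
  have hlam := M.lam_pos ℓ hℓ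
  have hz := (r - t).norm_mul_cos_theta
  have hn : ‖r - t‖ ^ 2 < ‖s - t‖ ^ 2 := by gcongr
  rw [(s - t).norm_sq_eq] at hn
  simp only [PiLp.sub_apply] at hn hz
  -- A displacement of the target enters the exponent with the sign opposite to one of the source,
  -- hence the signs `-a.sign` and `-1`.
  have H := (M.isAmplitude_baseAmp a b hℓ hℓ' t s).hasSum_expansion hlam
    (sq_add_sq_direction (e₁ := -a.sign) (e₂ := -1) (by rw [neg_mul_neg, a.sign_mul_self])
      (by norm_num) (r - t).theta (r - t).phi)
    (ρ := ‖r - t‖) (X := t 0 - s 0) (Y := t 1 - s 1) (D := a.sign * (t 2 - s 2)) (norm_nonneg _)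
    (by linarith) (by rw [mul_left_comm, hz]; linarith)
    (by rw [mul_pow, pow_two a.sign, a.sign_mul_self]; linarith)
  have hlim : ∀ κ, 0 < κ → ∀ α, M.baseAmp a b ℓ ℓ' t s (realWave κ α) *
      Complex.exp ((M.lam ℓ * ‖r - t‖ : ℝ) *
        waveCos (M.lam ℓ) (-1 * (Real.sin (r - t).theta * Real.cos (r - t).phi))
          (-1 * (Real.sin (r - t).theta * Real.sin (r - t).phi)) (-a.sign * Real.cos (r - t).theta)
          (realWave κ α)) *
      wavePhase (t 0 - s 0) (t 1 - s 1) (a.sign * (t 2 - s 2)) (realWave κ α) =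
      M.baseIntegrand a b ℓ ℓ' r s κ α := by
    intro κ hκ α
    rw [← M.baseIntegrand_exp_target a b hℓ t s r, M.baseIntegrand_eq hℓ' ha hb t s hκ]
    ring
  rw [sommerfeldIntegral_congr hlim] at H
  refine Eq.mpr (congrArg (fun f => HasSum f _) (funext fun n => ?_)) H
  rw [← SommerfeldConvergent.sum_const_mul fun m _ => M.sommerfeldConvergent_base_mul hℓ hℓ' ha hb
    ht hs (isAmplitude_legendreWave hlam.le (-1) n m)]
  refine sommerfeldIntegral_congr fun κ hκ α => ?_
  have hsum := SphericalFunctions.sum_sphHarmAt_mul (e₁ := ((-a.sign : ℝ) : ℂ))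
    (e₂ := ((-1 : ℝ) : ℂ)) (by rcases a with _ | _ <;> simp [Side.sign]) (by simp) n (r - t)
    ((Real.sqrt (M.lam ℓ ^ 2 + κ ^ 2) / M.lam ℓ : ℝ) : ℂ) α
  rw [← waveCos_realWave hlam hκ.le] at hsum
  have hπ : (Real.pi : ℂ) ≠ 0 := by exact_mod_cast Real.pi_ne_zero
  have hterm : SphericalFunctions.expLegendreTerm n (M.lam ℓ * ‖r - t‖)
      (waveCos (M.lam ℓ) (-1 * (Real.sin (r - t).theta * Real.cos (r - t).phi))
        (-1 * (Real.sin (r - t).theta * Real.sin (r - t).phi)) (-a.sign * Real.cos (r - t).theta)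
        (realWave κ α)) = 4 * Real.pi *
      (SphericalFunctions.sphBesselI n (M.lam ℓ * ‖r - t‖) : ℂ) *
      ((2 * (n : ℂ) + 1) / (4 * (Real.pi : ℂ)) * SphericalFunctions.legendreDeriv n 0
        (waveCos (M.lam ℓ) (-1 * (Real.sin (r - t).theta * Real.cos (r - t).phi))
        (-1 * (Real.sin (r - t).theta * Real.sin (r - t).phi)) (-a.sign * Real.cos (r - t).theta)
        (realWave κ α))) := by
    rw [SphericalFunctions.expLegendreTerm]
    field_simp
  rw [hterm, ← hsum, Finset.mul_sum, Finset.mul_sum, Finset.sum_mul]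
  refine Finset.sum_congr rfl fun m hm => ?_
  rw [M.baseIntegrand_eq hℓ' ha hb t s hκ, legendreWave_realWave hlam hκ.le (Or.inr rfl)
    (abs_le.mpr (Finset.mem_Icc.mp hm)),
    show Complex.I * ((-1 * m : ℤ) : ℂ) * α = -(Complex.I * m * α) by push_cast; ring]
  ring

theorem multipoleIntegrand_eq (a b : Side) {ℓ ℓ' n : ℕ} {m : ℤ} (hℓ' : ℓ' ≤ M.L)
    (hm : |m| ≤ (n : ℤ)) (t c : Space3) {κ : ℝ} (hκ : 0 < κ) (α : ℝ) :
    M.multipoleIntegrand a b ℓ ℓ' n m t c κ α =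
      M.baseIntegrand a b ℓ ℓ' t c κ α * legendreWave (M.lam ℓ') 1 n m (realWave κ α) := by
  rw [multipoleIntegrand, legendreWave_realWave (M.lam_pos ℓ' hℓ') hκ.le (Or.inl rfl) hm, one_mul,
    mul_assoc]
  rfl

theorem localIntegrand_eq (a b : Side) {ℓ ℓ' n : ℕ} {m : ℤ} (hℓ : ℓ ≤ M.L)
    (hm : |m| ≤ (n : ℤ)) (t s : Space3) {κ : ℝ} (hκ : 0 < κ) (α : ℝ) :
    M.localIntegrand a b ℓ ℓ' n m t s κ α =
      M.baseIntegrand a b ℓ ℓ' t s κ α * legendreWave (M.lam ℓ) (-1) n m (realWave κ α) := by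
  rw [localIntegrand, legendreWave_realWave (M.lam_pos ℓ hℓ) hκ.le (Or.inr rfl) hm, mul_assoc,
    show Complex.I * ((-1 * m : ℤ) : ℂ) * α = -(Complex.I * m * α) by push_cast; ring]
  rfl

theorem translationIntegrand_eq (a b : Side) {ℓ ℓ' n ν : ℕ} {m μ : ℤ} (hℓ : ℓ ≤ M.L)
    (hℓ' : ℓ' ≤ M.L) (hm : |m| ≤ (n : ℤ)) (hμ : |μ| ≤ (ν : ℤ)) (t c : Space3) {κ : ℝ}
    (hκ : 0 < κ) (α : ℝ) :
    M.translationIntegrand a b ℓ ℓ' n m ν μ t c κ α = M.baseIntegrand a b ℓ ℓ' t c κ α *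
      (legendreWave (M.lam ℓ) (-1) n m (realWave κ α) *
        legendreWave (M.lam ℓ') 1 ν μ (realWave κ α)) := by
  rw [translationIntegrand, legendreWave_realWave (M.lam_pos ℓ hℓ) hκ.le (Or.inr rfl) hm,
    legendreWave_realWave (M.lam_pos ℓ' hℓ') hκ.le (Or.inl rfl) hμ, mul_mul_mul_comm,
    ← Complex.exp_add, mul_assoc,
    show Complex.I * ((-1 * m : ℤ) : ℂ) * α + Complex.I * ((1 * μ : ℤ) : ℂ) * α =
      Complex.I * ((μ : ℂ) - m) * α by push_cast; ring]
  rfl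

/-- The polarization source has the lateral position of the source and lies across the target
interface at the height `B_𝔟`, so the exponents are literally equal. -/
theorem reactionComponent_eq_reactionPol (a b : Side) (ℓ ℓ' : ℕ) (r r' : Space3) :
    M.reactionComponent a b ℓ ℓ' r r' =
      M.reactionPol a b ℓ ℓ' r (M.polarizationSource a b ℓ ℓ' r') := by
  rw [reactionComponent, reactionPol]
  congr 2
  funext κ α
  rw [baseIntegrand]
  congr 2
  rcases a with _ | _ <;> rcases b with _ | _ <;>
  · simp only [expSource, expPol, polarizationSource, lateralPhase, PiLp.toLp_apply,
      Matrix.cons_val]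
    congr 1
    push_cast
    ring

theorem multipoleBasis_eq {a b : Side} {ℓ ℓ' n : ℕ} {m : ℤ} (hℓ' : ℓ' ≤ M.L)
    (hm : |m| ≤ (n : ℤ)) (t c : Space3) :
    M.multipoleBasis a b ℓ ℓ' n m t c = 1 / (8 * (Real.pi : ℂ) ^ 2) *
      ((a.sign : ℂ) ^ (n + m.natAbs) * sommerfeldIntegral fun κ α =>
        M.baseIntegrand a b ℓ ℓ' t c κ α * legendreWave (M.lam ℓ') 1 n m (realWave κ α)) := by
  rw [multipoleBasis.eq_def, sommerfeldIntegral_congr fun κ hκ α =>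
    M.multipoleIntegrand_eq a b hℓ' hm t c hκ α]
  rcases a with _ | _
  · simp [Side.sign]
  · simp only [Side.sign, Complex.ofReal_neg, Complex.ofReal_one]
    rw [zpow_add₀ (by norm_num), zpow_natCast, neg_one_zpow_eq_natAbs, pow_add]
    ring

/-- Identifies the signs produced by the target expansion with the prefactor `t^𝔞_{nm}`. -/
theorem neg_sign_pow_mul (a : Side) (n : ℕ) (m : ℤ) :
    ((-a.sign : ℝ) : ℂ) ^ (n + m.natAbs) * ((-1 : ℝ) : ℂ) ^ m.natAbs =
      match a with
      | Side.one => (-1 : ℂ) ^ n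
      | Side.two => (-1 : ℂ) ^ m := by
  rcases a with _ | _
  · simp [Side.sign, pow_add, mul_assoc, ← mul_pow]
  · simp [Side.sign, neg_one_zpow_eq_natAbs]

theorem localCoeff_eq {a b : Side} {ℓ ℓ' n : ℕ} {m : ℤ} (hℓ : ℓ ≤ M.L)
    (hm : |m| ≤ (n : ℤ)) (t s : Space3) :
    M.localCoeff a b ℓ ℓ' n m t s = ((-a.sign : ℝ) : ℂ) ^ (n + m.natAbs) *
      ((-1 : ℝ) : ℂ) ^ m.natAbs / (2 * (Real.pi : ℂ)) * sommerfeldIntegral fun κ α =>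
        M.baseIntegrand a b ℓ ℓ' t s κ α * legendreWave (M.lam ℓ) (-1) n m (realWave κ α) := by
  rw [localCoeff.eq_def, sommerfeldIntegral_congr fun κ hκ α =>
    M.localIntegrand_eq a b hℓ hm t s hκ α, neg_sign_pow_mul]

theorem translationCoeff_eq {a b : Side} {ℓ ℓ' n ν : ℕ} {m μ : ℤ} (hℓ : ℓ ≤ M.L)
    (hℓ' : ℓ' ≤ M.L) (hm : |m| ≤ (n : ℤ)) (hμ : |μ| ≤ (ν : ℤ)) (t c : Space3) :
    M.translationCoeff a b ℓ ℓ' n m ν μ t c = ((-a.sign : ℝ) : ℂ) ^ (n + m.natAbs) *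
      ((-1 : ℝ) : ℂ) ^ m.natAbs / (2 * (Real.pi : ℂ)) *
      ((a.sign : ℂ) ^ (ν + μ.natAbs) * sommerfeldIntegral fun κ α =>
        M.baseIntegrand a b ℓ ℓ' t c κ α * (legendreWave (M.lam ℓ) (-1) n m (realWave κ α) *
          legendreWave (M.lam ℓ') 1 ν μ (realWave κ α))) := by
  rw [translationCoeff.eq_def, sommerfeldIntegral_congr fun κ hκ α =>
    M.translationIntegrand_eq a b hℓ hℓ' hm hμ t c hκ α, neg_sign_pow_mul]
  rcases a with _ | _
  · simp [Side.sign]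
  · simp only [Side.sign, Complex.ofReal_neg, Complex.ofReal_one]
    rw [zpow_add₀ (by norm_num), zpow_add₀ (by norm_num), zpow_natCast, neg_one_zpow_eq_natAbs μ,
      pow_add]
    ring

end LayeredMedium

/-! ### The main theorem; in `ℂ`, `HasSum` over `ℕ` includes absolute convergence. -/

theorem mainTheorem3 (M : LayeredMedium) (a b : Side) (ℓ ℓ' : ℕ) (hℓ : ℓ ≤ M.L) (hℓ' : ℓ' ≤ M.L)
    (ha : M.Admissible a ℓ) (hb : M.Admissible b ℓ') (r r' rc rt : Space3)
    (hr : M.InLayer ℓ (r 2)) (hr' : M.InLayer ℓ' (r' 2))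
    (hrc : M.SourceCenterCond a ℓ rc) (hrt : M.TargetCenterCond a ℓ rt) :
    -- the reaction component in terms of the polarization source; all integrals converge
    (SommerfeldConvergent (M.baseIntegrand a b ℓ ℓ' r (M.polarizationSource a b ℓ ℓ' r')) ∧
      M.reactionComponent a b ℓ ℓ' r r' =
        M.reactionPol a b ℓ ℓ' r (M.polarizationSource a b ℓ ℓ' r') ∧
      (∀ (n : ℕ) (m : ℤ), |m| ≤ (n : ℤ) →
        SommerfeldConvergent (M.multipoleIntegrand a b ℓ ℓ' n m r rc) ∧
        SommerfeldConvergent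
          (M.localIntegrand a b ℓ ℓ' n m rt (M.polarizationSource a b ℓ ℓ' r')) ∧
        ∀ (ν : ℕ) (μ : ℤ), |μ| ≤ (ν : ℤ) →
          SommerfeldConvergent (M.translationIntegrand a b ℓ ℓ' n m ν μ rt rc))) ∧
    -- multipole expansion
    (‖M.polarizationSource a b ℓ ℓ' r' - rc‖ < ‖r - rc‖ →
      HasSum (fun n : ℕ => ∑ m ∈ Finset.Icc (-(n : ℤ)) n,
          M.multipoleCoeff ℓ' n m (M.polarizationSource a b ℓ ℓ' r') rc *
            M.multipoleBasis a b ℓ ℓ' n m r rc)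
        (M.reactionPol a b ℓ ℓ' r (M.polarizationSource a b ℓ ℓ' r'))) ∧
    -- local expansion
    (‖r - rt‖ < ‖M.polarizationSource a b ℓ ℓ' r' - rt‖ →
      HasSum (fun n : ℕ => ∑ m ∈ Finset.Icc (-(n : ℤ)) n,
          M.localCoeff a b ℓ ℓ' n m rt (M.polarizationSource a b ℓ ℓ' r') *
            (SphericalFunctions.sphBesselI n (M.lam ℓ * ‖r - rt‖) : ℂ) *
            SphericalFunctions.sphHarmAt n m (r - rt))
        (M.reactionPol a b ℓ ℓ' r (M.polarizationSource a b ℓ ℓ' r'))) ∧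
    -- multipole-to-local translation
    (‖M.polarizationSource a b ℓ ℓ' r' - rc‖ < ‖rt - rc‖ →
      ∀ (n : ℕ) (m : ℤ), |m| ≤ (n : ℤ) →
        HasSum (fun ν : ℕ => ∑ μ ∈ Finset.Icc (-(ν : ℤ)) ν,
            M.translationCoeff a b ℓ ℓ' n m ν μ rt rc *
              M.multipoleCoeff ℓ' ν μ (M.polarizationSource a b ℓ ℓ' r') rc)
          (M.localCoeff a b ℓ ℓ' n m rt (M.polarizationSource a b ℓ ℓ' r'))) := by
  have hrt' := M.targetCenterCond_of_inLayer ha hr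
  have hs := M.sourceCenterCond_polarizationSource a ℓ hb hr'
  have hπ : (Real.pi : ℂ) ≠ 0 := by exact_mod_cast Real.pi_ne_zero
  set s := M.polarizationSource a b ℓ ℓ' r'
  have amp := fun n m => isAmplitude_legendreWave (M.lam_pos ℓ hℓ).le (-1) n m
  have amp' := fun n m => isAmplitude_legendreWave (M.lam_pos ℓ' hℓ').le 1 n m
  refine ⟨⟨?_, M.reactionComponent_eq_reactionPol a b ℓ ℓ' r r', fun n m hm => ⟨?_, ?_,
    fun ν μ hμ => ?_⟩⟩, fun h => ?_, fun h => ?_, fun h n m hm => ?_⟩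
  · exact (M.sommerfeldConvergent_base_mul hℓ hℓ' ha hb hrt' hs (IsAmplitude.const 1)).congr
      fun κ _ α => mul_one _
  · exact (M.sommerfeldConvergent_base_mul hℓ hℓ' ha hb hrt' hrc (amp' n m)).congr
      fun κ hκ α => (M.multipoleIntegrand_eq a b hℓ' hm r rc hκ α).symm
  · exact (M.sommerfeldConvergent_base_mul hℓ hℓ' ha hb hrt hs (amp n m)).congr
      fun κ hκ α => (M.localIntegrand_eq a b hℓ hm rt s hκ α).symm
  · exact (M.sommerfeldConvergent_base_mul hℓ hℓ' ha hb hrt hrc ((amp n m).mul (amp' ν μ))).congr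
      fun κ hκ α => (M.translationIntegrand_eq a b hℓ hℓ' hm hμ rt rc hκ α).symm
  · have H := (M.hasSum_source_expansion hℓ hℓ' ha hb hrt' hs hrc h
      (IsAmplitude.const 1)).mul_left (1 / (8 * (Real.pi : ℂ) ^ 2))
    simp only [mul_one, one_mul] at H
    refine Eq.mpr (congrArg (fun f => HasSum f _) (funext fun n => ?_)) H
    rw [Finset.mul_sum]
    refine Finset.sum_congr rfl fun m hm => ?_
    rw [M.multipoleBasis_eq hℓ' (abs_le.mpr (Finset.mem_Icc.mp hm))]
    ring
  -- The `4π` of the expansion turns the prefactor `1/(8π²)` into the `1/(2π)` of the local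
  -- coefficient.
  · have H := (M.hasSum_target_expansion hℓ hℓ' ha hb hrt hs hrt' h).mul_left
      (1 / (8 * (Real.pi : ℂ) ^ 2))
    refine Eq.mpr (congrArg (fun f => HasSum f _) (funext fun n => ?_)) H
    rw [Finset.mul_sum]
    refine Finset.sum_congr rfl fun m hm => ?_
    rw [M.localCoeff_eq hℓ (abs_le.mpr (Finset.mem_Icc.mp hm))]
    field_simp
    ring
  -- The local coefficient is itself a Sommerfeld integral with source `s`. Its Legendre factor is a
  -- further amplitude, so the source expansion applies with target `rt`.
  · have H := (M.hasSum_source_expansion hℓ hℓ' ha hb hrt hs hrc h (amp n m)).mul_left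
      (((-a.sign : ℝ) : ℂ) ^ (n + m.natAbs) * ((-1 : ℝ) : ℂ) ^ m.natAbs / (2 * (Real.pi : ℂ)))
    rw [M.localCoeff_eq hℓ hm]
    refine Eq.mpr (congrArg (fun f => HasSum f _) (funext fun ν => ?_)) H
    rw [Finset.mul_sum]
    refine Finset.sum_congr rfl fun μ hμ => ?_
    rw [M.translationCoeff_eq hℓ hℓ' hm (abs_le.mpr (Finset.mem_Icc.mp hμ))]
    ring
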